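/- Axially symmetric functions on the unit sphere $\mathbb S^2$ (round metric $\gamma$, Laplacian $\Delta$) are considered, with $Y_{\ell 0}$ the zonal spherical harmonics and $\mathscr P_\ell,\mathscr Q_\ell$ the Legendre functions of the first and second kind. (1) A field $\varphi$ on $(0,\pi)\times\mathbb S^2$ is a smooth axially symmetric solution of $\ddot\varphi+\cot t\,\dot\varphi-\Delta\varphi=0$ (the massless Klein–Gordon equation of the metric $\sin^2 t\,(-dt^2+\gamma)$) if and only if $\xi=\sqrt{\sin t}\,\varphi$ is a smooth axially symmetric solution of $$-\ddot\xi+\Delta\xi=\tfrac14(1+\csc^2 t)\,\xi ,$$ a Klein–Gordon equation with time-dependent mass term $\tfrac14(1+\csc^2t)$ on the static background $-dt^2+\gamma$. Let $\mathcal S_\xi$ be the space of these $\xi$. Let $\rho_\ell>0$ and $\nu_\ell\in\mathbb R$ ($\ell\in\mathbb N_0$) be arbitrary. They parametrize the $SO(3)$-invariant complex structures through the positive-frequency modes $z_\ell Y_{\ell0}$, where $$z_\ell(t)=\sqrt{\tfrac{\sin t}{2}}\,\Big(\rho_\ell\,\mathscr P_\ell(\cos t)+(\nu_\ell+i\rho_\ell^{-1})\,\mathscr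 Q_\ell(\cos t)\Big).$$ For $\xi\in\mathcal S_\xi$ with $\xi(t,\cdot)=\sum_\ell\big(b_\ell z_\ell(t)+\overline{b_\ell z_\ell(t)}\big)Y_{\ell0}$, put $\kappa(\xi)=(b_\ell)_\ell$ and $\|\kappa(\xi)\|^2=\sum_\ell|b_\ell|^2$; the one-particle space is $\ell^2(\mathbb C)$, and $\mathscr F_+$ is the symmetric Fock space over it. For $t_0,t_1\in(0,\pi)$ let $\mathcal T_{(t_1,t_0)}$ map $\xi\in\mathcal S_\xi$ to the solution which at time $t_0$ has the Cauchy data $\big(\xi,\ \dot\xi-\tfrac12\cot t\,\xi\big)$ that $\xi$ has at time $t_1$, and let $$\beta^\xi_\ell(t_1,t_0)=i\,\bar z_\ell(t_0)\big(\dot{\bar z}_\ell-\tfrac12\cot t\,\bar z_\ell\big)(t_1)-i\,\bar z_\ell(t_1)\big(\dot{\bar z}_\ell-\tfrac12\cot t\,\bar z_\ell\big)(t_0).$$ Consider the condition $$(\ast)\qquad \rho_\ell=\sqrt{\pi/2}+x_\ell\ \text{ with }(x_\ell)_\ell\in\ell^2(\mathbb R),\qquad (\nu_\ell)_\ell\in\ell^2(\mathbb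 R).$$ (2) $\sum_\ell|\beta^\xi_\ell(t_1,t_0)|^2<\infty$ for all $t_0,t_1\in(0,\pi)$ if and only if $(\ast)$ holds. (3) $\mathcal T_{(t_1,t_0)}$ is unitarily implementable on $\mathscr F_+$ for all $t_0,t_1\in(0,\pi)$ if and only if $(\ast)$ holds. Here implementable means that there is a unitary $U$ on $\mathscr F_+$ with $U^{-1}W(\kappa(\xi))U=W(\kappa(\mathcal T_{(t_1,t_0)}\xi))$ for all $\xi\in\mathcal S_\xi$ for which $\kappa(\xi)$ and $\kappa(\mathcal T_{(t_1,t_0)}\xi)$ lie in $\ell^2$, where $W(f)=\exp(C(f)-A(f))$ is the Weyl operator built from the creation and annihilation operators $C(f)$, $A(f)$. (4) If $(\ast)$ holds, then $\kappa(\xi)\in\ell^2(\mathbb C)$ for every $\xi\in\mathcal S_\xi$, and for all $t_0,t_1\in(0,\pi)$ the map $\mathcal T_{(t_1,t_0)}$ is continuous: there is $K(t_1,t_0)>0$ with $\|\kappa(\mathcal T_{(t_1,t_0)}\xi)\|\le K(t_1,t_0)\,\|\kappa(\xi)\|$ for all $\xi\in\mathcal S_\xi$. -/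

import Mathlib

open scoped ComplexConjugate ContDiff

noncomputable section

namespace GowdyField

/-! ### Axially symmetric fields on `(0, π) × S²`

An axially symmetric function on the unit sphere is written as a function of the polar angle
`θ ∈ [0, π]`; the round metric is `dθ² + sin² θ dσ²`. A field is a function `ξ t θ`; only its values
at `t ∈ (0, π)`, `θ ∈ [0, π]` matter. -/

/-- The field is smooth as a function on `(0, π) × S²`, poles included. Functions on `S²` are
extended to `ℝ³ ∖ {0}` by homogeneity of degree zero. -/
def IsSmoothField (ξ : ℝ → ℝ → ℝ) : Prop :=
  ContDiffOn ℝ ∞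
    (fun q : ℝ × EuclideanSpace ℝ (Fin 3) => ξ q.1 (Real.arccos (q.2 2 / ‖q.2‖)))
    (Set.Ioo 0 Real.pi ×ˢ {x | x ≠ 0})

/-- The Laplace–Beltrami operator of the unit sphere on axially symmetric functions. -/
def sphereLaplacian (f : ℝ → ℝ) (θ : ℝ) : ℝ :=
  (1 / Real.sin θ) * deriv (fun η => Real.sin η * deriv f η) θ

/-- The integral over the unit sphere of an axially symmetric function. -/
def sphereIntegral (f : ℝ → ℝ) : ℝ :=
  2 * Real.pi * ∫ θ in (0 : ℝ)..Real.pi, f θ * Real.sin θ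

/-- Smooth axially symmetric solutions of the massless Klein–Gordon equation of the metric
`sin² t (-dt² + γ)` on `(0, π) × S²`, that is, of `φ'' + cot t φ' - Δ φ = 0`. -/
structure IsMasslessSolution (φ : ℝ → ℝ → ℝ) : Prop where
  smooth : IsSmoothField φ
  eqn : ∀ t ∈ Set.Ioo 0 Real.pi, ∀ θ ∈ Set.Ioo 0 Real.pi,
    deriv (deriv fun τ => φ τ θ) t + Real.cot t * deriv (fun τ => φ τ θ) t
      - sphereLaplacian (φ t) θ = 0

/-- The space `S_ξ`: smooth axially symmetric solutions of the Klein–Gordon equation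
`-ξ'' + Δ ξ = m(t) ξ`, with time-dependent mass term `m(t) = (1 + csc² t) / 4`, on the static
metric `-dt² + γ` on `(0, π) × S²`. -/
structure IsStaticSolution (ξ : ℝ → ℝ → ℝ) : Prop where
  smooth : IsSmoothField ξ
  eqn : ∀ t ∈ Set.Ioo 0 Real.pi, ∀ θ ∈ Set.Ioo 0 Real.pi,
    -deriv (deriv fun τ => ξ τ θ) t + sphereLaplacian (ξ t) θ
      = (1 / 4) * (1 + 1 / Real.sin t ^ 2) * ξ t θ

/-- The canonical momentum `P = ξ' - (1/2) cot t ξ` of the field on the slice of time `t`. -/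
def momentum (ξ : ℝ → ℝ → ℝ) (t θ : ℝ) : ℝ :=
  deriv (fun τ => ξ τ θ) t - (1 / 2) * Real.cot t * ξ t θ

/-- `ξ' = 𝒯_(t₁,t₀) ξ`: the solution `ξ'` has at time `t₀` the Cauchy data `(Q, P)` that the
solution `ξ` has at time `t₁`. -/
structure IsEvolved (t₁ t₀ : ℝ) (ξ ξ' : ℝ → ℝ → ℝ) : Prop where
  left : IsStaticSolution ξ
  right : IsStaticSolution ξ'
  position_eq : ∀ θ ∈ Set.Icc 0 Real.pi, ξ' t₀ θ = ξ t₁ θ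
  momentum_eq : ∀ θ ∈ Set.Icc 0 Real.pi, momentum ξ' t₀ θ = momentum ξ t₁ θ

/-! ### Modes -/

/-- Legendre polynomials. -/
def legendreP : ℕ → ℝ → ℝ
  | 0, _ => 1
  | 1, x => x
  | n + 2, x => ((2 * n + 3) * x * legendreP (n + 1) x - (n + 1) * legendreP n x) / (n + 2)

/-- Legendre functions of the second kind on `(-1, 1)`. -/
def legendreQ : ℕ → ℝ → ℝ
  | 0, x => (1 / 2) * Real.log ((1 + x) / (1 - x))
  | 1, x => x * ((1 / 2) * Real.log ((1 + x) / (1 - x))) - 1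
  | n + 2, x => ((2 * n + 3) * x * legendreQ (n + 1) x - (n + 1) * legendreQ n x) / (n + 2)

/-- The spherical harmonic `Y_{l0}`. -/
def sphericalY (l : ℕ) (θ : ℝ) : ℝ :=
  Real.sqrt ((2 * l + 1) / (4 * Real.pi)) * legendreP l (Real.cos θ)

/-- The mode `z_l(t) = √(sin t) (ρ_l u_{0l}(t) + (ν_l + i / ρ_l) v_{0l}(t))`, where
`u_{0l}(t) = P_l(cos t) / √2` and `v_{0l}(t) = Q_l(cos t) / √2`. -/
def mode (ρ ν : ℕ → ℝ) (l : ℕ) (t : ℝ) : ℂ :=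
  (Real.sqrt (Real.sin t) : ℂ) *
    ((ρ l : ℂ) * ((legendreP l (Real.cos t) / Real.sqrt 2 : ℝ) : ℂ)
      + ((ν l : ℂ) + Complex.I * (ρ l : ℂ)⁻¹) * ((legendreQ l (Real.cos t) / Real.sqrt 2 : ℝ) : ℂ))

/-- `z_l' - (1/2) cot t z_l`. -/
def modeMomentum (ρ ν : ℕ → ℝ) (l : ℕ) (t : ℝ) : ℂ :=
  deriv (mode ρ ν l) t - (1 / 2) * (Real.cot t : ℂ) * mode ρ ν l t

/-- The Bogoliubov coefficient `β_l(t₁, t₀)`. -/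
def bogoliubovBeta (ρ ν : ℕ → ℝ) (l : ℕ) (t₁ t₀ : ℝ) : ℂ :=
  Complex.I * conj (mode ρ ν l t₀) * conj (modeMomentum ρ ν l t₁)
    - Complex.I * conj (mode ρ ν l t₁) * conj (modeMomentum ρ ν l t₀)

/-! ### Fock space and Weyl operators -/

theorem expTerm_box {𝕜 : Type*} [Field 𝕜] (c : ℕ → 𝕜) (s : Finset ℕ) (N : ℕ) :
    ∑ n ∈ s.finsupp (fun _ => Finset.range N), (n.prod fun l k => c l ^ k / (k.factorial : 𝕜))
      = ∏ l ∈ s, ∑ k ∈ Finset.range N, c l ^ k / (k.factorial : 𝕜) := by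
  rw [Finset.prod_sum, Finset.finsupp, Finset.sum_map]
  refine Finset.sum_congr (by congr!) fun p _ => ?_
  change (Finsupp.indicator s p).prod _ = _
  rw [Finsupp.prod_of_support_subset (s := s) _ (Finsupp.support_indicator_subset _ _) _ (by simp)]
  rw [← Finset.prod_attach]
  refine Finset.prod_congr rfl fun x _ => ?_
  simp

theorem expTerm_summable {c : ℕ → ℂ} (hc : Summable fun l => ‖c l‖) :
    Summable fun n : ℕ →₀ ℕ => ‖n.prod fun l k => c l ^ k / (k.factorial : ℂ)‖ := by
  have key : ∀ n : ℕ →₀ ℕ, ‖n.prod fun l k => c l ^ k / (k.factorial : ℂ)‖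
      = n.prod fun l k => ‖c l‖ ^ k / (k.factorial : ℝ) := fun n => by
    simp [Finsupp.prod, norm_prod]
  simp only [key]
  have hpos : ∀ n : ℕ →₀ ℕ, 0 ≤ n.prod fun l k => ‖c l‖ ^ k / (k.factorial : ℝ) := fun n =>
    Finset.prod_nonneg fun _ _ => by positivity
  refine summable_of_sum_le (c := Real.exp (∑' l, ‖c l‖)) hpos fun u => ?_
  let s := u.biUnion Finsupp.support
  let N := (u.sup fun n => n.support.sup n) + 1
  have hsub : u ⊆ s.finsupp (fun _ => Finset.range N) := fun n hn => by
    rw [Finset.mem_finsupp_iff]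
    refine ⟨Finset.subset_biUnion_of_mem Finsupp.support hn, fun i _ => ?_⟩
    rw [Finset.mem_range, Nat.lt_succ_iff]
    by_cases hi : i ∈ n.support
    · exact (Finset.le_sup (f := n) hi).trans
        (Finset.le_sup (f := fun n : ℕ →₀ ℕ => n.support.sup n) hn)
    · simp [Finsupp.notMem_support_iff.mp hi]
  refine (Finset.sum_le_sum_of_subset_of_nonneg hsub fun n _ _ => hpos n).trans ?_
  rw [expTerm_box]
  calc ∏ l ∈ s, ∑ k ∈ Finset.range N, ‖c l‖ ^ k / (k.factorial : ℝ)
      ≤ ∏ l ∈ s, Real.exp ‖c l‖ := Finset.prod_le_prod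
        (fun _ _ => Finset.sum_nonneg fun _ _ => by positivity)
        (fun l _ => Real.sum_le_exp_of_nonneg (norm_nonneg _) _)
    _ = Real.exp (∑ l ∈ s, ‖c l‖) := (Real.exp_sum _ _).symm
    _ ≤ _ := Real.exp_le_exp.mpr (hc.sum_le_tsum _ fun _ _ => norm_nonneg _)

theorem expTerm_tsum {c : ℕ → ℂ} (hc : Summable fun l => ‖c l‖) :
    ∑' n : ℕ →₀ ℕ, (n.prod fun l k => c l ^ k / (k.factorial : ℂ)) = Complex.exp (∑' l, c l) := by
  classical
  have hs := expTerm_summable hc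
  -- partial products over a finite set of modes
  have hfin : ∀ s : Finset ℕ,
      ∑' n : ℕ →₀ ℕ, (if n.support ⊆ s then n.prod fun l k => c l ^ k / (k.factorial : ℂ) else 0)
        = Complex.exp (∑ l ∈ s, c l) := fun s => by
    have h1 : Filter.Tendsto (fun N : ℕ => ∑' n : ℕ →₀ ℕ,
        (if n ∈ s.finsupp (fun _ => Finset.range N) then
          n.prod fun l k => c l ^ k / (k.factorial : ℂ) else 0)) Filter.atTop
        (nhds (∑' n : ℕ →₀ ℕ,
          (if n.support ⊆ s then n.prod fun l k => c l ^ k / (k.factorial : ℂ) else 0))) := by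
      refine tendsto_tsum_of_dominated_convergence hs (fun n => ?_)
        (Filter.Eventually.of_forall fun N n => ?_)
      · refine tendsto_const_nhds.congr' ?_
        filter_upwards [Filter.eventually_gt_atTop (s.sup n)] with N hN
        have : n ∈ s.finsupp (fun _ => Finset.range N) ↔ n.support ⊆ s := by
          rw [Finset.mem_finsupp_iff]
          exact ⟨fun h => h.1, fun h => ⟨h, fun i hi =>
            Finset.mem_range.mpr ((Finset.le_sup (f := n) hi).trans_lt hN)⟩⟩
        simp only [this]
      · split_ifs
        · exact le_rfl
        · simp only [norm_zero]; exact norm_nonneg _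
    have h2 : Filter.Tendsto (fun N : ℕ => ∏ l ∈ s, ∑ k ∈ Finset.range N, c l ^ k / (k.factorial : ℂ))
        Filter.atTop (nhds (∏ l ∈ s, Complex.exp (c l))) := by
      refine tendsto_finsetProd _ fun l _ => ?_
      have := (NormedSpace.expSeries_div_hasSum_exp (c l)).tendsto_sum_nat
      rwa [← Complex.exp_eq_exp_ℂ] at this
    rw [Complex.exp_sum]
    refine tendsto_nhds_unique h1 (h2.congr fun N => ?_)
    rw [← expTerm_box, tsum_eq_sum (s := s.finsupp (fun _ => Finset.range N))
      (fun n hn => if_neg hn)]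
    exact Finset.sum_congr rfl fun n hn => (if_pos hn).symm
  have h3 : Filter.Tendsto (fun s : Finset ℕ => ∑' n : ℕ →₀ ℕ,
      (if n.support ⊆ s then n.prod fun l k => c l ^ k / (k.factorial : ℂ) else 0)) Filter.atTop
      (nhds (∑' n : ℕ →₀ ℕ, n.prod fun l k => c l ^ k / (k.factorial : ℂ))) := by
    refine tendsto_tsum_of_dominated_convergence hs (fun n => ?_)
      (Filter.Eventually.of_forall fun N n => ?_)
    · refine tendsto_const_nhds.congr' ?_
      filter_upwards [Filter.eventually_ge_atTop n.support] with s hs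
      rw [if_pos hs]
    · split_ifs
      · exact le_rfl
      · simp only [norm_zero]; exact norm_nonneg _
  simp only [hfin] at h3
  exact tendsto_nhds_unique h3
    ((Complex.continuous_exp.tendsto _).comp hc.of_norm.hasSum)

/-- The one-particle Hilbert space `ℋ`: the vector `∑ a_l φ_l`, where `φ_l = z_l Y_{l0}` is the
orthonormal basis of positive-frequency modes, is stored as its sequence `(a_l) ∈ ℓ²(ℂ)`. -/
abbrev OneParticle : Type := lp (fun _ : ℕ => ℂ) 2

/-- The symmetric Fock space over `ℋ` in its occupation number basis: `ψ n` is the component of `ψ`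
along the unit vector `|n₀ n₁ …⟩ = ∏ (a_l†)^(n_l) / √(n_l!) |0⟩`, for finitely supported `n`. -/
abbrev FockSpace : Type := lp (fun _ : ℕ →₀ ℕ => ℂ) 2

theorem expVec_conj_mul (f g : ℕ → ℂ) (n : ℕ →₀ ℕ) :
    conj (n.prod fun l k => f l ^ k / (Real.sqrt (k.factorial : ℝ) : ℂ))
        * (n.prod fun l k => g l ^ k / (Real.sqrt (k.factorial : ℝ) : ℂ))
      = n.prod fun l k => (conj (f l) * g l) ^ k / (k.factorial : ℂ) := by
  simp only [Finsupp.prod, map_prod, ← Finset.prod_mul_distrib]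
  refine Finset.prod_congr rfl fun l _ => ?_
  have h : ((Real.sqrt ((n l).factorial : ℝ) : ℂ)) * (Real.sqrt ((n l).factorial : ℝ) : ℂ) = ((n l).factorial : ℂ) := by
    rw [← Complex.ofReal_mul, Real.mul_self_sqrt (by positivity)]; simp
  rw [map_div₀, map_pow, Complex.conj_ofReal, div_mul_div_comm, h, mul_pow]

theorem summable_conj_mul (f g : OneParticle) : Summable fun l => ‖conj (f l) * g l‖ := by
  simpa using lp.summable_mul (p := 2) (q := 2) Real.HolderConjugate.two_two f g

theorem expVec_memlp (g : OneParticle) :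
    Memℓp (fun n : ℕ →₀ ℕ => n.prod fun l k => g l ^ k / (Real.sqrt (k.factorial : ℝ) : ℂ)) 2 := by
  rw [memℓp_gen_iff (by norm_num)]
  refine (expTerm_summable (summable_conj_mul g g)).congr fun n => ?_
  rw [← expVec_conj_mul, norm_mul, RCLike.norm_conj]
  norm_num [sq]

/-- The exponential (coherent) vector `exp(C(g)) |0⟩`, with `C(g) = ∑ g_l a_l†` the creation
operator of `g`. -/
def expVec (g : OneParticle) : FockSpace :=
  ⟨fun n => n.prod fun l k => g l ^ k / (Real.sqrt (k.factorial : ℝ) : ℂ), expVec_memlp g⟩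

theorem expVec_apply (g : OneParticle) (n : ℕ →₀ ℕ) :
    expVec g n = n.prod fun l k => g l ^ k / (Real.sqrt (k.factorial : ℝ) : ℂ) := rfl

theorem inner_expVec (f g : OneParticle) :
    inner ℂ (expVec f) (expVec g) = Complex.exp (inner ℂ f g) := by
  rw [lp.inner_eq_tsum, lp.inner_eq_tsum]
  have h1 : ∀ n : ℕ →₀ ℕ, inner ℂ (expVec f n) (expVec g n)
      = n.prod fun l k => (conj (f l) * g l) ^ k / (k.factorial : ℂ) := fun n => by
    rw [← expVec_conj_mul, ← expVec_apply, ← expVec_apply, RCLike.inner_apply, mul_comm]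
  have h2 : ∀ l, inner ℂ (f l) (g l) = conj (f l) * g l := fun l => by
    rw [RCLike.inner_apply, mul_comm]
  simp only [h1, h2]
  exact expTerm_tsum (summable_conj_mul f g)

theorem eq_zero_of_inner_expVec {ψ : FockSpace} (h : ∀ g, inner ℂ ψ (expVec g) = 0) : ψ = 0 := by
  classical
  -- the homogeneous parts of the entire function `z ↦ ⟨ψ, e(z g)⟩` vanish
  have hom : ∀ (g : OneParticle) (k : ℕ),
      ∑' n : (fun n : ℕ →₀ ℕ => n.degree) ⁻¹' {k}, conj (ψ n) * expVec g n = 0 := by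
    intro g
    have hz : ∀ z : ℂ, HasSum (fun k : ℕ => z ^ k •
        ∑' n : (fun n : ℕ →₀ ℕ => n.degree) ⁻¹' {k}, conj (ψ n) * expVec g n) 0 := fun z => by
      have hs := lp.hasSum_inner (𝕜 := ℂ) ψ (expVec (z • g))
      rw [h] at hs
      refine (hs.tsum_fiberwise (fun n : ℕ →₀ ℕ => n.degree)).congr_fun fun k => ?_
      rw [smul_eq_mul, ← tsum_mul_left]
      refine tsum_congr fun n => ?_
      have hn : (n : ℕ →₀ ℕ).degree = k := n.2
      have : ∀ m : ℕ →₀ ℕ, expVec (z • g) m = z ^ m.degree * expVec g m := fun m => by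
        rw [expVec_apply, expVec_apply, Finsupp.degree_apply]
        simp only [Finsupp.prod, ← Finset.prod_pow_eq_pow_sum,
          ← Finset.prod_mul_distrib]
        refine Finset.prod_congr rfl fun l _ => ?_
        simp [mul_pow, mul_div_assoc]
      rw [RCLike.inner_apply, this, hn]
      ring
    have hp : HasFPowerSeriesAt (0 : ℂ → ℂ) (FormalMultilinearSeries.ofScalars ℂ fun k : ℕ =>
        ∑' n : (fun n : ℕ →₀ ℕ => n.degree) ⁻¹' {k}, conj (ψ n) * expVec g n) 0 := by
      rw [hasFPowerSeriesAt_iff]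
      refine Filter.Eventually.of_forall fun z => ?_
      simp only [FormalMultilinearSeries.coeff_ofScalars]
      exact hz z
    intro k
    have := congrArg (fun p => p.coeff k) hp.eq_zero
    simp only [FormalMultilinearSeries.coeff_ofScalars] at this
    rw [this]; rfl
  ext m
  -- restrict to finitely many modes and use that a polynomial that vanishes everywhere is zero
  let B : Finset (ℕ →₀ ℕ) := (m.support.finsupp fun _ => Finset.range (m.degree + 1)).filter
    fun n => n.degree = m.degree
  let w : (ℕ →₀ ℕ) → ℂ := fun n => n.prod fun _ k => (Real.sqrt (k.factorial : ℝ) : ℂ)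
  have hw : ∀ n, w n ≠ 0 := fun n => Finset.prod_ne_zero_iff.mpr fun l _ => by
    simpa using Nat.factorial_ne_zero _
  let P : MvPolynomial ℕ ℂ := ∑ n ∈ B, MvPolynomial.monomial n (conj (ψ n) / w n)
  have hP : P = 0 := by
    refine MvPolynomial.funext fun x => ?_
    let g : OneParticle := ∑ l ∈ m.support, lp.single 2 l (x l)
    have hg : ∀ l, g l = if l ∈ m.support then x l else 0 := fun l => by
      simp only [g, lp.coeFn_sum, Finset.sum_apply, lp.single_apply, Pi.single_apply]
      simp
    have := hom g m.degree
    rw [tsum_subtype ((fun n : ℕ →₀ ℕ => n.degree) ⁻¹' {m.degree})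
      (fun n => conj (ψ n) * expVec g n), tsum_eq_sum (s := B)] at this
    · rw [map_zero, ← this, map_sum]
      refine Finset.sum_congr rfl fun n hn => ?_
      obtain ⟨hn1, hn2⟩ := Finset.mem_filter.mp hn
      rw [Set.indicator_of_mem (by exact hn2), MvPolynomial.eval_monomial, expVec_apply,
        div_mul_eq_mul_div, mul_div_assoc]
      simp only [Finsupp.prod, w, ← Finset.prod_div_distrib]
      congr 1
      refine Finset.prod_congr rfl fun l hl => ?_
      rw [hg, if_pos ((Finset.mem_finsupp_iff.mp hn1).1 hl)]
    · intro n hn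
      by_cases hd : n.degree = m.degree
      · have hsub : ¬ n.support ⊆ m.support := fun hsub => hn <| Finset.mem_filter.mpr
          ⟨Finset.mem_finsupp_iff.mpr ⟨hsub, fun i _ => Finset.mem_range.mpr
            (Nat.lt_succ_iff.mpr (hd ▸ Finsupp.le_degree i n))⟩, hd⟩
        obtain ⟨l, hl, hl'⟩ := Finset.not_subset.mp hsub
        rw [Set.indicator_of_mem (by exact hd), expVec_apply, Finsupp.prod,
          Finset.prod_eq_zero hl, mul_zero]
        rw [hg, if_neg hl', zero_pow (Finsupp.mem_support_iff.mp hl), zero_div]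
      · exact Set.indicator_of_notMem (by exact hd) _
  have hm : m ∈ B := Finset.mem_filter.mpr ⟨Finset.mem_finsupp_iff.mpr ⟨subset_rfl, fun i _ =>
    Finset.mem_range.mpr (Nat.lt_succ_iff.mpr (Finsupp.le_degree i m))⟩, rfl⟩
  have hc : MvPolynomial.coeff m P = conj (ψ m) / w m := by
    simp only [P, MvPolynomial.coeff_sum, MvPolynomial.coeff_monomial]
    rw [Finset.sum_ite_eq' B m, if_pos hm]
  rw [hP, MvPolynomial.coeff_zero, eq_comm, div_eq_zero_iff, or_iff_left (hw m)] at hc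
  simpa using hc

/-- Finite linear combinations of exponential vectors. -/
def expSpan : (OneParticle →₀ ℂ) →ₗ[ℂ] FockSpace := Finsupp.linearCombination ℂ expVec

theorem denseRange_expSpan : DenseRange expSpan := by
  have : (LinearMap.range expSpan).topologicalClosure = ⊤ := by
    rw [Submodule.topologicalClosure_eq_top_iff, Submodule.eq_bot_iff]
    intro ψ hψ
    refine eq_zero_of_inner_expVec fun g => ?_
    rw [Submodule.mem_orthogonal'] at hψ
    exact hψ _ ⟨Finsupp.single g 1, by simp [expSpan]⟩
  change Dense (LinearMap.range expSpan : Set FockSpace)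
  exact Submodule.dense_iff_topologicalClosure_eq_top.mpr this

/-- `exp(C(f)) exp(-A(f)) exp(-‖f‖² / 2)` on finite linear combinations of exponential vectors:
the annihilation operator satisfies `A(f) exp(C(g))|0⟩ = ⟨f, g⟩ exp(C(g))|0⟩`. -/
def weylOnExp (f : OneParticle) : (OneParticle →₀ ℂ) →ₗ[ℂ] FockSpace :=
  Finsupp.linearCombination ℂ fun g =>
    Complex.exp (-((‖f‖ ^ 2 / 2 : ℝ) : ℂ) - inner ℂ f g) • expVec (f + g)

/-- The Weyl operator `exp(C(f) - A(f)) = exp(C(f)) exp(-A(f)) exp(-‖f‖² / 2)` on Fock space: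
the unique continuous extension from the dense span of the exponential vectors; see
`weyl_expVec`. -/
def weyl (f : OneParticle) : FockSpace →L[ℂ] FockSpace :=
  (weylOnExp f).extendOfNorm expSpan

theorem norm_weylOnExp (f : OneParticle) (x : OneParticle →₀ ℂ) :
    ‖weylOnExp f x‖ = ‖expSpan x‖ := by
  have h : inner ℂ (weylOnExp f x) (weylOnExp f x) = inner ℂ (expSpan x) (expSpan x) := by
    simp only [weylOnExp, expSpan, Finsupp.linearCombination_apply, Finsupp.sum_inner,
      Finsupp.inner_sum]
    simp only [Finsupp.sum]
    refine Finset.sum_congr rfl fun g _ => Finset.sum_congr rfl fun g' _ => ?_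
    have key : conj (Complex.exp (-((‖f‖ ^ 2 / 2 : ℝ) : ℂ) - inner ℂ f g'))
        * (Complex.exp (-((‖f‖ ^ 2 / 2 : ℝ) : ℂ) - inner ℂ f g)
          * Complex.exp (inner ℂ (f + g') (f + g))) = Complex.exp (inner ℂ g' g) := by
      rw [← Complex.exp_conj, ← Complex.exp_add, ← Complex.exp_add]
      congr 1
      simp only [map_sub, map_neg, Complex.conj_ofReal, inner_conj_symm, inner_add_left,
        inner_add_right, inner_self_eq_norm_sq_to_K, Complex.coe_algebraMap]
      push_cast
      ring
    simp only [inner_smul_left, inner_smul_right, inner_expVec]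
    linear_combination conj (x g') * x g * key
  rw [inner_self_eq_norm_sq_to_K, inner_self_eq_norm_sq_to_K] at h
  exact (sq_eq_sq₀ (norm_nonneg _) (norm_nonneg _)).mp (by exact_mod_cast h)

theorem weyl_expVec (f g : OneParticle) : weyl f (expVec g)
    = Complex.exp (-((‖f‖ ^ 2 / 2 : ℝ) : ℂ) - inner ℂ f g) • expVec (f + g) := by
  have := LinearMap.extendOfNorm_eq (f := weylOnExp f) denseRange_expSpan
    ⟨1, fun x => by rw [one_mul, norm_weylOnExp]⟩ (Finsupp.single g 1)
  simpa [weylOnExp, expSpan, weyl] using this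

/-! ### Quantum time evolution -/

/-- `b = κ(ξ)`, the positive-frequency part: `ξ(t, ·) = ∑ (b_l z_l(t) + c.c.) Y_{l0}` for all `t`,
expressed on the coefficients with respect to the orthonormal functions `Y_{l0}`. -/
def IsPositiveFrequencyPart (ρ ν : ℕ → ℝ) (ξ : ℝ → ℝ → ℝ) (b : OneParticle) : Prop :=
  ∀ t ∈ Set.Ioo 0 Real.pi, ∀ l : ℕ,
    ((sphereIntegral fun θ => sphericalY l θ * ξ t θ : ℝ) : ℂ)
      = b l * mode ρ ν l t + conj (b l * mode ρ ν l t)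

/-- Continuity of `𝒯_(t₁,t₀)` in the one-particle norm. -/
def EvolutionContinuous (ρ ν : ℕ → ℝ) (t₁ t₀ : ℝ) : Prop :=
  ∃ K : ℝ, 0 < K ∧ ∀ ξ ξ' : ℝ → ℝ → ℝ, IsEvolved t₁ t₀ ξ ξ' →
    ∀ b b' : OneParticle, IsPositiveFrequencyPart ρ ν ξ b → IsPositiveFrequencyPart ρ ν ξ' b' →
      ‖b'‖ ≤ K * ‖b‖

/-- Unitary implementability of `𝒯_(t₁,t₀)` in the Fock representation: there is a unitary `U` with
`U⁻¹ W(ξ) U = W(𝒯 ξ)` for all `ξ`, where `W(ξ)` is the Weyl operator of `κ(ξ)`. -/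
def EvolutionImplementable (ρ ν : ℕ → ℝ) (t₁ t₀ : ℝ) : Prop :=
  ∃ U : FockSpace ≃ₗᵢ[ℂ] FockSpace, ∀ ξ ξ' : ℝ → ℝ → ℝ, IsEvolved t₁ t₀ ξ ξ' →
    ∀ b b' : OneParticle, IsPositiveFrequencyPart ρ ν ξ b → IsPositiveFrequencyPart ρ ν ξ' b' →
      ∀ ψ : FockSpace, U.symm (weyl b (U ψ)) = weyl b' ψ

end GowdyField

end

open GowdyField

open scoped ComplexConjugate ContDiff

noncomputable section

namespace GowdyField

/-! ### Legendre functions -/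

/-! Everything is diagonal in the degree `l`, so the theorem is about a sequence of oscillators with
equation f'' = -(ω² + csc² t / 4) f, where ω = l + 1/2 (`IsModeSolution.hasDerivAt_velocity`).

Statement (1) is the substitution ξ = a φ with a = √(sin t): the first-order term is absorbed and
-a''/a is the mass term.

For (2), the case ρ = √(π/2), ν = 0 serves as reference. Its data at t = π/2 are Wallis products,
and because ρ² = π/2 is their limit, the data agree with those of a positive-frequency plane wave up
to a relative error O(1/ω). An energy estimate carries this to all t (`refMode_asymptotics`). A
general mode is A ζ + B conj ζ with ζ the reference mode and |A|² = 1 + |B|², and (∗) says exactly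
that B is in ℓ² (`summable_refB_iff`). Up to phase and conjugation, β = A² X + A B Y + B² conj X
with X = O(1/ω) and Y = -2 sin(ω(t₁ - t₀)) + O(1/ω) (`ref_asymptotics`). As 1/ω is square summable,
B in ℓ² makes β square summable. Conversely, for t₁ - t₀ = π/2 one has sin² = 1/2 in every degree,
so β controls B.

For (3), the evolution acts on κ(ξ) by b ↦ α b + β conj b with |α|² = 1 + |β|²
(`IsEvolved.frequency_eq`), and the claim is Shale's criterion for diagonal transformations. If β is
in ℓ², the vector exp(-½ ∑ (β_l/α_l) a_l†²)|0⟩ lies in Fock space; its expectation values of Weyl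
operators are those of the transformed vacuum, which yields an intertwining isometry. The same
construction for the inverse transformation, with irreducibility of the Weyl operators, makes it
unitary (`exists_bogoliubov_unitary`). If an implementer U exists, testing on single-mode solutions
forces U|0⟩ to be a squeezed state in each mode; its component along two particles in mode l is a
nonzero constant times β_l/α_l, so β/α and then β are in ℓ² (`summable_of_intertwine`). Both
directions rest on one fact of complex analysis: a function that is holomorphic and antiholomorphic
is constant, also after a real-linear change of variable (`eq_of_differentiable_bogoliubov`).

For (4), κ(ξ) is in ℓ² by Bessel's inequality for ξ, its time derivative and its Laplacian at t =
π/2, and boundedness of α and β gives continuity. -/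

/-- Bonnet's recurrence. -/
def BonnetRecurrence (f : ℕ → ℝ → ℝ) : Prop :=
  ∀ n x, f (n + 2) x = ((2 * n + 3) * x * f (n + 1) x - (n + 1) * f n x) / (n + 2)

theorem bonnet_legendreP : BonnetRecurrence legendreP := fun n x => by simp [legendreP]

theorem bonnet_legendreQ : BonnetRecurrence legendreQ := fun n x => by simp [legendreQ]

/-- The two formulas are propagated as a pair: by the recurrence, the second one for n is the first
one for n + 1. Only n = 0 depends on the initial functions, so both kinds of Legendre functions are
covered at once. -/
theorem BonnetRecurrence.hasDerivAt {f : ℕ → ℝ → ℝ} (hf : BonnetRecurrence f) {x : ℝ}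
    (hx : 1 - x ^ 2 ≠ 0)
    (h0 : HasDerivAt (f 0) ((x * f 0 x - f 1 x) / (1 - x ^ 2)) x)
    (h1 : HasDerivAt (f 1) ((f 0 x - x * f 1 x) / (1 - x ^ 2)) x) (n : ℕ) :
    HasDerivAt (f n) ((n + 1) * (x * f n x - f (n + 1) x) / (1 - x ^ 2)) x ∧
      HasDerivAt (f (n + 1)) ((n + 1) * (f n x - x * f (n + 1) x) / (1 - x ^ 2)) x := by
  induction n with
  | zero => simpa using ⟨h0, h1⟩
  | succ n ih =>
    obtain ⟨ihA, ihB⟩ := ih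
    have hn : (n : ℝ) + 2 ≠ 0 := by positivity
    constructor
    · refine HasDerivAt.congr_deriv (ihB) ?_
      rw [show n + 1 + 1 = n + 2 from rfl, hf n x]
      push_cast
      field_simp
      ring
    · have hfun : f (n + 1 + 1) = fun x =>
          ((2 * n + 3) * x * f (n + 1) x - (n + 1) * f n x) / (n + 2) := funext fun x => hf n x
      rw [hfun]
      have := ((((hasDerivAt_id x).const_mul (2 * n + 3 : ℝ)).mul ihB).sub
        (ihA.const_mul (n + 1 : ℝ))).div_const (n + 2 : ℝ)
      refine HasDerivAt.congr_deriv (this) ?_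
      simp only [id]
      push_cast
      field_simp
      ring

theorem one_sub_cos_sq_ne {t : ℝ} (ht : t ∈ Set.Ioo 0 Real.pi) : 1 - Real.cos t ^ 2 ≠ 0 := by
  have := Real.sin_pos_of_mem_Ioo ht
  rw [← Real.sin_sq]
  positivity

theorem hasDerivAt_legendreP {x : ℝ} (hx : 1 - x ^ 2 ≠ 0) (n : ℕ) :
    HasDerivAt (legendreP n) ((n + 1) * (x * legendreP n x - legendreP (n + 1) x) / (1 - x ^ 2)) x ∧
      HasDerivAt (legendreP (n + 1))
        ((n + 1) * (legendreP n x - x * legendreP (n + 1) x) / (1 - x ^ 2)) x := by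
  refine bonnet_legendreP.hasDerivAt hx ?_ ?_ n
  · simpa [legendreP] using hasDerivAt_const x (1 : ℝ)
  · have h : (1 - x * x) / (1 - x ^ 2) = 1 := by rw [← sq, div_self hx]
    simpa [legendreP, h] using hasDerivAt_id' x

theorem hasDerivAt_half_log {x : ℝ} (hx : x ∈ Set.Ioo (-1 : ℝ) 1) :
    HasDerivAt (fun x : ℝ => (1 / 2) * Real.log ((1 + x) / (1 - x))) (1 / (1 - x ^ 2)) x := by
  have h1 : 1 - x ≠ 0 := by linarith [hx.2]
  have h2 : 1 + x ≠ 0 := by linarith [hx.1]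
  have := ((((hasDerivAt_id x).const_add 1).div ((hasDerivAt_id x).const_sub 1) h1).log
    (div_ne_zero h2 h1)).const_mul (1 / 2 : ℝ)
  refine HasDerivAt.congr_deriv (this) ?_
  have h3 : 1 - x ^ 2 ≠ 0 := by
    rw [show 1 - x ^ 2 = (1 - x) * (1 + x) by ring]; exact mul_ne_zero h1 h2
  simp only [id, Pi.div_apply]
  field_simp
  ring

theorem hasDerivAt_legendreQ {x : ℝ} (hx : x ∈ Set.Ioo (-1 : ℝ) 1) (n : ℕ) :
    HasDerivAt (legendreQ n) ((n + 1) * (x * legendreQ n x - legendreQ (n + 1) x) / (1 - x ^ 2)) x ∧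
      HasDerivAt (legendreQ (n + 1))
        ((n + 1) * (legendreQ n x - x * legendreQ (n + 1) x) / (1 - x ^ 2)) x := by
  have hx' : 1 - x ^ 2 ≠ 0 := by
    have : 0 < (1 - x) * (1 + x) := mul_pos (by linarith [hx.2]) (by linarith [hx.1])
    nlinarith
  refine bonnet_legendreQ.hasDerivAt hx' ?_ ?_ n
  · refine HasDerivAt.congr_deriv (hasDerivAt_half_log hx) ?_
    simp only [legendreQ]; ring
  · refine HasDerivAt.congr_deriv (((hasDerivAt_id x).mul (hasDerivAt_half_log hx)).sub_const 1) ?_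
    simp only [legendreQ]
    simp only [id]
    field_simp
    ring

theorem cos_mem_Ioo {t : ℝ} (ht : t ∈ Set.Ioo 0 Real.pi) : Real.cos t ∈ Set.Ioo (-1 : ℝ) 1 := by
  have := Real.sin_pos_of_mem_Ioo ht
  have h := Real.sin_sq_add_cos_sq t
  constructor <;> nlinarith [Real.neg_one_le_cos t, Real.cos_le_one t]

/-- A Casoratian: the recurrence makes the expression independent of n. For |x| < 1 it equals (1 -
x²) times the Wronskian of P_n and Q_n, and it is what normalizes the modes. -/
theorem legendreP_wronskian {x : ℝ} (n : ℕ) :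
    (n + 1) * (legendreQ n x * legendreP (n + 1) x - legendreP n x * legendreQ (n + 1) x) = 1 := by
  induction n with
  | zero => simp [legendreP, legendreQ]; ring
  | succ n ih =>
    have hn : (n : ℝ) + 2 ≠ 0 := by positivity
    rw [show n + 1 + 1 = n + 2 from rfl, bonnet_legendreP, bonnet_legendreQ]
    push_cast
    field_simp
    linear_combination (n + 2) * ih

/-! ### The Hamiltonian system of a mode -/

/-- The Hamiltonian system of the `l`-th mode: `f' = p + (1/2) cot t f`,
`p' = -(1/2) cot t p - l (l + 1) f`. -/
def IsModeSolution (l : ℕ) (f p : ℝ → ℂ) : Prop :=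
  ∀ t ∈ Set.Ioo 0 Real.pi, HasDerivAt f (p t + 1 / 2 * (Real.cot t : ℂ) * f t) t ∧
    HasDerivAt p (-(1 / 2 * (Real.cot t : ℂ) * p t) - l * (l + 1) * f t) t

theorem IsModeSolution.add {l : ℕ} {f p g q : ℝ → ℂ} (hf : IsModeSolution l f p)
    (hg : IsModeSolution l g q) : IsModeSolution l (fun t => f t + g t) (fun t => p t + q t) :=
  fun t ht => by
    constructor
    · exact ((hf t ht).1.add (hg t ht).1).congr_deriv (by ring)
    · exact ((hf t ht).2.add (hg t ht).2).congr_deriv (by ring)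

theorem IsModeSolution.const_mul {l : ℕ} {f p : ℝ → ℂ} (hf : IsModeSolution l f p) (c : ℂ) :
    IsModeSolution l (fun t => c * f t) (fun t => c * p t) :=
  fun t ht => by
    constructor
    · exact ((hf t ht).1.const_mul c).congr_deriv (by ring)
    · exact ((hf t ht).2.const_mul c).congr_deriv (by ring)

theorem IsModeSolution.conj {l : ℕ} {f p : ℝ → ℂ} (hf : IsModeSolution l f p) :
    IsModeSolution l (fun t => conj (f t)) (fun t => conj (p t)) :=
  fun t ht => by
    constructor
    · have := (hf t ht).1.star
      refine HasDerivAt.congr_deriv (this) ?_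
      simp only [Complex.star_def]
      simp only [map_add, map_mul, map_div₀, map_one, map_ofNat, Complex.conj_ofReal]
    · have := (hf t ht).2.star
      refine HasDerivAt.congr_deriv (this) ?_
      simp only [Complex.star_def]
      simp only [map_sub, map_neg, map_add, map_mul, map_div₀, map_one, map_ofNat,
        Complex.conj_ofReal, map_natCast]

theorem constant_on_Ioo {w : ℝ → ℂ} (hw : ∀ t ∈ Set.Ioo 0 Real.pi, HasDerivAt w 0 t) {s t : ℝ}
    (hs : s ∈ Set.Ioo 0 Real.pi) (ht : t ∈ Set.Ioo 0 Real.pi) : w s = w t :=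
  (convex_Ioo 0 Real.pi).is_const_of_fderivWithin_eq_zero (𝕜 := ℝ)
    (fun x hx => (hw x hx).differentiableAt.differentiableWithinAt)
    (fun x hx => by
      rw [fderivWithin_of_isOpen isOpen_Ioo hx]
      have := (hw x hx).hasFDerivAt.fderiv
      rw [this]; ext; simp) hs ht

/-- The symplectic product of two solutions is conserved. -/
theorem IsModeSolution.wronskian {l : ℕ} {f p g q : ℝ → ℂ} (hf : IsModeSolution l f p)
    (hg : IsModeSolution l g q) {s t : ℝ} (hs : s ∈ Set.Ioo 0 Real.pi)
    (ht : t ∈ Set.Ioo 0 Real.pi) : f s * q s - g s * p s = f t * q t - g t * p t :=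
  constant_on_Ioo (w := fun t => f t * q t - g t * p t) (fun x hx => by
    refine HasDerivAt.congr_deriv (((hf x hx).1.mul (hg x hx).2).sub ((hg x hx).1.mul (hf x hx).2)) ?_
    ring) hs ht

/-- The momentum of the solution `√(sin t) f_n(cos t)`. -/
def legendreMomentum (f : ℕ → ℝ → ℝ) (n : ℕ) (t : ℝ) : ℝ :=
  -((n + 1) * (Real.cos t * f n (Real.cos t) - f (n + 1) (Real.cos t)) / Real.sqrt (Real.sin t))

theorem hasDerivAt_sqrt_sin {t : ℝ} (ht : t ∈ Set.Ioo 0 Real.pi) :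
    HasDerivAt (fun t => Real.sqrt (Real.sin t)) (1 / 2 * Real.cot t * Real.sqrt (Real.sin t)) t := by
  have hs := Real.sin_pos_of_mem_Ioo ht
  refine HasDerivAt.congr_deriv ((Real.hasDerivAt_sin t).sqrt hs.ne') ?_
  have h : Real.sqrt (Real.sin t) ^ 2 = Real.sin t := Real.sq_sqrt hs.le
  have h' : Real.sqrt (Real.sin t) ≠ 0 := (Real.sqrt_pos.mpr hs).ne'
  rw [Real.cot_eq_cos_div_sin]
  have h2 : Real.sin t ≠ 0 := hs.ne'
  field_simp
  rw [h]

theorem legendre_mode_system {f : ℕ → ℝ → ℝ} (hf : ∀ x ∈ Set.Ioo (-1 : ℝ) 1, ∀ n : ℕ,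
    HasDerivAt (f n) ((n + 1) * (x * f n x - f (n + 1) x) / (1 - x ^ 2)) x ∧
      HasDerivAt (f (n + 1)) ((n + 1) * (f n x - x * f (n + 1) x) / (1 - x ^ 2)) x) (n : ℕ) {t : ℝ}
    (ht : t ∈ Set.Ioo 0 Real.pi) :
    HasDerivAt (fun t => Real.sqrt (Real.sin t) * f n (Real.cos t))
      (legendreMomentum f n t + 1 / 2 * Real.cot t * (Real.sqrt (Real.sin t) * f n (Real.cos t))) t ∧
    HasDerivAt (legendreMomentum f n) (-(1 / 2 * Real.cot t * legendreMomentum f n t)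
      - n * (n + 1) * (Real.sqrt (Real.sin t) * f n (Real.cos t))) t := by
  have hs := Real.sin_pos_of_mem_Ioo ht
  obtain ⟨h1, h2⟩ := hf _ (cos_mem_Ioo ht) n
  have d1 := h1.comp t (Real.hasDerivAt_cos t)
  have d2 := h2.comp t (Real.hasDerivAt_cos t)
  have ds := hasDerivAt_sqrt_sin ht
  have hr : Real.sqrt (Real.sin t) ^ 2 = Real.sin t := Real.sq_sqrt hs.le
  have hr0 : Real.sqrt (Real.sin t) ≠ 0 := (Real.sqrt_pos.mpr hs).ne'
  have hc : 1 - Real.cos t ^ 2 = Real.sin t ^ 2 := by rw [Real.sin_sq]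
  have hc' : Real.cos t ^ 2 = 1 - Real.sin t ^ 2 := by rw [Real.sin_sq]; ring
  rw [hc] at d1 d2
  rw [Real.cot_eq_cos_div_sin] at ds ⊢
  constructor
  · refine HasDerivAt.congr_deriv (ds.mul d1) ?_
    simp only [legendreMomentum]
    generalize Real.sqrt (Real.sin t) = r at *
    rw [← hr]
    field_simp
    ring
  · have := (((((Real.hasDerivAt_cos t).mul d1).sub d2).const_mul (n + 1 : ℝ)).div ds hr0).neg
    refine HasDerivAt.congr_deriv (this) ?_
    simp only [legendreMomentum, Function.comp, Pi.mul_apply, Pi.sub_apply]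
    generalize Real.sqrt (Real.sin t) = r at *
    rw [← hr] at hc' ⊢
    field_simp
    generalize f n (Real.cos t) = a at *
    generalize f (n + 1) (Real.cos t) = b at *
    generalize Real.cos t = c at *
    have h4 : r ^ 4 = 1 - c ^ 2 := by rw [hc']; ring
    linear_combination (2 * (n + 1) * a) * h4

theorem legendreP_mode_system (n : ℕ) {t : ℝ} (ht : t ∈ Set.Ioo 0 Real.pi) :
    HasDerivAt (fun t => Real.sqrt (Real.sin t) * legendreP n (Real.cos t))
      (legendreMomentum legendreP n t
        + 1 / 2 * Real.cot t * (Real.sqrt (Real.sin t) * legendreP n (Real.cos t))) t ∧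
    HasDerivAt (legendreMomentum legendreP n) (-(1 / 2 * Real.cot t * legendreMomentum legendreP n t)
      - n * (n + 1) * (Real.sqrt (Real.sin t) * legendreP n (Real.cos t))) t :=
  legendre_mode_system (f := legendreP) (fun x hx n => hasDerivAt_legendreP
    (by nlinarith [mul_pos (sub_pos.mpr hx.2) (by linarith [hx.1] : (0:ℝ) < 1 + x)]) n) n ht

theorem legendreQ_mode_system (n : ℕ) {t : ℝ} (ht : t ∈ Set.Ioo 0 Real.pi) :
    HasDerivAt (fun t => Real.sqrt (Real.sin t) * legendreQ n (Real.cos t))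
      (legendreMomentum legendreQ n t
        + 1 / 2 * Real.cot t * (Real.sqrt (Real.sin t) * legendreQ n (Real.cos t))) t ∧
    HasDerivAt (legendreMomentum legendreQ n) (-(1 / 2 * Real.cot t * legendreMomentum legendreQ n t)
      - n * (n + 1) * (Real.sqrt (Real.sin t) * legendreQ n (Real.cos t))) t :=
  legendre_mode_system (f := legendreQ) (fun _ hx n => hasDerivAt_legendreQ hx n) n ht

theorem IsModeSolution.congr {l : ℕ} {f p g q : ℝ → ℂ} (hf : IsModeSolution l f p)
    (h1 : ∀ t ∈ Set.Ioo 0 Real.pi, g t = f t) (h2 : ∀ t ∈ Set.Ioo 0 Real.pi, q t = p t) :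
    IsModeSolution l g q := fun t ht => by
  have hmem := isOpen_Ioo.mem_nhds ht
  rw [h1 t ht, h2 t ht]
  exact ⟨(hf t ht).1.congr_of_eventuallyEq (Filter.eventually_of_mem hmem h1),
    (hf t ht).2.congr_of_eventuallyEq (Filter.eventually_of_mem hmem h2)⟩

theorem IsModeSolution.momentum_eq {l : ℕ} {f p : ℝ → ℂ} (hf : IsModeSolution l f p) {t : ℝ}
    (ht : t ∈ Set.Ioo 0 Real.pi) : deriv f t - (1 / 2) * (Real.cot t : ℂ) * f t = p t := by
  rw [(hf t ht).1.deriv]; ring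

/-- The momentum of `mode ρ ν l` in terms of Legendre functions. -/
def modeMomentumFormula (ρ ν : ℕ → ℝ) (l : ℕ) (t : ℝ) : ℂ :=
  (ρ l : ℂ) / Real.sqrt 2 * (legendreMomentum legendreP l t : ℂ)
    + ((ν l : ℂ) + Complex.I * (ρ l : ℂ)⁻¹) / Real.sqrt 2 * (legendreMomentum legendreQ l t : ℂ)

theorem mode_eq (ρ ν : ℕ → ℝ) (l : ℕ) (t : ℝ) : mode ρ ν l t =
    (ρ l : ℂ) / Real.sqrt 2 * ((Real.sqrt (Real.sin t) * legendreP l (Real.cos t) : ℝ) : ℂ)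
      + ((ν l : ℂ) + Complex.I * (ρ l : ℂ)⁻¹) / Real.sqrt 2
        * ((Real.sqrt (Real.sin t) * legendreQ l (Real.cos t) : ℝ) : ℂ) := by
  simp only [mode]
  push_cast
  ring

theorem mode_system_formula (ρ ν : ℕ → ℝ) (l : ℕ) :
    IsModeSolution l (mode ρ ν l) (modeMomentumFormula ρ ν l) := by
  have hP : IsModeSolution l
      (fun t => ((Real.sqrt (Real.sin t) * legendreP l (Real.cos t) : ℝ) : ℂ))
      (fun t => (legendreMomentum legendreP l t : ℂ)) := fun t ht => by
    constructor
    · refine (legendreP_mode_system l ht).1.ofReal_comp.congr_deriv ?_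
      push_cast; ring
    · refine (legendreP_mode_system l ht).2.ofReal_comp.congr_deriv ?_
      push_cast; ring
  have hQ : IsModeSolution l
      (fun t => ((Real.sqrt (Real.sin t) * legendreQ l (Real.cos t) : ℝ) : ℂ))
      (fun t => (legendreMomentum legendreQ l t : ℂ)) := fun t ht => by
    constructor
    · refine (legendreQ_mode_system l ht).1.ofReal_comp.congr_deriv ?_
      push_cast; ring
    · refine (legendreQ_mode_system l ht).2.ofReal_comp.congr_deriv ?_
      push_cast; ring
  have h := (hP.const_mul ((ρ l : ℂ) / Real.sqrt 2)).add
    (hQ.const_mul (((ν l : ℂ) + Complex.I * (ρ l : ℂ)⁻¹) / Real.sqrt 2))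
  exact h.congr (fun t _ => mode_eq ρ ν l t) (fun _ _ => rfl)

theorem modeMomentum_eq (ρ ν : ℕ → ℝ) (l : ℕ) {t : ℝ} (ht : t ∈ Set.Ioo 0 Real.pi) :
    modeMomentum ρ ν l t = modeMomentumFormula ρ ν l t :=
  (mode_system_formula ρ ν l).momentum_eq ht

theorem mode_system (ρ ν : ℕ → ℝ) (l : ℕ) :
    IsModeSolution l (mode ρ ν l) (modeMomentum ρ ν l) :=
  (mode_system_formula ρ ν l).congr (fun _ _ => rfl) fun _ ht => modeMomentum_eq ρ ν l ht

/-- The modes are normalized in the symplectic product. -/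
theorem mode_wronskian (ρ ν : ℕ → ℝ) (l : ℕ) (hρ : 0 < ρ l) {t : ℝ}
    (ht : t ∈ Set.Ioo 0 Real.pi) :
    mode ρ ν l t * conj (modeMomentum ρ ν l t) - conj (mode ρ ν l t) * modeMomentum ρ ν l t
      = Complex.I := by
  have hs := Real.sin_pos_of_mem_Ioo ht
  have hr0 : ((Real.sqrt (Real.sin t) : ℝ) : ℂ) ≠ 0 := by
    exact_mod_cast (Real.sqrt_pos.mpr hs).ne'
  have h2 : ((Real.sqrt 2 : ℝ) : ℂ) ^ 2 = 2 := by
    rw [← Complex.ofReal_pow, Real.sq_sqrt (by norm_num)]; norm_num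
  have h20 : ((Real.sqrt 2 : ℝ) : ℂ) ≠ 0 := by
    intro h; rw [h] at h2; norm_num at h2
  have hρ0 : (ρ l : ℂ) ≠ 0 := by exact_mod_cast hρ.ne'
  -- Only the cross terms between P and Q survive in the symplectic product. Their coefficient comes
  -- from ρ times the imaginary part of ν + i/ρ, which is 1, so ν drops out.
  have w : ((l : ℂ) + 1) * ((legendreQ l (Real.cos t) : ℂ) * legendreP (l + 1) (Real.cos t)
      - legendreP l (Real.cos t) * legendreQ (l + 1) (Real.cos t)) = 1 := by
    exact_mod_cast legendreP_wronskian (x := Real.cos t) l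
  rw [modeMomentum_eq ρ ν l ht, mode_eq, modeMomentumFormula]
  simp only [legendreMomentum]
  generalize Real.cos t = c at *
  push_cast
  simp only [map_add, map_mul, map_div₀, map_neg, map_sub, map_one, map_inv₀, Complex.conj_I,
    Complex.conj_ofReal, map_natCast]
  generalize (legendreQ l (Real.cos t) : ℂ) = q at *
  generalize (legendreP l (Real.cos t) : ℂ) = p at *
  generalize (legendreQ (l + 1) (Real.cos t) : ℂ) = q' at *
  generalize (legendreP (l + 1) (Real.cos t) : ℂ) = p' at *
  generalize ((Real.sqrt (Real.sin t) : ℝ) : ℂ) = r at *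
  generalize ((Real.sqrt 2 : ℝ) : ℂ) = a at *
  field_simp
  rw [h2]
  linear_combination (2 * Complex.I * (ρ l : ℂ) ^ 2) * w

/-! ### Large degree asymptotics of the reference modes -/

/-- The frequency `l + 1/2`. -/
def freq (l : ℕ) : ℝ := l + 1 / 2

theorem freq_pos (l : ℕ) : 0 < freq l := by unfold freq; positivity

theorem half_le_freq (l : ℕ) : 1 / 2 ≤ freq l := by
  unfold freq; linarith [(Nat.cast_nonneg l : (0 : ℝ) ≤ l)]

theorem hasDerivAt_cot {t : ℝ} (ht : t ∈ Set.Ioo 0 Real.pi) :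
    HasDerivAt Real.cot (-(1 / Real.sin t ^ 2)) t := by
  have hs := (Real.sin_pos_of_mem_Ioo ht).ne'
  have hfun : Real.cot = fun t => Real.cos t / Real.sin t := funext Real.cot_eq_cos_div_sin
  rw [hfun]
  refine ((Real.hasDerivAt_cos t).div (Real.hasDerivAt_sin t) hs).congr_deriv ?_
  field_simp
  linear_combination (-1 : ℝ) * Real.sin_sq_add_cos_sq t

theorem abs_cot_le {t : ℝ} (ht : t ∈ Set.Ioo 0 Real.pi) : |Real.cot t| ≤ 1 / Real.sin t := by
  have hs := Real.sin_pos_of_mem_Ioo ht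
  rw [Real.cot_eq_cos_div_sin, abs_div, abs_of_pos hs]
  gcongr
  exact Real.abs_cos_le_one t

/-! ### Energy estimate and slowly varying amplitudes of the mode equation -/

/-- The time derivative of a solution of the mode system. -/
def velocity (f p : ℝ → ℂ) (t : ℝ) : ℂ := p t + 1 / 2 * (Real.cot t : ℂ) * f t

/-- Eliminating the momentum gives an oscillator equation. The constant 1/4 of the mass term
completes l (l + 1) to (l + 1/2)², which is why `freq` is the natural frequency. -/
theorem IsModeSolution.hasDerivAt_velocity {l : ℕ} {f p : ℝ → ℂ} (hf : IsModeSolution l f p) {t : ℝ}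
    (ht : t ∈ Set.Ioo 0 Real.pi) : HasDerivAt (velocity f p)
      (-((freq l ^ 2 + 1 / 4 * (1 / Real.sin t ^ 2) : ℝ) : ℂ) * f t) t := by
  obtain ⟨h1, h2⟩ := hf t ht
  have h3 := ((hasDerivAt_cot ht).ofReal_comp.const_mul (1 / 2 : ℂ)).mul h1
  refine (h2.add h3).congr_deriv ?_
  have hs : (Real.sin t : ℂ) ≠ 0 := by exact_mod_cast (Real.sin_pos_of_mem_Ioo ht).ne'
  have hsc : (Real.sin t : ℂ) ^ 2 + (Real.cos t : ℂ) ^ 2 = 1 := by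
    exact_mod_cast Real.sin_sq_add_cos_sq t
  rw [Real.cot_eq_cos_div_sin, freq]
  rw [Complex.ofReal_div]
  generalize Real.cos t = c at *
  generalize Real.sin t = s at *
  push_cast
  field_simp
  linear_combination (4 * f t) * hsc

/-- The energy of a solution of the mode system. -/
def energy (l : ℕ) (f p : ℝ → ℂ) (t : ℝ) : ℝ := ‖velocity f p t‖ ^ 2 + freq l ^ 2 * ‖f t‖ ^ 2

theorem IsModeSolution.hasDerivAt_energy {l : ℕ} {f p : ℝ → ℂ} (hf : IsModeSolution l f p) {t : ℝ}
    (ht : t ∈ Set.Ioo 0 Real.pi) : HasDerivAt (energy l f p)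
      (-(1 / 2 * (1 / Real.sin t ^ 2) * inner ℝ (velocity f p t) (f t))) t := by
  refine ((hf.hasDerivAt_velocity ht).norm_sq.add
    ((hf t ht).1.norm_sq.const_mul (freq l ^ 2))).congr_deriv ?_
  change _ + freq l ^ 2 * (2 * inner ℝ (f t) (velocity f p t)) = _
  rw [← Complex.ofReal_neg, ← Complex.real_smul, inner_smul_right, real_inner_comm (f t)]
  ring

/-- Only the potential csc² t / 4 changes the energy, and 2 ω ‖v‖ ‖f‖ is at most the energy. The
resulting relative rate csc² t / (4 ω) has the explicit primitive -cot t / (4 ω). -/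
theorem abs_energy_deriv_le (l : ℕ) (f p : ℝ → ℂ) {t : ℝ} (ht : t ∈ Set.Ioo 0 Real.pi) :
    |(-(1 / 2 * (1 / Real.sin t ^ 2) * inner ℝ (velocity f p t) (f t)))|
      ≤ 1 / (4 * freq l) * (1 / Real.sin t ^ 2) * energy l f p t := by
  have hs := Real.sin_pos_of_mem_Ioo ht
  have hω := freq_pos l
  rw [abs_neg, abs_mul, abs_of_pos (by positivity)]
  have h1 := abs_real_inner_le_norm (velocity f p t) (f t)
  have h2 : 2 * freq l * (‖velocity f p t‖ * ‖f t‖) ≤ energy l f p t := by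
    unfold energy; nlinarith [sq_nonneg (‖velocity f p t‖ - freq l * ‖f t‖)]
  calc 1 / 2 * (1 / Real.sin t ^ 2) * |inner ℝ (velocity f p t) (f t)|
      ≤ 1 / 2 * (1 / Real.sin t ^ 2) * (‖velocity f p t‖ * ‖f t‖) := by gcongr
    _ = 1 / (4 * freq l) * (1 / Real.sin t ^ 2) * (2 * freq l * (‖velocity f p t‖ * ‖f t‖)) := by
        field_simp
        ring
    _ ≤ _ := by gcongr

theorem half_pi_mem : Real.pi / 2 ∈ Set.Ioo 0 Real.pi :=
  ⟨by positivity, by linarith [Real.pi_pos]⟩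

theorem cot_half_pi : Real.cot (Real.pi / 2) = 0 := by simp [Real.cot_eq_cos_div_sin]

/-- Grönwall's inequality starting from t = π/2; the factor does not depend on l because ω ≥ 1/2. -/
theorem IsModeSolution.energy_le {l : ℕ} {f p : ℝ → ℂ} (hf : IsModeSolution l f p) {t : ℝ}
    (ht : t ∈ Set.Ioo 0 Real.pi) :
    energy l f p t ≤ Real.exp (1 / (2 * Real.sin t)) * energy l f p (Real.pi / 2) := by
  have hω := freq_pos l
  -- The exponential is the integrating factor of the differential inequality. The product decreases
  -- for ε = 1 and increases for ε = -1; the first is used after π/2, the second before, and the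
  -- factor is 1 at π/2 since cot vanishes there.
  have key : ∀ ε : ℝ, ∀ x ∈ Set.Ioo 0 Real.pi,
      HasDerivAt (fun t => energy l f p t * Real.exp (ε * (1 / (4 * freq l) * Real.cot t)))
        ((-(1 / 2 * (1 / Real.sin x ^ 2) * inner ℝ (velocity f p x) (f x))
          - ε * (1 / (4 * freq l) * (1 / Real.sin x ^ 2) * energy l f p x))
          * Real.exp (ε * (1 / (4 * freq l) * Real.cot x))) x := fun ε x hx => by
    refine ((hf.hasDerivAt_energy hx).mul
      (((hasDerivAt_cot hx).const_mul (1 / (4 * freq l))).const_mul ε).exp).congr_deriv ?_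
    ring
  have hanti : AntitoneOn
      (fun t => energy l f p t * Real.exp (1 * (1 / (4 * freq l) * Real.cot t)))
      (Set.Ioo 0 Real.pi) := by
    refine antitoneOn_of_deriv_nonpos (convex_Ioo _ _)
      (fun x hx => (key 1 x hx).continuousAt.continuousWithinAt)
      (fun x hx => (key 1 x (interior_subset hx)).differentiableAt.differentiableWithinAt)
      fun x hx => ?_
    rw [(key 1 x (interior_subset hx)).deriv]
    refine mul_nonpos_of_nonpos_of_nonneg ?_ (Real.exp_pos _).le
    linarith [(abs_le.mp (abs_energy_deriv_le l f p (interior_subset hx))).2]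
  have hmono : MonotoneOn
      (fun t => energy l f p t * Real.exp (-1 * (1 / (4 * freq l) * Real.cot t)))
      (Set.Ioo 0 Real.pi) := by
    refine monotoneOn_of_deriv_nonneg (convex_Ioo _ _)
      (fun x hx => (key (-1) x hx).continuousAt.continuousWithinAt)
      (fun x hx => (key (-1) x (interior_subset hx)).differentiableAt.differentiableWithinAt)
      fun x hx => ?_
    rw [(key (-1) x (interior_subset hx)).deriv]
    refine mul_nonneg ?_ (Real.exp_pos _).le
    linarith [(abs_le.mp (abs_energy_deriv_le l f p (interior_subset hx))).1]
  have hE : 0 ≤ energy l f p (Real.pi / 2) := by unfold energy; positivity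
  have hs := Real.sin_pos_of_mem_Ioo ht
  have hcot : ∀ ε : ℝ, |ε| = 1 →
      ε * (1 / (4 * freq l) * Real.cot t) ≤ 1 / (2 * Real.sin t) := fun ε hε => by
    have h2 : 1 / (4 * freq l) ≤ 1 / 2 := by
      gcongr; linarith [half_le_freq l]
    calc ε * (1 / (4 * freq l) * Real.cot t) ≤ |ε * (1 / (4 * freq l) * Real.cot t)| := le_abs_self _
      _ = 1 / (4 * freq l) * |Real.cot t| := by
          rw [abs_mul, hε, abs_mul, abs_of_pos (by positivity : 0 < 1 / (4 * freq l)), one_mul]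
      _ ≤ 1 / 2 * (1 / Real.sin t) := by
          gcongr
          exact abs_cot_le ht
      _ = _ := by rw [one_div_mul_one_div]
  have fin : ∀ ε : ℝ, |ε| = 1 →
      energy l f p t * Real.exp (ε * (1 / (4 * freq l) * Real.cot t)) ≤ energy l f p (Real.pi / 2) →
      energy l f p t ≤ Real.exp (1 / (2 * Real.sin t)) * energy l f p (Real.pi / 2) := fun ε hε h => by
    have h3 : energy l f p t = energy l f p t * Real.exp (ε * (1 / (4 * freq l) * Real.cot t))
        * Real.exp (-ε * (1 / (4 * freq l) * Real.cot t)) := by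
      rw [mul_assoc, ← Real.exp_add]; simp
    rw [h3, mul_comm]
    refine mul_le_mul (Real.exp_le_exp.mpr (hcot (-ε) (by rwa [abs_neg]))) h ?_ (Real.exp_pos _).le
    have : 0 ≤ energy l f p t := by unfold energy; positivity
    positivity
  rcases le_total t (Real.pi / 2) with h | h
  · have := hmono ht half_pi_mem h
    simp only [cot_half_pi, mul_zero, Real.exp_zero, mul_one] at this
    exact fin (-1) (by simp) this
  · have := hanti half_pi_mem ht h
    simp only [cot_half_pi, mul_zero, Real.exp_zero, mul_one] at this
    exact fin 1 (by simp) this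

theorem IsModeSolution.norm_le {l : ℕ} {f p : ℝ → ℂ} (hf : IsModeSolution l f p) {t E : ℝ}
    (ht : t ∈ Set.Ioo 0 Real.pi) (hE : energy l f p (Real.pi / 2) ≤ E) :
    ‖f t‖ ≤ Real.sqrt (Real.exp (1 / (2 * Real.sin t)) * E) / freq l := by
  have hω := freq_pos l
  rw [le_div_iff₀ hω]
  refine Real.le_sqrt_of_sq_le ((?_ : _ ≤ energy l f p t).trans ((hf.energy_le ht).trans ?_))
  · unfold energy; nlinarith [sq_nonneg ‖velocity f p t‖]
  · gcongr

/-- Between t and π/2 the sine is smallest at t, so bounds in terms of 1 / sin hold along the whole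
segment with their value at t. -/
theorem sin_le_of_mem_uIcc {t s : ℝ} (ht : t ∈ Set.Ioo 0 Real.pi)
    (hs : s ∈ Set.uIcc t (Real.pi / 2)) : Real.sin t ≤ Real.sin s := by
  rcases Set.mem_uIcc.mp hs with h | h
  · exact Real.sin_le_sin_of_le_of_le_pi_div_two (by linarith [ht.1, Real.pi_pos]) h.2 h.1
  · rw [← Real.sin_pi_sub t, ← Real.sin_pi_sub s]
    exact Real.sin_le_sin_of_le_of_le_pi_div_two (by linarith [ht.2, Real.pi_pos])
      (by linarith [h.1]) (by linarith [h.2])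

theorem uIcc_half_pi_subset {t : ℝ} (ht : t ∈ Set.Ioo 0 Real.pi) :
    Set.uIcc t (Real.pi / 2) ⊆ Set.Ioo 0 Real.pi :=
  Set.ordConnected_Ioo.uIcc_subset ht half_pi_mem

/-- The two circularly rotating amplitudes of a mode are almost constant. -/
theorem IsModeSolution.rotating_amplitude {l : ℕ} {f p : ℝ → ℂ} (hf : IsModeSolution l f p)
    {t E ε : ℝ} (ht : t ∈ Set.Ioo 0 Real.pi) (hE : energy l f p (Real.pi / 2) ≤ E)
    (hε : ε ^ 2 = 1) :
    ‖Complex.exp (-(Complex.I * (ε * freq l : ℝ) * t))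
          * (velocity f p t + Complex.I * (ε * freq l : ℝ) * f t)
        - Complex.exp (-(Complex.I * (ε * freq l : ℝ) * (Real.pi / 2 : ℝ)))
          * (velocity f p (Real.pi / 2) + Complex.I * (ε * freq l : ℝ) * f (Real.pi / 2))‖
      ≤ 1 / 4 * (1 / Real.sin t ^ 2) * (Real.sqrt (Real.exp (1 / (2 * Real.sin t)) * E) / freq l)
        * Real.pi := by
  set w : ℝ := ε * freq l with hw
  have hw2 : (w : ℂ) ^ 2 = (freq l : ℂ) ^ 2 := by
    have : w ^ 2 = freq l ^ 2 := by rw [hw, mul_pow, hε, one_mul]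
    exact_mod_cast this
  have hE0 : 0 ≤ E := le_trans (by unfold energy; positivity) hE
  have hs := Real.sin_pos_of_mem_Ioo ht
  -- The phase factor undoes the free rotation: since w² = ω², the oscillator terms cancel and only
  -- the potential term csc² f / 4 is left. It is small because the energy bound gives f a factor
  -- 1/ω.
  have hderiv : ∀ s ∈ Set.Ioo 0 Real.pi, HasDerivAt (fun s : ℝ =>
      Complex.exp (-(Complex.I * w * s)) * (velocity f p s + Complex.I * w * f s))
      (Complex.exp (-(Complex.I * w * s)) * (-((1 / 4 * (1 / Real.sin s ^ 2) : ℝ) : ℂ) * f s)) s :=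
    fun s hs => by
    have h1 : HasDerivAt (fun s : ℝ => Complex.exp (-(Complex.I * w * s)))
        (Complex.exp (-(Complex.I * w * s)) * (-(Complex.I * w))) s := by
      have := (((hasDerivAt_id s).ofReal_comp.const_mul (Complex.I * w)).neg).cexp
      simpa using this
    have h2 := (hf.hasDerivAt_velocity hs).add ((hf s hs).1.const_mul (Complex.I * w))
    refine (h1.mul h2).congr_deriv ?_
    change _ + _ * (_ + Complex.I * w * velocity f p s) = _
    simp only [Pi.add_apply]
    rw [Complex.ofReal_add, Complex.ofReal_pow, ← hw2]
    linear_combination (-(Complex.exp (-(Complex.I * w * s)) * w ^ 2 * f s)) * Complex.I_sq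
  have hbound : ∀ s ∈ Set.uIcc t (Real.pi / 2),
      ‖Complex.exp (-(Complex.I * w * s)) * (-((1 / 4 * (1 / Real.sin s ^ 2) : ℝ) : ℂ) * f s)‖
      ≤ 1 / 4 * (1 / Real.sin t ^ 2) *
        (Real.sqrt (Real.exp (1 / (2 * Real.sin t)) * E) / freq l) := fun s hs' => by
    have hle := sin_le_of_mem_uIcc ht hs'
    have hs1 : 0 < Real.sin s := hs.trans_le hle
    have hn : ‖Complex.exp (-(Complex.I * w * s))‖ = 1 := by
      rw [Complex.norm_exp]; simp
    rw [norm_mul, hn, one_mul, norm_mul, norm_neg, Complex.norm_real, Real.norm_of_nonneg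
      (by positivity)]
    have hfs := hf.norm_le (uIcc_half_pi_subset ht hs') hE
    have hω := freq_pos l
    refine mul_le_mul ?_ (hfs.trans ?_) (norm_nonneg _) (by positivity)
    · gcongr
    · gcongr
  have := (convex_uIcc t (Real.pi / 2)).norm_image_sub_le_of_norm_hasDerivWithin_le
    (fun s hs => (hderiv s (uIcc_half_pi_subset ht hs)).hasDerivWithinAt) hbound
    Set.right_mem_uIcc Set.left_mem_uIcc
  refine this.trans ?_
  have hω := freq_pos l
  gcongr
  rw [Real.norm_eq_abs, abs_le]
  constructor <;> linarith [ht.1, ht.2, Real.pi_pos]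

/-! #### Values at the equator -/

/-- At x = 0 Bonnet's recurrence connects only degrees of equal parity, so c is a product of ratios
(2j + 1)/(2j + 2) and its square is governed by the Wallis product. The value of Q at odd degree is
its reciprocal, as the Casoratian demands. -/
theorem legendre_zero_values (k : ℕ) : ∃ c : ℝ, 0 < c ∧ c ^ 2 * ((2 * k + 1) * Real.Wallis.W k) = 1 ∧
    legendreP (2 * k) 0 = (-1) ^ k * c ∧ legendreP (2 * k + 1) 0 = 0 ∧ legendreQ (2 * k) 0 = 0 ∧
    legendreQ (2 * k + 1) 0 = (-1) ^ (k + 1) / ((2 * k + 1) * c) := by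
  induction k with
  | zero => exact ⟨1, by simp [legendreP, legendreQ, Real.Wallis.W]⟩
  | succ k ih =>
    obtain ⟨c, hc, hW, h1, h2, h3, h4⟩ := ih
    have e1 : 2 * (k + 1) = 2 * k + 2 := by ring
    have e2 : 2 * (k + 1) + 1 = (2 * k + 1) + 2 := by ring
    refine ⟨(2 * k + 1) / (2 * k + 2) * c, by positivity, ?_, ?_, ?_, ?_, ?_⟩
    · rw [Real.Wallis.W_succ]
      push_cast
      refine Eq.trans ?_ hW
      field_simp
      ring
    · rw [e1, bonnet_legendreP, h1, h2]
      push_cast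
      field_simp
      ring
    · rw [e2, bonnet_legendreP, h2]; simp
    · rw [e1, bonnet_legendreQ, h3]; simp
    · rw [e2, bonnet_legendreQ, h4]
      push_cast
      field_simp
      ring

/-- The reference parameter `ρ = √(π/2)` with `ν = 0`. -/
def refRho : ℕ → ℝ := fun _ => Real.sqrt (Real.pi / 2)

theorem refRho_pos (l : ℕ) : 0 < refRho l := Real.sqrt_pos.mpr (by positivity)

theorem refRho_sq (l : ℕ) : refRho l ^ 2 = Real.pi / 2 := Real.sq_sqrt (by positivity)

theorem mode_half_pi (ρ ν : ℕ → ℝ) (l : ℕ) : mode ρ ν l (Real.pi / 2) = ((ρ l : ℂ) *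
    (legendreP l 0 : ℂ) + ((ν l : ℂ) + Complex.I * (ρ l : ℂ)⁻¹) * (legendreQ l 0 : ℂ))
      / Real.sqrt 2 := by
  rw [mode_eq]
  simp only [Real.sin_pi_div_two, Real.cos_pi_div_two, Real.sqrt_one, one_mul]
  ring

theorem modeMomentum_half_pi (ρ ν : ℕ → ℝ) (l : ℕ) : modeMomentum ρ ν l (Real.pi / 2) =
    (l + 1) * ((ρ l : ℂ) * (legendreP (l + 1) 0 : ℂ)
      + ((ν l : ℂ) + Complex.I * (ρ l : ℂ)⁻¹) * (legendreQ (l + 1) 0 : ℂ)) / Real.sqrt 2 := by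
  rw [modeMomentum_eq _ _ _ half_pi_mem, modeMomentumFormula]
  simp only [legendreMomentum, Real.sin_pi_div_two, Real.cos_pi_div_two, Real.sqrt_one]
  push_cast
  ring

/-- Here x stands for k, 2 x + 1/2 for the frequency of degree 2k and R for the squared amplitude;
the two hypotheses are the two Wallis bounds. -/
theorem abs_sub_one_le_of_even {x R : ℝ} (hx : 0 ≤ x) (lo : 2 * x + 1 / 2 ≤ R * (2 * x + 1))
    (hi : R * ((2 * x + 1) * (2 * x + 1)) ≤ (2 * x + 1 / 2) * (2 * x + 2)) :
    1 / 2 ≤ R ∧ |R - 1| ≤ 1 / (2 * x + 1 / 2) := by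
  have hlo : (2 * x + 1 / 2) / (2 * x + 1) ≤ R := by rwa [div_le_iff₀ (by positivity)]
  have hhi : R ≤ (2 * x + 1 / 2) * (2 * x + 2) / ((2 * x + 1) * (2 * x + 1)) := by
    rwa [le_div_iff₀ (by positivity)]
  have h1 : 0 ≤ (2 * x + 1 / 2) / (2 * x + 1) - 1 + 1 / (2 * x + 1 / 2) := by
    rw [show (2 * x + 1 / 2) / (2 * x + 1) - 1 + 1 / (2 * x + 1 / 2)
      = (2 * x + 3/2) / (2 * (2 * x + 1) * (2 * x + 1/2)) by field_simp; ring]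
    positivity
  have h2 : 0 ≤ 1 / (2 * x + 1 / 2)
      - ((2 * x + 1 / 2) * (2 * x + 2) / ((2 * x + 1) * (2 * x + 1)) - 1) := by
    rw [show 1 / (2 * x + 1 / 2) - ((2 * x + 1 / 2) * (2 * x + 2) / ((2 * x + 1) * (2 * x + 1)) - 1)
      = (2 * x ^ 2 + 7 / 2 * x + 1) / ((2 * x + 1 / 2) * ((2 * x + 1) * (2 * x + 1))) by
        field_simp; ring]
    positivity
  exact ⟨by nlinarith, abs_le.mpr ⟨by linarith, by linarith⟩⟩

theorem abs_sub_one_le_of_odd {x R : ℝ} (hx : 0 ≤ x) (lo : 2 * x + 3 / 2 ≤ R * (2 * x + 2))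
    (hi : R * (2 * x + 1) ≤ 2 * x + 3 / 2) :
    1 / 2 ≤ R ∧ |R - 1| ≤ 1 / (2 * x + 3 / 2) := by
  have hlo : (2 * x + 3 / 2) / (2 * x + 2) ≤ R := by rwa [div_le_iff₀ (by positivity)]
  have hhi : R ≤ (2 * x + 3 / 2) / (2 * x + 1) := by rwa [le_div_iff₀ (by positivity)]
  have h1 : 0 ≤ (2 * x + 3 / 2) / (2 * x + 2) - 1 + 1 / (2 * x + 3 / 2) := by
    rw [show (2 * x + 3 / 2) / (2 * x + 2) - 1 + 1 / (2 * x + 3 / 2)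
      = (2 * x + 5/2) / (2 * (2 * x + 2) * (2 * x + 3/2)) by field_simp; ring]
    positivity
  have h2 : 0 ≤ 1 / (2 * x + 3 / 2) - ((2 * x + 3 / 2) / (2 * x + 1) - 1) := by
    rw [show 1 / (2 * x + 3 / 2) - ((2 * x + 3 / 2) / (2 * x + 1) - 1)
      = (2 * x + 1 / 2) / (2 * (2 * x + 3 / 2) * (2 * x + 1)) by field_simp; ring]
    positivity
  exact ⟨by nlinarith, abs_le.mpr ⟨by linarith, by linarith⟩⟩

/-- Initial data of the reference modes at the equator: amplitude `r` and phase `σ`. -/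
def HasRefData (l : ℕ) : Prop := ∃ (σ : ℂ) (r : ℝ), ‖σ‖ = 1 ∧ 0 < r ∧ 1 / 2 ≤ r ^ 2 ∧
    |r ^ 2 - 1| ≤ 1 / freq l ∧
    mode refRho 0 l (Real.pi / 2) = σ * (r / (Real.sqrt (freq l) * Real.sqrt 2) : ℝ) ∧
    modeMomentum refRho 0 l (Real.pi / 2)
      = -Complex.I * σ * (Real.sqrt (freq l) / (r * Real.sqrt 2) : ℝ)

theorem hasRefData_of_even {l k : ℕ} (hk : l = 2 * k) : HasRefData l := by
  have hω := freq_pos l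
  have hsω : 0 < Real.sqrt (freq l) := Real.sqrt_pos.mpr hω
  have hsω2 := Real.sq_sqrt hω.le
  have hρ := refRho_pos l
  have hρ2 := refRho_sq l
  have hsωC : ((Real.sqrt (freq l) : ℝ) : ℂ) ≠ 0 := by exact_mod_cast hsω.ne'
  have hρC : (refRho l : ℂ) ≠ 0 := by exact_mod_cast hρ.ne'
  have h2C : ((Real.sqrt 2 : ℝ) : ℂ) ≠ 0 := by exact_mod_cast (Real.sqrt_pos.mpr two_pos).ne'
  obtain ⟨c, hc, hW, h1, h2, h3, h4⟩ := legendre_zero_values k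
  have hcC : (c : ℂ) ≠ 0 := by exact_mod_cast hc.ne'
  have hk1 : ((2 : ℂ) * k + 1) ≠ 0 := by exact_mod_cast (Nat.succ_ne_zero (2 * k))
  have hWp := Real.Wallis.W_pos k
  have hW1 := Real.Wallis.W_le k
  have hW2 := Real.Wallis.le_W k
  have hfr : freq l = 2 * k + 1 / 2 := by rw [freq, hk]; push_cast; ring
  -- This singles out √(π/2): ρ² equals the limit π/2 of the Wallis products, so the squared
  -- amplitude R tends to 1.
  have hr2 : (Real.sqrt (freq l) * refRho l * c) ^ 2 * ((2 * k + 1) * Real.Wallis.W k)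
      = freq l * (Real.pi / 2) := by
    rw [mul_pow, mul_pow, hsω2, hρ2, mul_assoc, hW, mul_one]
  set R := (Real.sqrt (freq l) * refRho l * c) ^ 2 with hR
  have hR0 : 0 ≤ R := sq_nonneg _
  have hpi := Real.pi_pos
  have hk0 : (0 : ℝ) ≤ k := Nat.cast_nonneg k
  -- lower bound
  have lo : freq l ≤ R * (2 * k + 1) := by
    have : R * ((2 * k + 1) * Real.Wallis.W k) ≤ R * ((2 * k + 1) * (Real.pi / 2)) := by gcongr
    rw [hr2] at this
    nlinarith
  have hi : R * ((2 * k + 1) * (2 * k + 1)) ≤ freq l * (2 * k + 2) := by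
    rw [div_mul_eq_mul_div, div_le_iff₀ (by positivity)] at hW2
    have : R * ((2 * k + 1) * ((2 * k + 1) * (Real.pi / 2)))
        ≤ R * ((2 * k + 1) * (Real.Wallis.W k * (2 * k + 2))) := by gcongr
    have h5 : R * ((2 * k + 1) * (Real.Wallis.W k * (2 * k + 2)))
      = freq l * (Real.pi / 2) * (2 * k + 2) := by rw [← hr2]; ring
    rw [h5] at this
    nlinarith
  -- In even degree the value of the mode comes from P alone and its momentum from Q in degree l +
  -- 1; these are reciprocal up to sign and the factor 2k + 1, so one amplitude describes both.
  refine ⟨(-1) ^ k, Real.sqrt (freq l) * refRho l * c, by simp, by positivity, ?_, ?_, ?_, ?_⟩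
  · exact (abs_sub_one_le_of_even hk0 (hfr ▸ lo) (hfr ▸ hi)).1
  · rw [hfr]; exact (abs_sub_one_le_of_even hk0 (hfr ▸ lo) (hfr ▸ hi)).2
  · rw [mode_half_pi, hk, h1, h3, ← hk]
    push_cast
    field_simp
    simp
  · rw [modeMomentum_half_pi, hk, h2, h4, ← hk]
    have : (l : ℂ) = 2 * k := by rw [hk]; push_cast; ring
    rw [this]
    push_cast
    field_simp
    simp only [Pi.zero_apply, Complex.ofReal_zero]
    ring

theorem hasRefData_of_odd {l k : ℕ} (hk : l = 2 * k + 1) : HasRefData l := by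
  have hω := freq_pos l
  have hsω : 0 < Real.sqrt (freq l) := Real.sqrt_pos.mpr hω
  have hsω2 := Real.sq_sqrt hω.le
  have hρ := refRho_pos l
  have hρ2 := refRho_sq l
  have hsωC : ((Real.sqrt (freq l) : ℝ) : ℂ) ≠ 0 := by exact_mod_cast hsω.ne'
  have hρC : (refRho l : ℂ) ≠ 0 := by exact_mod_cast hρ.ne'
  have h2C : ((Real.sqrt 2 : ℝ) : ℂ) ≠ 0 := by exact_mod_cast (Real.sqrt_pos.mpr two_pos).ne'
  obtain ⟨c, hc, hW, h1, h2, h3, h4⟩ := legendre_zero_values k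
  have hP2 : legendreP (2 * k + 2) 0 = -((2 * k + 1) / (2 * k + 2)) * ((-1) ^ k * c) := by
    rw [bonnet_legendreP, h1]; push_cast; field_simp; ring
  have hQ2 : legendreQ (2 * k + 2) 0 = 0 := by rw [bonnet_legendreQ, h3]; simp
  have hcC : (c : ℂ) ≠ 0 := by exact_mod_cast hc.ne'
  have hk1 : ((2 : ℂ) * k + 1) ≠ 0 := by exact_mod_cast (Nat.succ_ne_zero (2 * k))
  have hk2 : ((2 : ℂ) * k + 2) ≠ 0 := by exact_mod_cast (Nat.succ_ne_zero (2 * k + 1))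
  have hWp := Real.Wallis.W_pos k
  have hW1 := Real.Wallis.W_le k
  have hW2 := Real.Wallis.le_W k
  have hfr : freq l = 2 * k + 3 / 2 := by rw [freq, hk]; push_cast; ring
  have hr2 : (Real.sqrt (freq l) / (refRho l * ((2 * k + 1) * c))) ^ 2
      * ((2 * k + 1) * (Real.pi / 2)) = freq l * Real.Wallis.W k := by
    rw [div_pow, mul_pow, mul_pow, hsω2, hρ2]
    field_simp
    linear_combination (-1 : ℝ) * hW
  set R := (Real.sqrt (freq l) / (refRho l * ((2 * k + 1) * c))) ^ 2 with hR
  have hR0 : 0 ≤ R := sq_nonneg _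
  have hpi := Real.pi_pos
  have hk0 : (0 : ℝ) ≤ k := Nat.cast_nonneg k
  have hi : R * (2 * k + 1) ≤ freq l := by
    have : freq l * Real.Wallis.W k ≤ freq l * (Real.pi / 2) := by gcongr
    rw [← hr2] at this
    nlinarith
  have lo : freq l ≤ R * (2 * k + 2) := by
    rw [div_mul_eq_mul_div, div_le_iff₀ (by positivity)] at hW2
    have : freq l * ((2 * k + 1) * (Real.pi / 2)) ≤ freq l * (Real.Wallis.W k * (2 * k + 2)) := by
      gcongr
    rw [← mul_assoc, ← mul_assoc (freq l), ← hr2] at this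
    have h6 : 0 ≤ (R * (2 * k + 2) - freq l) * ((2 * k + 1) * (Real.pi / 2)) := by linarith
    have := nonneg_of_mul_nonneg_left h6 (by positivity)
    linarith
  -- In odd degree P and Q exchange roles: the value is i Q / ρ up to 1/√2, which explains the phase
  -- `Complex.I` and the reciprocal amplitude.
  refine ⟨Complex.I * (-1) ^ (k + 1), Real.sqrt (freq l) / (refRho l * ((2 * k + 1) * c)),
    by simp, by positivity, ?_, ?_, ?_, ?_⟩
  · exact (abs_sub_one_le_of_odd hk0 (hfr ▸ lo) (hfr ▸ hi)).1
  · rw [hfr]; exact (abs_sub_one_le_of_odd hk0 (hfr ▸ lo) (hfr ▸ hi)).2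
  · rw [mode_half_pi, hk, h2, h4, ← hk]
    push_cast
    field_simp
    simp only [Pi.zero_apply, Complex.ofReal_zero]
    ring
  · rw [modeMomentum_half_pi, hk, hP2, hQ2, ← hk]
    have : (l : ℂ) = 2 * k + 1 := by rw [hk]; push_cast; ring
    rw [this]
    push_cast
    rw [show (2 * (k : ℂ) + 1 + 1) = 2 * k + 2 by ring]
    field_simp
    simp only [Complex.I_sq]
    ring

theorem refMode_data (l : ℕ) : HasRefData l := by
  rcases Nat.even_or_odd' l with ⟨k, hk | hk⟩
  exacts [hasRefData_of_even hk, hasRefData_of_odd hk]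

/-- At t = π/2 the amplitudes v + iωf and v - iωf of a reference mode are proportional to r - 1/r
and r + 1/r. The first should vanish and the second should have r + 1/r = 2, both up to O(1/ω). -/
theorem abs_sub_inv_le {r w : ℝ} (hr : 0 < r) (hr2 : 1 / 2 ≤ r ^ 2) (h : |r ^ 2 - 1| ≤ 1 / w) :
    |r - 1 / r| ≤ Real.sqrt 2 * (1 / w) ∧ |(1 / r + r) / 2 - 1| ≤ Real.sqrt 2 * (1 / w) := by
  have h2 := Real.sq_sqrt (zero_le_two : (0 : ℝ) ≤ 2)
  have h20 := Real.sqrt_nonneg 2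
  have hinv : 1 / r ≤ Real.sqrt 2 := by
    rw [div_le_iff₀ hr]
    nlinarith [mul_nonneg h20 hr.le, sq_nonneg (Real.sqrt 2 * r - 1)]
  have hw : 0 ≤ 1 / w := (abs_nonneg _).trans h
  constructor
  · rw [show r - 1 / r = (1 / r) * (r ^ 2 - 1) by field_simp, abs_mul, abs_of_pos (by positivity)]
    gcongr
  · rw [show (1 / r + r) / 2 - 1 = (1 / r) * ((r - 1) ^ 2 / 2) by field_simp; ring, abs_mul,
      abs_of_pos (by positivity)]
    gcongr
    rw [abs_of_nonneg (by positivity)]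
    refine le_trans ?_ h
    rw [show r ^ 2 - 1 = (r - 1) * (r + 1) by ring, abs_mul, ← sq_abs (r - 1), sq]
    have : |r - 1| ≤ |r + 1| := by
      rw [abs_of_pos (by linarith : 0 < r + 1), abs_le]
      constructor <;> linarith
    nlinarith [abs_nonneg (r - 1), mul_le_mul_of_nonneg_left this (abs_nonneg (r - 1))]

theorem norm_exp_I_mul (a t : ℝ) : ‖Complex.exp (-(Complex.I * (a : ℂ) * (t : ℂ)))‖ = 1 := by
  rw [Complex.norm_exp]; simp

/-- Asymptotics of the reference modes: with `ω = l + 1/2`, uniformly in `l`,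
`√ω ζ_l(t) = σ_l exp(-iωt) / √2 + O(1/ω)` and `p_l + iω ζ_l = O(1/√ω)`. -/
theorem refMode_asymptotics : ∃ σ : ℕ → ℂ, (∀ l, ‖σ l‖ = 1) ∧ ∀ t ∈ Set.Ioo 0 Real.pi,
    ∃ C : ℝ, 0 ≤ C ∧ ∀ l,
      ‖modeMomentum refRho 0 l t + Complex.I * freq l * mode refRho 0 l t‖
        ≤ C / Real.sqrt (freq l) ∧
      ‖(Real.sqrt (freq l) : ℂ) * mode refRho 0 l t
        - σ l * Complex.exp (-(Complex.I * freq l * t)) / Real.sqrt 2‖ ≤ C / freq l := by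
  choose σ r hσ hr hr2 hr1 hm hp using refMode_data
  -- The extra phase exp(iωπ/2) makes the plane wave exp(-iωt) take the phase of the mode at t =
  -- π/2.
  refine ⟨fun l => Complex.exp (-(Complex.I * (-freq l : ℝ) * (Real.pi / 2 : ℝ))) * σ l, fun l => by
    rw [norm_mul, norm_exp_I_mul, hσ, one_mul], fun t ht => ?_⟩
  have hs := Real.sin_pos_of_mem_Ioo ht
  set B := Real.sqrt (Real.exp (1 / (2 * Real.sin t)) * 3) with hB
  set K := 1 / 4 * (1 / Real.sin t ^ 2) * B * Real.pi with hK
  have hB0 : 0 ≤ B := Real.sqrt_nonneg _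
  have hK0 : 0 ≤ K := by positivity
  refine ⟨2 + 2 * K + 1 / Real.sin t * B, by positivity, fun l => ?_⟩
  have hω := freq_pos l
  have hsω : 0 < Real.sqrt (freq l) := Real.sqrt_pos.mpr hω
  have hsω2 := Real.mul_self_sqrt hω.le
  have h2 := Real.mul_self_sqrt (zero_le_two : (0 : ℝ) ≤ 2)
  have h20 : 0 < Real.sqrt 2 := Real.sqrt_pos.mpr two_pos
  obtain ⟨hinv1, hinv2⟩ := abs_sub_inv_le (hr l) (hr2 l) (hr1 l)
  have hsys := mode_system refRho 0 l
  have hm := hm l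
  have hp := hp l
  set f := mode refRho 0 l with hf
  set p := modeMomentum refRho 0 l with hpdef
  have hv0 : velocity f p (Real.pi / 2) = p (Real.pi / 2) := by
    rw [velocity, cot_half_pi]; simp
  -- Since 1/ω ≤ 2, the squared amplitude lies between 1/2 and 3. The kinetic part is then at most ω
  -- and the potential part at most 3ω/2.
  have hE : energy l f p (Real.pi / 2) ≤ 3 * freq l := by
    have e1 : ‖f (Real.pi / 2)‖ ^ 2 = r l ^ 2 / (2 * freq l) := by
      rw [hm, norm_mul, hσ, one_mul, Complex.norm_real, Real.norm_of_nonneg (by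
        have := hr l; positivity), div_pow, mul_pow, Real.sq_sqrt hω.le, Real.sq_sqrt zero_le_two]
      ring
    have e2 : ‖p (Real.pi / 2)‖ ^ 2 = freq l / (2 * r l ^ 2) := by
      rw [hp, norm_mul, norm_mul, hσ, norm_neg, Complex.norm_I, one_mul, one_mul,
        Complex.norm_real, Real.norm_of_nonneg (by
        have := hr l; positivity), div_pow, mul_pow, Real.sq_sqrt hω.le, Real.sq_sqrt zero_le_two]
      ring
    rw [energy, hv0, e1, e2]
    have h3 : r l ^ 2 ≤ 3 := by
      have h5 : 1 / freq l ≤ 2 := by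
        rw [div_le_iff₀ hω]; linarith [half_le_freq l]
      linarith [(abs_le.mp ((hr1 l).trans h5)).2]
    have h4 : freq l / (2 * r l ^ 2) ≤ freq l := div_le_self hω.le (by linarith [hr2 l])
    have h5 : freq l ^ 2 * (r l ^ 2 / (2 * freq l)) ≤ 3 / 2 * freq l := by
      rw [show freq l ^ 2 * (r l ^ 2 / (2 * freq l)) = r l ^ 2 / 2 * freq l by field_simp]
      gcongr
    linarith
  have hBω : Real.sqrt (Real.exp (1 / (2 * Real.sin t)) * (3 * freq l)) / freq l
      = B / Real.sqrt (freq l) := by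
    rw [← mul_assoc, Real.sqrt_mul (by positivity), ← hB, div_eq_div_iff hω.ne' hsω.ne']
    linear_combination B * hsω2
  have hft := hsys.norm_le ht hE
  rw [hBω] at hft
  have rot : ∀ ε : ℝ, ε ^ 2 = 1 → _ := fun ε hε => hsys.rotating_amplitude ht hE hε
  rw [hBω, show 1 / 4 * (1 / Real.sin t ^ 2) * (B / Real.sqrt (freq l)) * Real.pi
    = K / Real.sqrt (freq l) by rw [hK]; ring] at rot
  have rotG := rot 1 (by norm_num)
  have rotH := rot (-1) (by norm_num)
  rw [one_mul] at rotG
  rw [neg_one_mul] at rotH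
  -- the growing amplitude is small
  have hG0 : ‖velocity f p (Real.pi / 2) + Complex.I * (freq l : ℝ) * f (Real.pi / 2)‖
      ≤ 1 / Real.sqrt (freq l) := by
    have : velocity f p (Real.pi / 2) + Complex.I * (freq l : ℝ) * f (Real.pi / 2)
        = Complex.I * σ l * (Real.sqrt (freq l) / Real.sqrt 2 * (r l - 1 / r l) : ℝ) := by
      rw [hv0, hm, hp]
      have e : (freq l : ℂ) = Real.sqrt (freq l) * Real.sqrt (freq l) := by exact_mod_cast hsω2.symm
      rw [e]
      have := (hr l).ne'
      push_cast
      have a1 : (r l : ℂ) ≠ 0 := by exact_mod_cast this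
      have a2 : ((Real.sqrt (freq l) : ℝ) : ℂ) ≠ 0 := by exact_mod_cast hsω.ne'
      have a3 : ((Real.sqrt 2 : ℝ) : ℂ) ≠ 0 := by exact_mod_cast h20.ne'
      field_simp
      ring
    rw [this, norm_mul, norm_mul, Complex.norm_I, hσ, one_mul, one_mul, Complex.norm_real,
      Real.norm_eq_abs, abs_mul, abs_of_pos (by positivity)]
    calc _ ≤ Real.sqrt (freq l) / Real.sqrt 2 * (Real.sqrt 2 * (1 / freq l)) := by gcongr
      _ = 1 / Real.sqrt (freq l) := by
        rw [eq_div_iff hsω.ne']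
        field_simp
        linear_combination hsω2
  have hG : ‖velocity f p t + Complex.I * (freq l : ℝ) * f t‖ ≤ (1 + K) / Real.sqrt (freq l) := by
    have h6 := norm_le_norm_sub_add
      (Complex.exp (-(Complex.I * (freq l : ℝ) * t))
          * (velocity f p t + Complex.I * (freq l : ℝ) * f t))
      (Complex.exp (-(Complex.I * (freq l : ℝ) * (Real.pi / 2 : ℝ)))
          * (velocity f p (Real.pi / 2) + Complex.I * (freq l : ℝ) * f (Real.pi / 2)))
    rw [norm_mul, norm_exp_I_mul, one_mul, norm_mul (Complex.exp _) (velocity f p (Real.pi / 2) + _),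
      norm_exp_I_mul, one_mul] at h6
    rw [add_div]
    linarith
  constructor
  · have : p t + Complex.I * freq l * f t = (velocity f p t + Complex.I * (freq l : ℝ) * f t)
        - 1 / 2 * (Real.cot t : ℂ) * f t := by rw [velocity]; ring
    rw [this]
    refine (norm_sub_le _ _).trans ?_
    have h7 : ‖1 / 2 * (Real.cot t : ℂ) * f t‖
        ≤ 1 / 2 * (1 / Real.sin t) * (B / Real.sqrt (freq l)) := by
      rw [norm_mul, norm_mul, Complex.norm_real, Real.norm_eq_abs]
      have := abs_cot_le ht
      norm_num
      gcongr
      simpa using this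
    calc _ ≤ (1 + K) / Real.sqrt (freq l) + 1 / 2 * (1 / Real.sin t) * (B / Real.sqrt (freq l)) :=
        add_le_add hG h7
      _ = (1 + K + 1 / 2 * (1 / Real.sin t * B)) / Real.sqrt (freq l) := by ring
      _ ≤ _ := by
        gcongr ?_ / _
        have : 0 ≤ 1 / Real.sin t * B := by positivity
        linarith
  · set e := Complex.exp (-(Complex.I * (-freq l : ℝ) * t)) with he
    set e0 := Complex.exp (-(Complex.I * (-freq l : ℝ) * (Real.pi / 2 : ℝ))) with he0
    set e' := Complex.exp (-(Complex.I * freq l * t)) with he'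
    have hee : e' * e = 1 := by
      rw [he, he', ← Complex.exp_add]; simp
    have hn' : ‖e'‖ = 1 := norm_exp_I_mul _ _
    have hn0 : ‖e0‖ = 1 := norm_exp_I_mul _ _
    set δ := e * (velocity f p t + Complex.I * (-freq l : ℝ) * f t)
      - e0 * (velocity f p (Real.pi / 2) + Complex.I * (-freq l : ℝ) * f (Real.pi / 2)) with hδ
    have a2 : ((Real.sqrt (freq l) : ℝ) : ℂ) ≠ 0 := by exact_mod_cast hsω.ne'
    -- The mode is recovered from 2iωf = (v + iωf) - (v - iωf). The error has three sources: the
    -- small amplitude v + iωf, the drift δ of the other amplitude since π/2, and the deviation of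
    -- (r + 1/r)/2 from 1.
    have key : (Real.sqrt (freq l) : ℂ) * f t - e0 * σ l * e' / Real.sqrt 2
        = (velocity f p t + Complex.I * (freq l : ℝ) * f t) / (2 * Complex.I * Real.sqrt (freq l))
          - e' * δ / (2 * Complex.I * Real.sqrt (freq l))
          + e' * (e0 * σ l) * (((1 / r l + r l) / 2 - 1) / Real.sqrt 2 : ℝ) := by
      have hD : e' * δ = velocity f p t - Complex.I * freq l * f t
          + e' * (e0 * (Complex.I * σ l * (Real.sqrt (freq l) / Real.sqrt 2 * (1 / r l + r l) : ℝ))) := by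
        have : velocity f p (Real.pi / 2) + Complex.I * (-freq l : ℝ) * f (Real.pi / 2)
            = -(Complex.I * σ l * (Real.sqrt (freq l) / Real.sqrt 2 * (1 / r l + r l) : ℝ)) := by
          rw [hv0, hm, hp]
          have e : (freq l : ℂ) = Real.sqrt (freq l) * Real.sqrt (freq l) := by
            exact_mod_cast hsω2.symm
          push_cast
          rw [e]
          have := (hr l).ne'
          have a1 : (r l : ℂ) ≠ 0 := by exact_mod_cast this
          have a3 : ((Real.sqrt 2 : ℝ) : ℂ) ≠ 0 := by exact_mod_cast h20.ne'
          field_simp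
          ring
        rw [hδ, this]
        push_cast
        linear_combination (velocity f p t - Complex.I * freq l * f t) * hee
      rw [hD]
      have e : (freq l : ℂ) = Real.sqrt (freq l) * Real.sqrt (freq l) := by
        exact_mod_cast hsω2.symm
      push_cast
      rw [e]
      have := (hr l).ne'
      have a1 : (r l : ℂ) ≠ 0 := by exact_mod_cast this
      have a3 : ((Real.sqrt 2 : ℝ) : ℂ) ≠ 0 := by exact_mod_cast h20.ne'
      field_simp
      ring
    rw [key]
    have hden : ‖2 * Complex.I * (Real.sqrt (freq l) : ℂ)‖ = 2 * Real.sqrt (freq l) := by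
      rw [norm_mul, norm_mul, Complex.norm_I, Complex.norm_real, Real.norm_of_nonneg hsω.le]
      norm_num
    have b1 : ‖(velocity f p t + Complex.I * (freq l : ℝ) * f t)
        / (2 * Complex.I * Real.sqrt (freq l))‖ ≤ (1 + K) / 2 / freq l := by
      rw [norm_div, hden, div_le_iff₀ (by positivity)]
      refine hG.trans_eq ?_
      nth_rewrite 2 [← hsω2]
      field_simp
    have b2 : ‖e' * δ / (2 * Complex.I * Real.sqrt (freq l))‖ ≤ K / 2 / freq l := by
      rw [norm_div, hden, norm_mul, hn', one_mul, div_le_iff₀ (by positivity)]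
      refine rotH.trans_eq ?_
      nth_rewrite 2 [← hsω2]
      field_simp
    have b3 : ‖e' * (e0 * σ l) * (((1 / r l + r l) / 2 - 1) / Real.sqrt 2 : ℝ)‖ ≤ 1 / freq l := by
      rw [norm_mul, norm_mul, norm_mul, hn', hn0, hσ, Complex.norm_real, Real.norm_eq_abs, abs_div,
        abs_of_pos h20, one_mul, one_mul, one_mul, div_le_iff₀ h20]
      linarith
    refine (norm_add_le _ _).trans ((add_le_add (norm_sub_le _ _) le_rfl).trans ?_)
    calc _ ≤ (1 + K) / 2 / freq l + K / 2 / freq l + 1 / freq l :=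
        add_le_add (add_le_add b1 b2) b3
      _ = (3 / 2 + K) / freq l := by ring
      _ ≤ _ := by
        gcongr ?_ / _
        have : 0 ≤ 1 / Real.sin t * B := by positivity
        linarith

/-! ### Square summability of the Bogoliubov coefficients -/

theorem memlp_two_iff {ι : Type*} {E : ι → Type*} [∀ i, NormedAddCommGroup (E i)] {f : ∀ i, E i} :
    Memℓp f 2 ↔ Summable fun i => ‖f i‖ ^ 2 := by
  rw [memℓp_gen_iff (by norm_num)]
  simp

theorem summable_inv_freq_sq : Summable fun l => (1 / freq l) ^ 2 := by
  have h : Summable fun l : ℕ => 4 * (1 / ((l + 1 : ℕ) : ℝ) ^ 2) :=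
    ((summable_nat_add_iff 1).mpr (Real.summable_one_div_nat_pow.mpr one_lt_two)).mul_left 4
  refine h.of_nonneg_of_le (fun l => by positivity) fun l => ?_
  have hl : (0 : ℝ) ≤ l := Nat.cast_nonneg l
  rw [div_pow, one_pow, mul_one_div, div_le_div_iff₀ (by have := freq_pos l; positivity)
    (by positivity), freq]
  push_cast
  nlinarith

theorem summable_sq_of_le {a b c : ℕ → ℝ} (ha : Summable fun l => a l ^ 2)
    (hb : Summable fun l => b l ^ 2) (h0 : ∀ l, 0 ≤ c l) (hc : ∀ l, c l ≤ a l + b l) :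
    Summable fun l => c l ^ 2 := by
  refine ((ha.mul_left 2).add (hb.mul_left 2)).of_nonneg_of_le (fun l => sq_nonneg _) fun l => ?_
  have : c l ^ 2 ≤ (a l + b l) ^ 2 := pow_le_pow_left₀ (h0 l) (hc l) 2
  nlinarith [sq_nonneg (a l - b l)]

/-! ### General modes expressed through the reference modes -/

/-- The coefficients of the modes with respect to the reference modes. -/
def refA (ρ ν : ℕ → ℝ) (l : ℕ) : ℂ :=
  ((ρ l / refRho l + refRho l / ρ l : ℝ) - Complex.I * (refRho l * ν l : ℝ)) / 2

/-- The conjugate coefficients of the modes with respect to the reference modes. -/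
def refB (ρ ν : ℕ → ℝ) (l : ℕ) : ℂ :=
  ((ρ l / refRho l - refRho l / ρ l : ℝ) + Complex.I * (refRho l * ν l : ℝ)) / 2

theorem normSq_refB (ρ ν : ℕ → ℝ) (l : ℕ) : ‖refB ρ ν l‖ ^ 2 =
    ((ρ l / refRho l - refRho l / ρ l) ^ 2 + (refRho l * ν l) ^ 2) / 4 := by
  rw [refB, ← Complex.normSq_eq_norm_sq, Complex.normSq_div, mul_comm Complex.I,
    Complex.normSq_add_mul_I]
  norm_num

theorem normSq_refA (ρ ν : ℕ → ℝ) (l : ℕ) (hρ : 0 < ρ l) :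
    ‖refA ρ ν l‖ ^ 2 = 1 + ‖refB ρ ν l‖ ^ 2 := by
  have h0 := refRho_pos l
  rw [normSq_refB, refA, ← Complex.normSq_eq_norm_sq, Complex.normSq_div, mul_comm Complex.I,
    sub_eq_add_neg, ← neg_mul, ← Complex.ofReal_neg, Complex.normSq_add_mul_I]
  norm_num
  field_simp
  ring

theorem mode_eq_ref (ρ ν : ℕ → ℝ) (l : ℕ) (hρ : 0 < ρ l) (t : ℝ) : mode ρ ν l t =
    refA ρ ν l * mode refRho 0 l t + refB ρ ν l * conj (mode refRho 0 l t) := by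
  have h0 : (refRho l : ℂ) ≠ 0 := by exact_mod_cast (refRho_pos l).ne'
  have h1 : (ρ l : ℂ) ≠ 0 := by exact_mod_cast hρ.ne'
  have h2 : ((Real.sqrt 2 : ℝ) : ℂ) ≠ 0 := by exact_mod_cast (Real.sqrt_pos.mpr two_pos).ne'
  simp only [mode_eq, refA, refB]
  simp only [map_add, map_mul, map_div₀, map_inv₀, Complex.conj_I, Complex.conj_ofReal,
    Pi.zero_apply, Complex.ofReal_zero, map_zero]
  push_cast
  field_simp
  ring_nf
  simp only [Complex.I_sq]
  ring

theorem modeMomentum_eq_ref (ρ ν : ℕ → ℝ) (l : ℕ) (hρ : 0 < ρ l) {t : ℝ}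
    (ht : t ∈ Set.Ioo 0 Real.pi) : modeMomentum ρ ν l t =
    refA ρ ν l * modeMomentum refRho 0 l t + refB ρ ν l * conj (modeMomentum refRho 0 l t) := by
  have h0 := (mode_system refRho 0 l)
  have h1 := (h0.const_mul (refA ρ ν l)).add (h0.conj.const_mul (refB ρ ν l))
  have h2 := (h1.congr (fun t _ => mode_eq_ref ρ ν l hρ t) fun _ _ => rfl).momentum_eq ht
  exact h2

/-- The symplectic product of a reference mode at two times. -/
def refX (l : ℕ) (t₁ t₀ : ℝ) : ℂ :=
  mode refRho 0 l t₀ * modeMomentum refRho 0 l t₁ - mode refRho 0 l t₁ * modeMomentum refRho 0 l t₀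

/-- The symmetrized mixed symplectic product of a reference mode and its conjugate. -/
def refY (l : ℕ) (t₁ t₀ : ℝ) : ℂ :=
  (mode refRho 0 l t₀ * conj (modeMomentum refRho 0 l t₁)
    - mode refRho 0 l t₁ * conj (modeMomentum refRho 0 l t₀))
  + (conj (mode refRho 0 l t₀) * modeMomentum refRho 0 l t₁
    - conj (mode refRho 0 l t₁) * modeMomentum refRho 0 l t₀)

/-- Up to a phase and conjugation, β is the symplectic product of the data of one mode at two times.
Inserting the expansion in the reference mode and its conjugate gives a quadratic form in the two
expansion coefficients. -/
theorem norm_bogoliubovBeta (ρ ν : ℕ → ℝ) (l : ℕ) (hρ : 0 < ρ l) {t₁ t₀ : ℝ}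
    (h1 : t₁ ∈ Set.Ioo 0 Real.pi) (h0 : t₀ ∈ Set.Ioo 0 Real.pi) :
    ‖bogoliubovBeta ρ ν l t₁ t₀‖ = ‖refA ρ ν l ^ 2 * refX l t₁ t₀
      + refA ρ ν l * refB ρ ν l * refY l t₁ t₀ + refB ρ ν l ^ 2 * conj (refX l t₁ t₀)‖ := by
  have : bogoliubovBeta ρ ν l t₁ t₀ = Complex.I * conj (refA ρ ν l ^ 2 * refX l t₁ t₀
      + refA ρ ν l * refB ρ ν l * refY l t₁ t₀ + refB ρ ν l ^ 2 * conj (refX l t₁ t₀)) := by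
    rw [bogoliubovBeta, mode_eq_ref ρ ν l hρ, mode_eq_ref ρ ν l hρ,
      modeMomentum_eq_ref ρ ν l hρ h1, modeMomentum_eq_ref ρ ν l hρ h0]
    simp only [refX, refY, map_add, map_mul, map_sub, map_pow, Complex.conj_conj]
    ring
  rw [this, norm_mul, Complex.norm_I, one_mul, RCLike.norm_conj]

/-- For exact plane waves with p = -iωζ the two products in `refX` cancel, while `refY` reduces to
the sine of the phase difference. The corrections are of relative size 1/ω. -/
theorem ref_asymptotics {t₁ t₀ : ℝ} (h1 : t₁ ∈ Set.Ioo 0 Real.pi) (h0 : t₀ ∈ Set.Ioo 0 Real.pi) :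
    ∃ C : ℝ, 0 ≤ C ∧ ∀ l, ‖refX l t₁ t₀‖ ≤ C * (1 / freq l) ∧
      ‖refY l t₁ t₀ + (2 * Real.sin (freq l * (t₁ - t₀)) : ℝ)‖ ≤ C * (1 / freq l) := by
  obtain ⟨σ, hσ, H⟩ := refMode_asymptotics
  obtain ⟨C₁, hC₁, H₁⟩ := H t₁ h1
  obtain ⟨C₀, hC₀, H₀⟩ := H t₀ h0
  -- a common constant
  obtain ⟨C, hC, hC1, hC0⟩ : ∃ C, 0 ≤ C ∧ C₁ ≤ C ∧ C₀ ≤ C :=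
    ⟨max C₁ C₀, le_max_of_le_left hC₁, le_max_left _ _, le_max_right _ _⟩
  refine ⟨2 * (2 * (1 + 2 * C) * C) + 2 * (2 * ((1 + 2 * C) * C + C)), by positivity, fun l => ?_⟩
  have hω := freq_pos l
  have hsω : 0 < Real.sqrt (freq l) := Real.sqrt_pos.mpr hω
  have hsωC : ((Real.sqrt (freq l) : ℝ) : ℂ) ≠ 0 := by exact_mod_cast hsω.ne'
  have hsω2 : ((Real.sqrt (freq l) : ℝ) : ℂ) * (Real.sqrt (freq l) : ℝ) = (freq l : ℂ) := by
    exact_mod_cast Real.mul_self_sqrt hω.le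
  have hinv : 1 / freq l ≤ 2 := by rw [div_le_iff₀ hω]; linarith [half_le_freq l]
  -- normalized variables
  have norml : ∀ t C', C' ≤ C → (‖modeMomentum refRho 0 l t + Complex.I * freq l * mode refRho 0 l t‖
        ≤ C' / Real.sqrt (freq l) ∧
      ‖(Real.sqrt (freq l) : ℂ) * mode refRho 0 l t
        - σ l * Complex.exp (-(Complex.I * freq l * t)) / Real.sqrt 2‖ ≤ C' / freq l) →
      ∃ S D ε : ℂ, mode refRho 0 l t = S / Real.sqrt (freq l) ∧
        modeMomentum refRho 0 l t = Real.sqrt (freq l) * (D - Complex.I * S) ∧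
        S = σ l * Complex.exp (-(Complex.I * freq l * t)) / Real.sqrt 2 + ε ∧
        ‖D‖ ≤ C * (1 / freq l) ∧ ‖ε‖ ≤ C * (1 / freq l) ∧ ‖S‖ ≤ 1 + 2 * C := by
    intro t C' hC' h
    have hε : ‖(Real.sqrt (freq l) : ℂ) * mode refRho 0 l t
        - σ l * Complex.exp (-(Complex.I * freq l * t)) / Real.sqrt 2‖ ≤ C * (1 / freq l) := by
      refine h.2.trans ?_
      rw [mul_one_div]; gcongr
    refine ⟨Real.sqrt (freq l) * mode refRho 0 l t,
      (modeMomentum refRho 0 l t + Complex.I * freq l * mode refRho 0 l t) / Real.sqrt (freq l),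
      Real.sqrt (freq l) * mode refRho 0 l t
        - σ l * Complex.exp (-(Complex.I * freq l * t)) / Real.sqrt 2, ?_, ?_, by ring, ?_, hε, ?_⟩
    · field_simp
    · rw [← hsω2]; field_simp; ring
    · rw [norm_div, Complex.norm_real, Real.norm_of_nonneg hsω.le, div_le_iff₀ hsω]
      refine h.1.trans ?_
      rw [div_le_iff₀ hsω, mul_assoc, mul_assoc, Real.mul_self_sqrt hω.le, one_div,
        inv_mul_cancel₀ hω.ne', mul_one]
      exact hC'
    · have ha : ‖σ l * Complex.exp (-(Complex.I * freq l * t)) / Real.sqrt 2‖ ≤ 1 := by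
        rw [norm_div, norm_mul, hσ, norm_exp_I_mul, one_mul, Complex.norm_real,
          Real.norm_of_nonneg (Real.sqrt_nonneg _)]
        rw [div_le_iff₀ (Real.sqrt_pos.mpr two_pos), one_mul]
        exact Real.one_le_sqrt.mpr one_le_two
      have hε2 := hε.trans (mul_le_mul_of_nonneg_left hinv hC)
      have := norm_le_norm_sub_add ((Real.sqrt (freq l) : ℂ) * mode refRho 0 l t)
        (σ l * Complex.exp (-(Complex.I * freq l * t)) / Real.sqrt 2)
      linarith
  obtain ⟨S₁, D₁, ε₁, hm1, hp1, hS1, hD1, hε1, hn1⟩ := norml t₁ C₁ hC1 (H₁ l)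
  obtain ⟨S₀, D₀, ε₀, hm0, hp0, hS0, hD0, hε0, hn0⟩ := norml t₀ C₀ hC0 (H₀ l)
  have hSD : ∀ S D : ℂ, ‖S‖ ≤ 1 + 2 * C → ‖D‖ ≤ C * (1 / freq l) →
      ‖S * D‖ ≤ (1 + 2 * C) * (C * (1 / freq l)) := fun S D hS hD => by
    rw [norm_mul]; gcongr
  have hinv0 : 0 ≤ 1 / freq l := by positivity
  constructor
  · have : refX l t₁ t₀ = S₀ * D₁ - S₁ * D₀ := by
      rw [refX, hm1, hm0, hp1, hp0]; field_simp; ring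
    rw [this]
    refine (norm_sub_le _ _).trans ?_
    have a1 := hSD S₀ D₁ hn0 hD1
    have a2 := hSD S₁ D₀ hn1 hD0
    have : 0 ≤ C * (1 / freq l) := by positivity
    have : 0 ≤ C * (C * (1 / freq l)) := by positivity
    nlinarith
  · set a₁ := σ l * Complex.exp (-(Complex.I * freq l * t₁)) / Real.sqrt 2 with ha₁
    set a₀ := σ l * Complex.exp (-(Complex.I * freq l * t₀)) / Real.sqrt 2 with ha₀
    have hY : refY l t₁ t₀ = ((S₀ * conj D₁ - S₁ * conj D₀) + conj (S₀ * conj D₁ - S₁ * conj D₀))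
        + 2 * Complex.I * (S₀ * conj S₁ - conj (S₀ * conj S₁)) := by
      rw [refY, hm1, hm0, hp1, hp0]
      simp only [map_div₀, map_mul, map_sub, Complex.conj_ofReal, Complex.conj_I, Complex.conj_conj]
      field_simp
      ring
    have haa : 2 * Complex.I * (a₀ * conj a₁ - conj (a₀ * conj a₁))
        = -(2 * Real.sin (freq l * (t₁ - t₀)) : ℝ) := by
      have h2 : ((Real.sqrt 2 : ℝ) : ℂ) * (Real.sqrt 2 : ℝ) = 2 := by
        exact_mod_cast Real.mul_self_sqrt (zero_le_two : (0 : ℝ) ≤ 2)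
      have h20 : ((Real.sqrt 2 : ℝ) : ℂ) ≠ 0 := by
        exact_mod_cast (Real.sqrt_pos.mpr two_pos).ne'
      have hσ2 : σ l * conj (σ l) = 1 := by
        rw [Complex.mul_conj, Complex.normSq_eq_norm_sq, hσ]; simp
      have h3 : a₀ * conj a₁
          = Complex.exp (Complex.I * (freq l * (t₁ - t₀) : ℝ)) / 2 := by
        rw [ha₀, ha₁, map_div₀, map_mul, Complex.conj_ofReal, ← Complex.exp_conj, ← h2]
        simp only [map_neg, map_mul, Complex.conj_I, Complex.conj_ofReal]
        rw [div_mul_div_comm, mul_mul_mul_comm, hσ2, one_mul, ← Complex.exp_add]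
        congr 2
        push_cast; ring
      rw [h3, map_div₀, ← Complex.exp_conj]
      simp only [map_mul, Complex.conj_I, Complex.conj_ofReal, map_ofNat]
      rw [mul_comm Complex.I, mul_comm (-Complex.I), mul_neg, ← neg_mul, Complex.exp_mul_I,
        Complex.exp_mul_I, Complex.cos_neg, Complex.sin_neg, ← Complex.ofReal_sin]
      push_cast
      linear_combination (2 * Complex.sin (freq l * (t₁ - t₀))) * Complex.I_sq
    have hdiff : S₀ * conj S₁ - a₀ * conj a₁ = S₀ * conj ε₁ + conj a₁ * ε₀ := by
      have e0 : ε₀ = S₀ - a₀ := by rw [hS0]; ring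
      have e1 : ε₁ = S₁ - a₁ := by rw [hS1]; ring
      rw [e0, e1, map_sub]; ring
    have hna : ‖conj a₁‖ ≤ 1 := by
      rw [RCLike.norm_conj, ha₁, norm_div, norm_mul, hσ, norm_exp_I_mul, one_mul, Complex.norm_real,
        Real.norm_of_nonneg (Real.sqrt_nonneg _)]
      rw [div_le_iff₀ (Real.sqrt_pos.mpr two_pos), one_mul]
      exact Real.one_le_sqrt.mpr one_le_two
    set u := S₀ * conj D₁ - S₁ * conj D₀ with hu
    set v := S₀ * conj S₁ - a₀ * conj a₁ with hv
    have hnu : ‖u‖ ≤ 2 * (1 + 2 * C) * C * (1 / freq l) := by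
      refine (norm_sub_le _ _).trans ?_
      have a1 := hSD S₀ (conj D₁) hn0 (by rwa [RCLike.norm_conj])
      have a2 := hSD S₁ (conj D₀) hn1 (by rwa [RCLike.norm_conj])
      linarith
    have hnv : ‖v‖ ≤ ((1 + 2 * C) * C + C) * (1 / freq l) := by
      rw [hdiff]
      refine (norm_add_le _ _).trans ?_
      have a1 := hSD S₀ (conj ε₁) hn0 (by rwa [RCLike.norm_conj])
      have a2 : ‖conj a₁ * ε₀‖ ≤ 1 * (C * (1 / freq l)) := by
        rw [norm_mul]; gcongr
      linarith
    have : refY l t₁ t₀ + (2 * Real.sin (freq l * (t₁ - t₀)) : ℝ)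
        = (u + conj u) + 2 * Complex.I * (v - conj v) := by
      rw [hY, ← sub_neg_eq_add, ← haa, hv]
      simp only [map_sub]
      ring
    rw [this]
    have n1 : ‖u + conj u‖ ≤ 2 * ‖u‖ := by
      refine (norm_add_le _ _).trans ?_
      rw [RCLike.norm_conj]; linarith
    have n2 : ‖2 * Complex.I * (v - conj v)‖ ≤ 2 * (2 * ‖v‖) := by
      rw [norm_mul, norm_mul, Complex.norm_I]
      norm_num
      refine (norm_sub_le _ _).trans ?_
      rw [RCLike.norm_conj]; linarith
    refine (norm_add_le _ _).trans ((add_le_add n1 n2).trans ?_)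
    linarith

/-- With c = √(π/2), 4 ‖B‖² is (ρ/c - c/ρ)² + (cν)², and ρ/c - c/ρ = (ρ - c)(1/c + 1/ρ). The last
factor is always at least 1/c; if ρ - c is in ℓ², then ρ tends to c and the factor is eventually at
most 3/c. -/
theorem summable_refB_iff {ρ ν : ℕ → ℝ} (hρ : ∀ l, 0 < ρ l) :
    (Summable fun l => ‖refB ρ ν l‖ ^ 2) ↔
      Memℓp (fun l => ρ l - Real.sqrt (Real.pi / 2)) 2 ∧ Memℓp ν 2 := by
  rw [memlp_two_iff, memlp_two_iff]
  simp only [Real.norm_eq_abs, sq_abs]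
  change _ ↔ (Summable fun l => (ρ l - refRho l) ^ 2) ∧ _
  set c := refRho 0 with hc
  have hcl : ∀ l, refRho l = c := fun _ => rfl
  have hc0 : 0 < c := refRho_pos 0
  have hB : ∀ l, ‖refB ρ ν l‖ ^ 2 = ((ρ l / c - c / ρ l) ^ 2 + (c * ν l) ^ 2) / 4 :=
    fun l => normSq_refB ρ ν l
  simp only [hcl, hB]
  have hdiv : ∀ l, ρ l / c - c / ρ l = (ρ l - c) * (1 / c + 1 / ρ l) := fun l => by
    have := (hρ l).ne'
    field_simp
    ring
  constructor
  · intro h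
    constructor
    · refine (h.mul_left (4 * c ^ 2)).of_nonneg_of_le (fun l => sq_nonneg _) fun l => ?_
      have : (ρ l - c) ^ 2 * (1 / c) ^ 2 ≤ (ρ l / c - c / ρ l) ^ 2 := by
        rw [hdiv, mul_pow]
        have := hρ l
        gcongr
        exact le_add_of_nonneg_right (by positivity)
      calc (ρ l - c) ^ 2 = c ^ 2 * ((ρ l - c) ^ 2 * (1 / c) ^ 2) := by field_simp
        _ ≤ c ^ 2 * ((ρ l / c - c / ρ l) ^ 2 + (c * ν l) ^ 2) := by
          gcongr; linarith [sq_nonneg (c * ν l)]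
        _ = _ := by ring
    · refine (h.mul_left (4 / c ^ 2)).of_nonneg_of_le (fun l => sq_nonneg _) fun l => ?_
      rw [show 4 / c ^ 2 * (((ρ l / c - c / ρ l) ^ 2 + (c * ν l) ^ 2) / 4)
        = (ρ l / c - c / ρ l) ^ 2 / c ^ 2 + ν l ^ 2 by field_simp]
      exact le_add_of_nonneg_left (by positivity)
  · rintro ⟨h1, h2⟩
    have hev : ∀ᶠ l in Filter.atTop, (ρ l - c) ^ 2 < (c / 2) ^ 2 :=
      h1.tendsto_atTop_zero.eventually_lt_const (by positivity)
    refine Summable.of_norm_bounded_eventually_nat (g := fun l =>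
      (3 / c) ^ 2 * (ρ l - c) ^ 2 + c ^ 2 * ν l ^ 2) ((h1.mul_left _).add (h2.mul_left _)) ?_
    filter_upwards [hev] with l hl
    have hhalf : c / 2 ≤ ρ l := by
      have := abs_lt_of_sq_lt_sq hl (by positivity)
      linarith [(abs_lt.mp this).1]
    rw [Real.norm_of_nonneg (by positivity), hdiv, mul_pow, mul_pow]
    have h3 : (1 / c + 1 / ρ l) ^ 2 ≤ (3 / c) ^ 2 := by
      have := hρ l
      have h4 : 1 / ρ l ≤ 2 / c := by
        rw [div_le_div_iff₀ this hc0]; linarith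
      gcongr
      linarith [show 3 / c = 1 / c + 2 / c by ring]
    nlinarith [mul_le_mul_of_nonneg_left h3 (sq_nonneg (ρ l - c)), sq_nonneg (c * ν l),
      mul_nonneg (sq_nonneg (3 / c)) (sq_nonneg (ρ l - c))]

/-- Because the frequencies are half-integers, a time difference of π/2 keeps the leading term of
`refY` at a fixed size in every degree. One pair of times thus suffices for the converse. -/
theorem sin_sq_freq (l : ℕ) : Real.sin (freq l * (Real.pi / 2)) ^ 2 = 1 / 2 := by
  rw [Real.sin_sq_eq_half_sub]
  have : 2 * (freq l * (Real.pi / 2)) = l * Real.pi + Real.pi / 2 := by rw [freq]; ring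
  rw [this, Real.cos_add, Real.cos_pi_div_two, Real.sin_nat_mul_pi]
  ring

theorem one_le_norm_refA {ρ ν : ℕ → ℝ} (hρ : ∀ l, 0 < ρ l) (l : ℕ) : 1 ≤ ‖refA ρ ν l‖ := by
  have := normSq_refA ρ ν l (hρ l)
  nlinarith [norm_nonneg (refA ρ ν l), sq_nonneg ‖refB ρ ν l‖]

/-- Summability bounds B, hence A, uniformly in l, and the quadratic form is then at most a constant
times 1/ω plus a constant times ‖B‖. -/
theorem summable_beta_of_summable_refB {ρ ν : ℕ → ℝ} (hρ : ∀ l, 0 < ρ l)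
    (hB : Summable fun l => ‖refB ρ ν l‖ ^ 2) {t₁ t₀ : ℝ}
    (h1 : t₁ ∈ Set.Ioo 0 Real.pi) (h0 : t₀ ∈ Set.Ioo 0 Real.pi) :
    Summable fun l => ‖bogoliubovBeta ρ ν l t₁ t₀‖ ^ 2 := by
  obtain ⟨C, hC, H⟩ := ref_asymptotics h1 h0
  obtain ⟨M, hM⟩ : ∃ M, ∀ l, ‖refA ρ ν l‖ ^ 2 ≤ M := ⟨1 + ∑' l, ‖refB ρ ν l‖ ^ 2, fun l => by
    rw [normSq_refA ρ ν l (hρ l)]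
    gcongr
    exact hB.le_tsum l fun _ _ => by positivity⟩
  have hM1 : 1 ≤ M := by nlinarith [hM 0, one_le_norm_refA (ν := ν) hρ 0]
  refine summable_sq_of_le (a := fun l => 2 * M * C * (1 / freq l))
    (b := fun l => M * (2 + 2 * C) * ‖refB ρ ν l‖) ?_ ?_ (fun l => norm_nonneg _) fun l => ?_
  · simp only [mul_pow _ (1 / freq _)]
    exact summable_inv_freq_sq.mul_left _
  · simp only [mul_pow _ ‖refB _ _ _‖]
    exact hB.mul_left _
  · obtain ⟨hX, hY⟩ := H l
    have hω := freq_pos l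
    have hinv : 1 / freq l ≤ 2 := by rw [div_le_iff₀ hω]; linarith [half_le_freq l]
    have hA := hM l
    have hA1 := one_le_norm_refA (ν := ν) hρ l
    have hAM : ‖refA ρ ν l‖ ≤ M := by nlinarith
    have hBA : ‖refB ρ ν l‖ ^ 2 ≤ M := by
      have := normSq_refA ρ ν l (hρ l); linarith
    have hY' : ‖refY l t₁ t₀‖ ≤ 2 + 2 * C := by
      have h3 := norm_le_norm_add_norm_sub' (refY l t₁ t₀)
        (-((2 * Real.sin (freq l * (t₁ - t₀)) : ℝ) : ℂ))
      rw [sub_neg_eq_add, norm_neg, Complex.norm_real, Real.norm_eq_abs, abs_mul] at h3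
      have h4 := Real.abs_sin_le_one (freq l * (t₁ - t₀))
      have h5 := mul_le_mul_of_nonneg_left hinv hC
      rw [abs_of_pos (two_pos)] at h3
      linarith
    rw [norm_bogoliubovBeta ρ ν l (hρ l) h1 h0]
    refine (norm_add_le _ _).trans ((add_le_add (norm_add_le _ _) le_rfl).trans ?_)
    rw [norm_mul, norm_mul, norm_mul, norm_mul, norm_pow, norm_pow, RCLike.norm_conj]
    have e1 : ‖refA ρ ν l‖ ^ 2 * ‖refX l t₁ t₀‖ ≤ M * (C * (1 / freq l)) := by gcongr
    have e2 : ‖refB ρ ν l‖ ^ 2 * ‖refX l t₁ t₀‖ ≤ M * (C * (1 / freq l)) := by gcongr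
    have e3 : ‖refA ρ ν l‖ * ‖refB ρ ν l‖ * ‖refY l t₁ t₀‖ ≤ M * ‖refB ρ ν l‖ * (2 + 2 * C) := by
      gcongr
    linarith

/-- No bound on A is known beforehand, so the quadratic form is divided by ‖A‖². Since ‖B‖ ≤ ‖A‖,
the lower bound on `refY` first gives that ‖B‖/‖A‖ is square summable. The ratio then tends to 0,
which forces ‖A‖² ≤ 2 eventually, and B itself is square summable. -/
theorem summable_refB_of_summable_beta {ρ ν : ℕ → ℝ} (hρ : ∀ l, 0 < ρ l)
    (hβ : Summable fun l => ‖bogoliubovBeta ρ ν l (3 * Real.pi / 4) (Real.pi / 4)‖ ^ 2) :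
    Summable fun l => ‖refB ρ ν l‖ ^ 2 := by
  have hπ := Real.pi_pos
  have h1 : 3 * Real.pi / 4 ∈ Set.Ioo 0 Real.pi := ⟨by positivity, by linarith⟩
  have h0 : Real.pi / 4 ∈ Set.Ioo 0 Real.pi := ⟨by positivity, by linarith⟩
  obtain ⟨C, hC, H⟩ := ref_asymptotics h1 h0
  have hw : Summable fun l => (‖refB ρ ν l‖ / ‖refA ρ ν l‖) ^ 2 := by
    refine summable_sq_of_le (a := fun l => ‖bogoliubovBeta ρ ν l (3 * Real.pi / 4) (Real.pi / 4)‖)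
      (b := fun l => 3 * C * (1 / freq l)) hβ ?_ (fun l => by positivity) fun l => ?_
    · simp only [mul_pow _ (1 / freq _)]
      exact summable_inv_freq_sq.mul_left _
    · obtain ⟨hX, hY⟩ := H l
      have hA1 := one_le_norm_refA (ν := ν) hρ l
      have hA0 : 0 < ‖refA ρ ν l‖ := by linarith
      have hAB : ‖refB ρ ν l‖ ≤ ‖refA ρ ν l‖ := by
        have := normSq_refA ρ ν l (hρ l)
        nlinarith [norm_nonneg (refB ρ ν l)]
      set A := refA ρ ν l
      set B := refB ρ ν l
      set X := refX l (3 * Real.pi / 4) (Real.pi / 4)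
      set Y := refY l (3 * Real.pi / 4) (Real.pi / 4)
      set β := bogoliubovBeta ρ ν l (3 * Real.pi / 4) (Real.pi / 4) with hβdef
      have hYlo : 1 - C * (1 / freq l) ≤ ‖Y‖ := by
        have hs : 1 ≤ |2 * Real.sin (freq l * (3 * Real.pi / 4 - Real.pi / 4))| := by
          rw [show 3 * Real.pi / 4 - Real.pi / 4 = Real.pi / 2 by ring]
          refine one_le_sq_iff_one_le_abs _ |>.mp ?_
          rw [mul_pow, sin_sq_freq]; norm_num
        have h3 := norm_le_norm_add_norm_sub' (-((2 * Real.sin (freq l *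
          (3 * Real.pi / 4 - Real.pi / 4)) : ℝ) : ℂ)) Y
        rw [norm_neg, Complex.norm_real, Real.norm_eq_abs, ← norm_neg (_ - Y), neg_sub,
          sub_neg_eq_add] at h3
        linarith
      have hβA : ‖A‖ * ‖B‖ * ‖Y‖ ≤ ‖β‖ + 2 * (‖A‖ ^ 2 * (C * (1 / freq l))) := by
        have h4 : A * B * Y = (A ^ 2 * X + A * B * Y + B ^ 2 * conj X) - A ^ 2 * X
            - B ^ 2 * conj X := by ring
        have h5 := norm_sub_le ((A ^ 2 * X + A * B * Y + B ^ 2 * conj X) - A ^ 2 * X)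
          (B ^ 2 * conj X)
        have h6 := norm_sub_le (A ^ 2 * X + A * B * Y + B ^ 2 * conj X) (A ^ 2 * X)
        rw [← h4, norm_mul, norm_mul, norm_mul, norm_pow, RCLike.norm_conj] at h5
        rw [← norm_bogoliubovBeta ρ ν l (hρ l) h1 h0, norm_mul, norm_pow] at h6
        have h7 : ‖A‖ ^ 2 * ‖X‖ ≤ ‖A‖ ^ 2 * (C * (1 / freq l)) := by gcongr
        have h8 : ‖B‖ ^ 2 * ‖X‖ ≤ ‖A‖ ^ 2 * (C * (1 / freq l)) := by gcongr
        linarith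
      have hCω : 0 ≤ C * (1 / freq l) := by have := freq_pos l; positivity
      rw [div_le_iff₀ hA0]
      have h9 : ‖A‖ * ‖B‖ * (1 - C * (1 / freq l)) ≤ ‖A‖ * ‖B‖ * ‖Y‖ := by gcongr
      have h10 : ‖A‖ * ‖B‖ * (C * (1 / freq l)) ≤ ‖A‖ * ‖A‖ * (C * (1 / freq l)) := by gcongr
      have h11 : ‖β‖ ≤ ‖β‖ * ‖A‖ * ‖A‖ := by
        nlinarith [norm_nonneg β, mul_le_mul_of_nonneg_left hA1 (norm_nonneg β)]
      have h12 : ‖A‖ * ‖B‖ ≤ ‖A‖ * ((‖β‖ + 3 * C * (1 / freq l)) * ‖A‖) := by nlinarith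
      exact le_of_mul_le_mul_left h12 hA0
  have hev : ∀ᶠ l in Filter.atTop, (‖refB ρ ν l‖ / ‖refA ρ ν l‖) ^ 2 < 1 / 2 :=
    hw.tendsto_atTop_zero.eventually_lt_const (by norm_num)
  refine Summable.of_norm_bounded_eventually_nat (hw.mul_left 2) ?_
  filter_upwards [hev] with l hl
  have hA1 := one_le_norm_refA (ν := ν) hρ l
  have hA2 := normSq_refA ρ ν l (hρ l)
  have hA0 : 0 < ‖refA ρ ν l‖ ^ 2 := by positivity
  rw [Real.norm_of_nonneg (by positivity)]
  rw [div_pow] at hl ⊢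
  rw [← mul_div_assoc, le_div_iff₀ hA0]
  rw [div_lt_iff₀ hA0] at hl
  have : ‖refA ρ ν l‖ ^ 2 ≤ 2 := by linarith
  nlinarith [sq_nonneg ‖refB ρ ν l‖]

theorem summable_beta_iff {ρ ν : ℕ → ℝ} (hρ : ∀ l, 0 < ρ l) :
    (∀ t₁ ∈ Set.Ioo 0 Real.pi, ∀ t₀ ∈ Set.Ioo 0 Real.pi,
        Summable fun l => ‖bogoliubovBeta ρ ν l t₁ t₀‖ ^ 2) ↔
      Memℓp (fun l => ρ l - Real.sqrt (Real.pi / 2)) 2 ∧ Memℓp ν 2 := by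
  rw [← summable_refB_iff hρ]
  have hπ := Real.pi_pos
  exact ⟨fun h => summable_refB_of_summable_beta hρ
    (h _ ⟨by positivity, by linarith⟩ _ ⟨by positivity, by linarith⟩),
    fun h t₁ h1 t₀ h0 => summable_beta_of_summable_refB hρ h h1 h0⟩

/-! ### Zonal spherical harmonics -/

theorem contDiff_legendreP (n : ℕ) : ContDiff ℝ ∞ (legendreP n) := by
  induction n using Nat.twoStepInduction with
  | zero => exact contDiff_const
  | one => exact contDiff_id
  | more n h0 h1 =>
    have : legendreP (n + 2) = fun x =>
        ((2 * n + 3) * x * legendreP (n + 1) x - (n + 1) * legendreP n x) / (n + 2) :=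
      funext fun x => bonnet_legendreP n x
    rw [this]
    fun_prop

theorem legendreP_one (n : ℕ) : legendreP n 1 = 1 := by
  induction n using Nat.twoStepInduction with
  | zero => rfl
  | one => rfl
  | more n h0 h1 =>
    rw [bonnet_legendreP, h0, h1]
    field_simp
    ring

theorem legendreP_neg_one (n : ℕ) : legendreP n (-1) = (-1) ^ n := by
  induction n using Nat.twoStepInduction with
  | zero => rfl
  | one => simp [legendreP]
  | more n h0 h1 =>
    rw [bonnet_legendreP, h0, h1]
    field_simp
    ring

theorem contDiff_sphericalY (l : ℕ) : ContDiff ℝ ∞ (sphericalY l) :=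
  contDiff_const.mul ((contDiff_legendreP l).comp Real.contDiff_cos)

theorem continuous_sphericalY (l : ℕ) : Continuous (sphericalY l) :=
  (contDiff_sphericalY l).continuous

/-- `sin θ ∂_θ Y_l`. -/
def sphericalFlux (l : ℕ) (θ : ℝ) : ℝ :=
  Real.sqrt ((2 * l + 1) / (4 * Real.pi)) *
    -((l + 1) * (Real.cos θ * legendreP l (Real.cos θ) - legendreP (l + 1) (Real.cos θ)))

theorem hasDerivAt_sphericalY (l : ℕ) {θ : ℝ} (hθ : θ ∈ Set.Ioo 0 Real.pi) :
    HasDerivAt (sphericalY l) (sphericalFlux l θ / Real.sin θ) θ := by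
  have hs := (Real.sin_pos_of_mem_Ioo hθ).ne'
  have h := ((hasDerivAt_legendreP (one_sub_cos_sq_ne hθ) l).1.comp θ
    (Real.hasDerivAt_cos θ)).const_mul (Real.sqrt ((2 * l + 1) / (4 * Real.pi)))
  refine h.congr_deriv ?_
  rw [sphericalFlux, ← Real.sin_sq]
  field_simp

theorem hasDerivAt_sphericalFlux (l : ℕ) {θ : ℝ} (hθ : θ ∈ Set.Ioo 0 Real.pi) :
    HasDerivAt (sphericalFlux l) (-(l * (l + 1)) * sphericalY l θ * Real.sin θ) θ := by
  have hs := (Real.sin_pos_of_mem_Ioo hθ).ne'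
  obtain ⟨h1, h2⟩ := hasDerivAt_legendreP (one_sub_cos_sq_ne hθ) l
  have h := (((((Real.hasDerivAt_cos θ).mul (h1.comp θ (Real.hasDerivAt_cos θ))).sub
    (h2.comp θ (Real.hasDerivAt_cos θ))).const_mul (l + 1 : ℝ)).neg).const_mul
      (Real.sqrt ((2 * l + 1) / (4 * Real.pi)))
  refine h.congr_deriv ?_
  have hc : Real.cos θ ^ 2 = 1 - Real.sin θ ^ 2 := by rw [Real.sin_sq]; ring
  simp only [sphericalY, Function.comp]
  rw [← Real.sin_sq]
  generalize Real.cos θ = c at *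
  generalize Real.sin θ = s at *
  field_simp
  ring_nf
  rw [hc]
  ring

theorem continuous_sphericalFlux (l : ℕ) : Continuous (sphericalFlux l) := by
  unfold sphericalFlux
  have h1 := (contDiff_legendreP l).continuous
  have h2 := (contDiff_legendreP (l + 1)).continuous
  fun_prop

/-- The flux vanishes at both poles because P_n(±1) = (±1)^n; this removes the boundary terms in
Green's identity. -/
theorem sphericalFlux_zero (l : ℕ) : sphericalFlux l 0 = 0 := by
  simp [sphericalFlux, legendreP_one]

theorem sphericalFlux_pi (l : ℕ) : sphericalFlux l Real.pi = 0 := by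
  simp [sphericalFlux, legendreP_neg_one, pow_succ]

/-- Green's identity against `Y_l`, for a function `g` with derivative `g'` and Laplacian `h`. -/
theorem sphereIntegral_laplacian (l : ℕ) {g g' h : ℝ → ℝ} (hg : Continuous g) (hg' : Continuous g')
    (hh : Continuous h) (d1 : ∀ θ ∈ Set.Ioo 0 Real.pi, HasDerivAt g (g' θ) θ)
    (d2 : ∀ θ ∈ Set.Ioo 0 Real.pi,
      HasDerivAt (fun η => Real.sin η * g' η) (Real.sin θ * h θ) θ) :
    sphereIntegral (fun θ => sphericalY l θ * h θ)
      = -(l * (l + 1)) * sphereIntegral (fun θ => sphericalY l θ * g θ) := by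
  have hY := continuous_sphericalY l
  have hV := continuous_sphericalFlux l
  have hcont : Continuous fun θ => Real.sin θ * g' θ * sphericalY l θ - sphericalFlux l θ * g θ := by
    fun_prop
  have hcont' : Continuous fun θ => sphericalY l θ * h θ * Real.sin θ
      - (-(l * (l + 1))) * (sphericalY l θ * g θ * Real.sin θ) := by fun_prop
  -- The primitive is continuous up to the poles and zero there, so the differential identities are
  -- needed only in the open interval, where division by sin θ is allowed.
  have key := intervalIntegral.integral_eq_sub_of_hasDerivAt_of_le Real.pi_pos.le
    hcont.continuousOn (f' := fun θ => sphericalY l θ * h θ * Real.sin θ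
      - (-(l * (l + 1))) * (sphericalY l θ * g θ * Real.sin θ)) (fun θ hθ => by
        have hs := (Real.sin_pos_of_mem_Ioo hθ).ne'
        refine (((d2 θ hθ).mul (hasDerivAt_sphericalY l hθ)).sub
          ((hasDerivAt_sphericalFlux l hθ).mul (d1 θ hθ))).congr_deriv ?_
        field_simp
        ring) (hcont'.intervalIntegrable _ _)
  rw [intervalIntegral.integral_sub, intervalIntegral.integral_const_mul] at key
  · simp only [sphericalFlux_zero, sphericalFlux_pi, Real.sin_zero, Real.sin_pi] at key
    rw [sphereIntegral, sphereIntegral]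
    linear_combination (2 * Real.pi) * key
  · exact Continuous.intervalIntegrable (by fun_prop) _ _
  · exact Continuous.intervalIntegrable (by fun_prop) _ _

theorem sphereIntegral_const_mul (c : ℝ) (f : ℝ → ℝ) :
    sphereIntegral (fun θ => c * f θ) = c * sphereIntegral f := by
  simp only [sphereIntegral, mul_assoc, intervalIntegral.integral_const_mul]
  ring

theorem sphereIntegral_add {f g : ℝ → ℝ} (hf : Continuous f) (hg : Continuous g) :
    sphereIntegral (fun θ => f θ + g θ) = sphereIntegral f + sphereIntegral g := by
  simp only [sphereIntegral, add_mul]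
  rw [intervalIntegral.integral_add, mul_add]
  · exact Continuous.intervalIntegrable (by fun_prop) _ _
  · exact Continuous.intervalIntegrable (by fun_prop) _ _

theorem sphereIntegral_sub {f g : ℝ → ℝ} (hf : Continuous f) (hg : Continuous g) :
    sphereIntegral (fun θ => f θ - g θ) = sphereIntegral f - sphereIntegral g := by
  simp only [sphereIntegral, sub_mul]
  rw [intervalIntegral.integral_sub, mul_sub]
  · exact Continuous.intervalIntegrable (by fun_prop) _ _
  · exact Continuous.intervalIntegrable (by fun_prop) _ _

theorem sphereIntegral_sum {ι : Type*} (s : Finset ι) {f : ι → ℝ → ℝ}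
    (hf : ∀ i, Continuous (f i)) :
    sphereIntegral (fun θ => ∑ i ∈ s, f i θ) = ∑ i ∈ s, sphereIntegral (f i) := by
  simp only [sphereIntegral, Finset.sum_mul]
  rw [intervalIntegral.integral_finsetSum, Finset.mul_sum]
  intro i _
  have := hf i
  exact Continuous.intervalIntegrable (by fun_prop) _ _

theorem sphereIntegral_congr {f g : ℝ → ℝ} (h : ∀ θ ∈ Set.Icc 0 Real.pi, f θ = g θ) :
    sphereIntegral f = sphereIntegral g := by
  rw [sphereIntegral, sphereIntegral]
  congr 1
  refine intervalIntegral.integral_congr fun θ hθ => ?_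
  rw [Set.uIcc_of_le Real.pi_pos.le] at hθ
  simp only [h θ hθ]

theorem sphereIntegral_nonneg {f : ℝ → ℝ} (h : ∀ θ, 0 ≤ f θ) : 0 ≤ sphereIntegral f := by
  refine mul_nonneg (by positivity) (intervalIntegral.integral_nonneg Real.pi_pos.le fun θ hθ => ?_)
  exact mul_nonneg (h θ) (Real.sin_nonneg_of_mem_Icc hθ)

theorem sphereIntegral_sphericalY_of_ne {l m : ℕ} (h : l ≠ m) :
    sphereIntegral (fun θ => sphericalY l θ * sphericalY m θ) = 0 := by
  have hY := continuous_sphericalY m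
  have hcd := contDiff_sphericalY m
  have hY' : Continuous (deriv (sphericalY m)) := hcd.continuous_deriv (by simp)
  have hd : Differentiable ℝ (sphericalY m) := hcd.differentiable (by simp)
  have key := sphereIntegral_laplacian l (g := sphericalY m) (g' := deriv (sphericalY m))
    (h := fun θ => -(m * (m + 1)) * sphericalY m θ) hY hY' (by fun_prop)
    (fun θ _ => (hd θ).hasDerivAt) (fun θ hθ => by
      refine ((hasDerivAt_sphericalFlux m hθ).congr_of_eventuallyEq ?_).congr_deriv (by ring)
      filter_upwards [isOpen_Ioo.mem_nhds hθ] with η hη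
      rw [(hasDerivAt_sphericalY m hη).deriv]
      have := (Real.sin_pos_of_mem_Ioo hη).ne'
      field_simp)
  have e : (fun θ => sphericalY l θ * (-(m * (m + 1)) * sphericalY m θ))
      = fun θ => (-(m * (m + 1)) : ℝ) * (sphericalY l θ * sphericalY m θ) := by
    funext θ; ring
  rw [e, sphereIntegral_const_mul] at key
  have hne : ((l : ℝ) * (l + 1) - m * (m + 1)) ≠ 0 := by
    have : ((l : ℝ) - m) * (l + m + 1) ≠ 0 :=
      mul_ne_zero (sub_ne_zero.mpr (by exact_mod_cast h)) (by positivity)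
    intro h'; apply this; linear_combination h'
  have h0 : ((l : ℝ) * (l + 1) - m * (m + 1))
      * sphereIntegral (fun θ => sphericalY l θ * sphericalY m θ) = 0 := by linear_combination key
  exact (mul_eq_zero.mp h0).resolve_left hne

theorem sphereIntegral_legendreP_of_ne {l m : ℕ} (h : l ≠ m) :
    sphereIntegral (fun θ => legendreP l (Real.cos θ) * legendreP m (Real.cos θ)) = 0 := by
  have hl : ∀ l : ℕ, Real.sqrt ((2 * l + 1) / (4 * Real.pi)) ≠ 0 := fun l =>
    (Real.sqrt_pos.mpr (by positivity)).ne'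
  have := sphereIntegral_sphericalY_of_ne h
  have e : (fun θ => sphericalY l θ * sphericalY m θ) = fun θ =>
      (Real.sqrt ((2 * l + 1) / (4 * Real.pi)) * Real.sqrt ((2 * m + 1) / (4 * Real.pi)))
        * (legendreP l (Real.cos θ) * legendreP m (Real.cos θ)) := by
    funext θ; simp only [sphericalY]; ring
  rw [e, sphereIntegral_const_mul] at this
  exact (mul_eq_zero.mp this).resolve_left (mul_ne_zero (hl l) (hl m))

theorem continuous_legendreP_cos (n : ℕ) : Continuous fun θ => legendreP n (Real.cos θ) :=
  (contDiff_legendreP n).continuous.comp Real.continuous_cos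

theorem sphereIntegral_cos_legendreP (n : ℕ) :
    sphereIntegral (fun θ => Real.cos θ * legendreP n (Real.cos θ) * legendreP (n + 1) (Real.cos θ))
      = (n + 1) / (2 * n + 3) * sphereIntegral (fun θ => legendreP n (Real.cos θ) ^ 2) := by
  have h0 := continuous_legendreP_cos n
  have h1 := continuous_legendreP_cos (n + 1)
  have h := sphereIntegral_legendreP_of_ne (show n ≠ n + 2 by omega)
  have e : (fun θ => legendreP n (Real.cos θ) * legendreP (n + 2) (Real.cos θ)) = fun θ =>
      ((2 * n + 3) / (n + 2) : ℝ) *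
        (Real.cos θ * legendreP n (Real.cos θ) * legendreP (n + 1) (Real.cos θ))
      - ((n + 1) / (n + 2) : ℝ) * legendreP n (Real.cos θ) ^ 2 := by
    funext θ
    rw [bonnet_legendreP]
    field_simp
  rw [e, sphereIntegral_sub (by fun_prop) (by fun_prop), sphereIntegral_const_mul,
    sphereIntegral_const_mul] at h
  field_simp at h ⊢
  linear_combination h

/-- One factor of the square is expanded by Bonnet's recurrence. One term is the integral of
`sphereIntegral_cos_legendreP`, the other vanishes by orthogonality. The recurrence starts at degree
2, so n = 0 is treated apart. -/
theorem sphereIntegral_legendreP_sq_succ (n : ℕ) :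
    sphereIntegral (fun θ => legendreP (n + 1) (Real.cos θ) ^ 2)
      = (2 * n + 1) / (2 * n + 3) * sphereIntegral (fun θ => legendreP n (Real.cos θ) ^ 2) := by
  cases n with
  | zero =>
    have := sphereIntegral_cos_legendreP 0
    simp only [legendreP, mul_one] at this ⊢
    simp only [← sq] at this
    rw [this]; norm_num
  | succ n =>
    have h1 := continuous_legendreP_cos (n + 1)
    have h2 := continuous_legendreP_cos (n + 2)
    have h0 := continuous_legendreP_cos n
    have hJ := sphereIntegral_cos_legendreP (n + 1)
    have hne := sphereIntegral_legendreP_of_ne (show n ≠ n + 2 by omega)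
    have e : (fun θ => legendreP (n + 1 + 1) (Real.cos θ) ^ 2) = fun θ =>
        ((2 * n + 3) / (n + 2) : ℝ) *
          (Real.cos θ * legendreP (n + 1) (Real.cos θ) * legendreP (n + 1 + 1) (Real.cos θ))
        - ((n + 1) / (n + 2) : ℝ) *
          (legendreP n (Real.cos θ) * legendreP (n + 2) (Real.cos θ)) := by
      funext θ
      rw [sq]
      nth_rewrite 1 [show n + 1 + 1 = n + 2 from rfl, bonnet_legendreP]
      field_simp
    rw [e, sphereIntegral_sub (by fun_prop) (by fun_prop), sphereIntegral_const_mul,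
      sphereIntegral_const_mul, hJ, hne]
    push_cast
    field_simp
    ring

theorem sphereIntegral_legendreP_sq (n : ℕ) :
    sphereIntegral (fun θ => legendreP n (Real.cos θ) ^ 2) = 4 * Real.pi / (2 * n + 1) := by
  induction n with
  | zero =>
    simp [legendreP, sphereIntegral]
    ring
  | succ n ih =>
    rw [sphereIntegral_legendreP_sq_succ, ih]
    push_cast
    field_simp
    ring

theorem sphereIntegral_sphericalY_sq (l : ℕ) :
    sphereIntegral (fun θ => sphericalY l θ * sphericalY l θ) = 1 := by
  have e : (fun θ => sphericalY l θ * sphericalY l θ) = fun θ =>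
      ((2 * l + 1) / (4 * Real.pi)) * legendreP l (Real.cos θ) ^ 2 := by
    funext θ
    rw [← Real.mul_self_sqrt (by positivity : 0 ≤ (2 * (l : ℝ) + 1) / (4 * Real.pi))]
    simp only [sphericalY]
    ring
  rw [e, sphereIntegral_const_mul, sphereIntegral_legendreP_sq]
  have := Real.pi_pos
  field_simp

theorem sphereIntegral_sphericalY (l m : ℕ) :
    sphereIntegral (fun θ => sphericalY l θ * sphericalY m θ) = if l = m then 1 else 0 := by
  split_ifs with h
  · rw [h, sphereIntegral_sphericalY_sq]
  · exact sphereIntegral_sphericalY_of_ne h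

/-- Bessel's inequality. -/
theorem summable_sphereIntegral_sq {h : ℝ → ℝ} (hh : Continuous h) :
    Summable fun l => sphereIntegral (fun θ => sphericalY l θ * h θ) ^ 2 := by
  refine summable_of_sum_le (c := sphereIntegral fun θ => h θ * h θ) (fun l => sq_nonneg _)
    fun s => ?_
  set c : ℕ → ℝ := fun l => sphereIntegral (fun θ => sphericalY l θ * h θ) with hc
  have hY := continuous_sphericalY
  -- This integrand is the square of h - ∑ c_l Y_l, written out so that orthonormality applies
  -- termwise.
  have hpos : 0 ≤ sphereIntegral fun θ =>
      (h θ * h θ - 2 * ∑ l ∈ s, c l * (sphericalY l θ * h θ))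
        + ∑ l ∈ s, ∑ m ∈ s, (c l * c m) * (sphericalY l θ * sphericalY m θ) := by
    refine sphereIntegral_nonneg fun θ => ?_
    have : (h θ * h θ - 2 * ∑ l ∈ s, c l * (sphericalY l θ * h θ))
        + ∑ l ∈ s, ∑ m ∈ s, (c l * c m) * (sphericalY l θ * sphericalY m θ)
        = (h θ - ∑ l ∈ s, c l * sphericalY l θ) ^ 2 := by
      have e1 : ∑ l ∈ s, c l * (sphericalY l θ * h θ) = (∑ l ∈ s, c l * sphericalY l θ) * h θ := by
        rw [Finset.sum_mul]; exact Finset.sum_congr rfl fun _ _ => by ring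
      have e2 : ∑ l ∈ s, ∑ m ∈ s, (c l * c m) * (sphericalY l θ * sphericalY m θ)
          = (∑ l ∈ s, c l * sphericalY l θ) * ∑ l ∈ s, c l * sphericalY l θ := by
        rw [Finset.sum_mul_sum]
        exact Finset.sum_congr rfl fun _ _ => Finset.sum_congr rfl fun _ _ => by ring
      rw [e1, e2]; ring
    rw [this]
    positivity
  rw [sphereIntegral_add (by fun_prop) (by fun_prop), sphereIntegral_sub (by fun_prop)
    (by fun_prop), sphereIntegral_const_mul, sphereIntegral_sum _ (fun i => by fun_prop),
    sphereIntegral_sum _ (fun i => by fun_prop)] at hpos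
  have e3 : ∀ l, sphereIntegral (fun θ => ∑ m ∈ s, (c l * c m) * (sphericalY l θ * sphericalY m θ))
      = ∑ m ∈ s, if l = m then c l * c m else 0 := fun l => by
    rw [sphereIntegral_sum _ (fun i => by fun_prop)]
    refine Finset.sum_congr rfl fun m _ => ?_
    rw [sphereIntegral_const_mul, sphereIntegral_sphericalY]
    split_ifs <;> ring
  simp only [e3, Finset.sum_ite_eq, sphereIntegral_const_mul] at hpos
  have e4 : ∑ l ∈ s, (if l ∈ s then c l * c l else 0) = ∑ l ∈ s, c l ^ 2 :=
    Finset.sum_congr rfl fun l hl => by rw [if_pos hl, sq]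
  have e5 : ∑ l ∈ s, c l * sphereIntegral (fun θ => sphericalY l θ * h θ) = ∑ l ∈ s, c l ^ 2 :=
    Finset.sum_congr rfl fun l hl => by rw [sq]
  rw [e4, e5] at hpos
  linarith

/-! ### Smooth fields and their mode coefficients -/

/-- A smooth function of time and of the polar angle, extended to all angles. -/
def SmoothStrip (F : ℝ × ℝ → ℝ) : Prop := ContDiffOn ℝ ∞ F (Set.Ioo 0 Real.pi ×ˢ Set.univ)

theorem isOpen_strip : IsOpen (Set.Ioo 0 Real.pi ×ˢ (Set.univ : Set ℝ)) :=
  isOpen_Ioo.prod isOpen_univ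

theorem SmoothStrip.fderiv_apply {F : ℝ × ℝ → ℝ} (hF : SmoothStrip F) (v : ℝ × ℝ) :
    SmoothStrip fun q => fderiv ℝ F q v :=
  (ContDiffOn.fderiv_of_isOpen hF isOpen_strip (m := ∞) (by simp)).clm_apply contDiffOn_const

theorem SmoothStrip.hasFDerivAt {F : ℝ × ℝ → ℝ} (hF : SmoothStrip F) {t : ℝ}
    (ht : t ∈ Set.Ioo 0 Real.pi) (θ : ℝ) : HasFDerivAt F (fderiv ℝ F (t, θ)) (t, θ) :=
  ((hF.contDiffAt (isOpen_strip.mem_nhds ⟨ht, trivial⟩)).differentiableAt (by simp)).hasFDerivAt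

/-- Time derivative. -/
def dTime (F : ℝ × ℝ → ℝ) (q : ℝ × ℝ) : ℝ := fderiv ℝ F q (1, 0)

/-- Derivative with respect to the polar angle. -/
def dAngle (F : ℝ × ℝ → ℝ) (q : ℝ × ℝ) : ℝ := fderiv ℝ F q (0, 1)

theorem SmoothStrip.dTime {F : ℝ × ℝ → ℝ} (hF : SmoothStrip F) : SmoothStrip (dTime F) :=
  hF.fderiv_apply (1, 0)

theorem SmoothStrip.dAngle {F : ℝ × ℝ → ℝ} (hF : SmoothStrip F) : SmoothStrip (dAngle F) :=
  hF.fderiv_apply (0, 1)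

theorem SmoothStrip.hasDerivAt_time {F : ℝ × ℝ → ℝ} (hF : SmoothStrip F) {t : ℝ}
    (ht : t ∈ Set.Ioo 0 Real.pi) (θ : ℝ) :
    HasDerivAt (fun τ => F (τ, θ)) (GowdyField.dTime F (t, θ)) t := by
  have h : HasDerivAt (fun τ : ℝ => (τ, θ)) ((1 : ℝ), (0 : ℝ)) t :=
    (hasDerivAt_id t).prodMk (hasDerivAt_const t θ)
  exact (hF.hasFDerivAt ht θ).comp_hasDerivAt t h

theorem SmoothStrip.hasDerivAt_angle {F : ℝ × ℝ → ℝ} (hF : SmoothStrip F) {t : ℝ}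
    (ht : t ∈ Set.Ioo 0 Real.pi) (θ : ℝ) :
    HasDerivAt (fun η => F (t, η)) (GowdyField.dAngle F (t, θ)) θ := by
  have h : HasDerivAt (fun η : ℝ => (t, η)) ((0 : ℝ), (1 : ℝ)) θ :=
    (hasDerivAt_const θ t).prodMk (hasDerivAt_id θ)
  exact (hF.hasFDerivAt ht θ).comp_hasDerivAt θ h

theorem SmoothStrip.continuous_slice {F : ℝ × ℝ → ℝ} (hF : SmoothStrip F) {t : ℝ}
    (ht : t ∈ Set.Ioo 0 Real.pi) : Continuous fun θ => F (t, θ) :=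
  continuous_iff_continuousAt.mpr fun θ => (hF.hasDerivAt_angle ht θ).continuousAt

theorem SmoothStrip.hasDerivAt_coeff {F : ℝ × ℝ → ℝ} (hF : SmoothStrip F) (l : ℕ) {t : ℝ}
    (ht : t ∈ Set.Ioo 0 Real.pi) :
    HasDerivAt (fun τ => sphereIntegral fun θ => sphericalY l θ * F (τ, θ))
      (sphereIntegral fun θ => sphericalY l θ * GowdyField.dTime F (t, θ)) t := by
  obtain ⟨ε, hε, hball⟩ := Metric.isOpen_iff.mp isOpen_Ioo t ht
  have hsub : Metric.closedBall t (ε / 2) ⊆ Set.Ioo 0 Real.pi :=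
    (Metric.closedBall_subset_ball (by linarith)).trans hball
  have hY := continuous_sphericalY l
  have hT := hF.dTime
  have hcomp : IsCompact (Metric.closedBall t (ε / 2) ×ˢ Set.Icc 0 Real.pi) :=
    (isCompact_closedBall _ _).prod isCompact_Icc
  have hcont : ContinuousOn (fun q : ℝ × ℝ =>
      sphericalY l q.2 * GowdyField.dTime F q * Real.sin q.2)
      (Metric.closedBall t (ε / 2) ×ˢ Set.Icc 0 Real.pi) := by
    have h1 : ContinuousOn (GowdyField.dTime F)
      (Metric.closedBall t (ε / 2) ×ˢ Set.Icc 0 Real.pi) :=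
      hT.continuousOn.mono (Set.prod_mono hsub (Set.subset_univ _))
    exact ((hY.comp continuous_snd).continuousOn.mul h1).mul
      (Real.continuous_sin.comp continuous_snd).continuousOn
  obtain ⟨M, hM⟩ := hcomp.exists_bound_of_continuousOn hcont
  have slice : ∀ τ ∈ Set.Ioo 0 Real.pi, Continuous fun θ => sphericalY l θ * F (τ, θ) * Real.sin θ :=
    fun τ hτ => (hY.mul (hF.continuous_slice hτ)).mul Real.continuous_sin
  have key := intervalIntegral.hasDerivAt_integral_of_dominated_loc_of_deriv_le (𝕜 := ℝ)
    (μ := MeasureTheory.volume) (a := 0) (b := Real.pi) (bound := fun _ => M)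
    (F := fun τ θ => sphericalY l θ * F (τ, θ) * Real.sin θ)
    (F' := fun τ θ => sphericalY l θ * GowdyField.dTime F (τ, θ) * Real.sin θ)
    (x₀ := t) (s := Metric.closedBall t (ε / 2)) (Metric.closedBall_mem_nhds _ (by linarith))
    (Filter.eventually_of_mem (isOpen_Ioo.mem_nhds ht) fun τ hτ =>
      (slice τ hτ).aestronglyMeasurable)
    ((slice t ht).intervalIntegrable _ _)
    ((hY.mul (hT.continuous_slice ht)).mul Real.continuous_sin).aestronglyMeasurable
    (Filter.Eventually.of_forall fun θ hθ τ hτ => by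
      rw [Set.uIoc_of_le Real.pi_pos.le] at hθ
      exact hM (τ, θ) ⟨hτ, hθ.1.le, hθ.2⟩)
    (by simp)
    (Filter.Eventually.of_forall fun θ _ τ hτ => by
      exact ((hF.hasDerivAt_time (hsub hτ) θ).const_mul _).mul_const _)
  exact key.2.const_mul (2 * Real.pi)

/-- The field as a function of time and angle, extended to all angles. -/
def strip (ξ : ℝ → ℝ → ℝ) (q : ℝ × ℝ) : ℝ := ξ q.1 (Real.arccos (Real.cos q.2))

theorem strip_eq (ξ : ℝ → ℝ → ℝ) (t : ℝ) {θ : ℝ} (hθ : θ ∈ Set.Icc 0 Real.pi) :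
    strip ξ (t, θ) = ξ t θ := by
  simp only [strip, Real.arccos_cos hθ.1 hθ.2]

/-- The great circle (sin θ, 0, cos θ) runs smoothly through both poles, and arccos (cos θ) is the
polar angle of its points. Restricting the field to it gives a smooth function of every real θ, so
the poles need no separate treatment. -/
theorem IsSmoothField.strip {ξ : ℝ → ℝ → ℝ} (h : IsSmoothField ξ) :
    SmoothStrip (GowdyField.strip ξ) := by
  have hφ : ContDiff ℝ ∞ fun q : ℝ × ℝ =>
      ((q.1, !₂[Real.sin q.2, 0, Real.cos q.2]) : ℝ × EuclideanSpace ℝ (Fin 3)) := by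
    refine contDiff_fst.prodMk (contDiff_euclidean.mpr fun i => ?_)
    fin_cases i
    · exact Real.contDiff_sin.comp contDiff_snd
    · exact contDiff_const
    · exact Real.contDiff_cos.comp contDiff_snd
  have hnorm : ∀ θ : ℝ, ‖(!₂[Real.sin θ, 0, Real.cos θ] : EuclideanSpace ℝ (Fin 3))‖ = 1 :=
    fun θ => by
    rw [EuclideanSpace.norm_eq, Fin.sum_univ_three]
    simp
  refine (h.comp hφ.contDiffOn fun q hq => ⟨hq.1, ?_⟩).congr fun q hq => ?_
  · intro h0
    have := hnorm q.2
    simp only at h0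
    rw [h0] at this
    simp at this
  · simp [GowdyField.strip, hnorm]

theorem deriv_time_eq {ξ : ℝ → ℝ → ℝ} (h : IsSmoothField ξ) {t θ : ℝ}
    (ht : t ∈ Set.Ioo 0 Real.pi) (hθ : θ ∈ Set.Icc 0 Real.pi) :
    HasDerivAt (fun τ => ξ τ θ) (dTime (strip ξ) (t, θ)) t := by
  have := h.strip.hasDerivAt_time ht θ
  simpa only [strip_eq ξ _ hθ] using this

theorem deriv_deriv_time_eq {ξ : ℝ → ℝ → ℝ} (h : IsSmoothField ξ) {t θ : ℝ}
    (ht : t ∈ Set.Ioo 0 Real.pi) (hθ : θ ∈ Set.Icc 0 Real.pi) :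
    HasDerivAt (deriv fun τ => ξ τ θ) (dTime (dTime (strip ξ)) (t, θ)) t := by
  refine (h.strip.dTime.hasDerivAt_time ht θ).congr_of_eventuallyEq ?_
  filter_upwards [isOpen_Ioo.mem_nhds ht] with τ hτ
  exact (deriv_time_eq h hτ hθ).deriv

/-- The coefficient of the field with respect to `Y_l`. -/
def coeffQ (l : ℕ) (ξ : ℝ → ℝ → ℝ) (t : ℝ) : ℝ :=
  sphereIntegral fun θ => sphericalY l θ * ξ t θ

/-- The coefficient of the momentum with respect to `Y_l`. -/
def coeffP (l : ℕ) (ξ : ℝ → ℝ → ℝ) (t : ℝ) : ℝ :=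
  sphereIntegral fun θ => sphericalY l θ * momentum ξ t θ

theorem coeffQ_eq_strip (l : ℕ) (ξ : ℝ → ℝ → ℝ) (t : ℝ) :
    coeffQ l ξ t = sphereIntegral fun θ => sphericalY l θ * strip ξ (t, θ) :=
  sphereIntegral_congr fun θ hθ => by rw [strip_eq ξ t hθ]

theorem coeffP_eq_strip (l : ℕ) {ξ : ℝ → ℝ → ℝ} (h : IsSmoothField ξ) {t : ℝ}
    (ht : t ∈ Set.Ioo 0 Real.pi) : coeffP l ξ t =
      (sphereIntegral fun θ => sphericalY l θ * dTime (strip ξ) (t, θ))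
        - 1 / 2 * Real.cot t * coeffQ l ξ t := by
  have hY := continuous_sphericalY l
  have h1 := h.strip.continuous_slice ht
  have h2 := h.strip.dTime.continuous_slice ht
  rw [coeffQ_eq_strip, ← sphereIntegral_const_mul, ← sphereIntegral_sub (by fun_prop) (by fun_prop)]
  refine sphereIntegral_congr fun θ hθ => ?_
  rw [momentum, (deriv_time_eq h ht hθ).deriv, strip_eq ξ t hθ]
  ring

/-- The Laplacian of a solution, continued to the poles. -/
def solutionLaplacian (ξ : ℝ → ℝ → ℝ) (t θ : ℝ) : ℝ :=
  dTime (dTime (strip ξ)) (t, θ) + 1 / 4 * (1 + 1 / Real.sin t ^ 2) * strip ξ (t, θ)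

theorem continuous_solutionLaplacian {ξ : ℝ → ℝ → ℝ} (h : IsSmoothField ξ) {t : ℝ}
    (ht : t ∈ Set.Ioo 0 Real.pi) : Continuous (solutionLaplacian ξ t) := by
  have h1 := h.strip.continuous_slice ht
  have h2 := h.strip.dTime.dTime.continuous_slice ht
  unfold solutionLaplacian
  fun_prop

theorem sphereLaplacian_eq_strip {ξ : ℝ → ℝ → ℝ} (h : IsSmoothField ξ) {t θ : ℝ}
    (ht : t ∈ Set.Ioo 0 Real.pi) (hθ : θ ∈ Set.Ioo 0 Real.pi) :
    HasDerivAt (fun η => Real.sin η * dAngle (strip ξ) (t, η))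
      (Real.sin θ * sphereLaplacian (ξ t) θ) θ := by
  have hs := (Real.sin_pos_of_mem_Ioo hθ).ne'
  have hev : (fun η => Real.sin η * deriv (ξ t) η)
      =ᶠ[nhds θ] fun η => Real.sin η * dAngle (strip ξ) (t, η) := by
    filter_upwards [isOpen_Ioo.mem_nhds hθ] with η hη
    have hev' : ξ t =ᶠ[nhds η] fun η => strip ξ (t, η) := by
      filter_upwards [isOpen_Ioo.mem_nhds hη] with x hx
      rw [strip_eq ξ t (Set.Ioo_subset_Icc_self hx)]
    rw [hev'.deriv_eq, (h.strip.hasDerivAt_angle ht η).deriv]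
  have hd := ((Real.hasDerivAt_sin θ).mul (h.strip.dAngle.hasDerivAt_angle ht θ))
  refine hd.congr_deriv ?_
  rw [sphereLaplacian, hev.deriv_eq]
  rw [show deriv (fun η => Real.sin η * dAngle (strip ξ) (t, η)) θ = _ from hd.deriv]
  field_simp

theorem IsStaticSolution.coeff_laplacian {ξ : ℝ → ℝ → ℝ} (h : IsStaticSolution ξ) (l : ℕ) {t : ℝ}
    (ht : t ∈ Set.Ioo 0 Real.pi) :
    sphereIntegral (fun θ => sphericalY l θ * solutionLaplacian ξ t θ)
      = -(l * (l + 1)) * coeffQ l ξ t := by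
  rw [coeffQ_eq_strip]
  refine sphereIntegral_laplacian l (h.smooth.strip.continuous_slice ht)
    (h.smooth.strip.dAngle.continuous_slice ht) (continuous_solutionLaplacian h.smooth ht)
    (fun θ _ => h.smooth.strip.hasDerivAt_angle ht θ) fun θ hθ => ?_
  refine (sphereLaplacian_eq_strip h.smooth ht hθ).congr_deriv ?_
  have := h.eqn t ht θ hθ
  rw [(deriv_deriv_time_eq h.smooth ht (Set.Ioo_subset_Icc_self hθ)).deriv] at this
  rw [solutionLaplacian, strip_eq ξ t (Set.Ioo_subset_Icc_self hθ)]
  linear_combination (Real.sin θ) * this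

/-- The coefficients of a solution solve the mode system. -/
theorem IsStaticSolution.modeSystem {ξ : ℝ → ℝ → ℝ} (h : IsStaticSolution ξ) (l : ℕ) :
    IsModeSolution l (fun t => (coeffQ l ξ t : ℂ)) (fun t => (coeffP l ξ t : ℂ)) := by
  intro t ht
  have hmem := isOpen_Ioo.mem_nhds ht
  have hQ : HasDerivAt (coeffQ l ξ) (coeffP l ξ t + 1 / 2 * Real.cot t * coeffQ l ξ t) t := by
    have := h.smooth.strip.hasDerivAt_coeff l ht
    simp only [← coeffQ_eq_strip] at this
    refine this.congr_deriv ?_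
    rw [coeffP_eq_strip l h.smooth ht]; ring
  have hP : HasDerivAt (coeffP l ξ)
      (-(1 / 2 * Real.cot t * coeffP l ξ t) - l * (l + 1) * coeffQ l ξ t) t := by
    have h1 := h.smooth.strip.dTime.hasDerivAt_coeff l ht
    have h2 := ((hasDerivAt_cot ht).const_mul (1 / 2)).mul hQ
    refine ((h1.sub h2).congr_of_eventuallyEq
      (Filter.eventually_of_mem hmem fun τ hτ => coeffP_eq_strip l h.smooth hτ)).congr_deriv ?_
    have h3 := h.coeff_laplacian l ht
    have hY := continuous_sphericalY l
    have c1 := h.smooth.strip.continuous_slice ht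
    have c2 := h.smooth.strip.dTime.dTime.continuous_slice ht
    have e : (fun θ => sphericalY l θ * solutionLaplacian ξ t θ) = fun θ =>
        sphericalY l θ * dTime (dTime (strip ξ)) (t, θ)
          + 1 / 4 * (1 + 1 / Real.sin t ^ 2) * (sphericalY l θ * strip ξ (t, θ)) := by
      funext θ; rw [solutionLaplacian]; ring
    rw [e, sphereIntegral_add (by fun_prop) (by fun_prop), sphereIntegral_const_mul,
      ← coeffQ_eq_strip] at h3
    rw [eq_sub_of_add_eq h3, Real.cot_eq_cos_div_sin]
    have hs := (Real.sin_pos_of_mem_Ioo ht).ne'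
    have hc : Real.cos t ^ 2 = 1 - Real.sin t ^ 2 := by rw [Real.sin_sq]; ring
    field_simp
    linear_combination (-4 * coeffQ l ξ t) * hc
  constructor
  · refine hQ.ofReal_comp.congr_deriv ?_
    push_cast; ring
  · refine hP.ofReal_comp.congr_deriv ?_
    push_cast; ring

/-! ### Massless and static form of the field equation -/

theorem isSmoothField_mul_iff {φ : ℝ → ℝ → ℝ} {a : ℝ → ℝ} (ha : ContDiffOn ℝ ∞ a (Set.Ioo 0 Real.pi))
    (h0 : ∀ t ∈ Set.Ioo 0 Real.pi, a t ≠ 0) :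
    IsSmoothField (fun t θ => a t * φ t θ) ↔ IsSmoothField φ := by
  have ha' : ContDiffOn ℝ ∞ (fun q : ℝ × EuclideanSpace ℝ (Fin 3) => a q.1)
      (Set.Ioo 0 Real.pi ×ˢ {x | x ≠ 0}) := ha.comp contDiffOn_fst fun q hq => hq.1
  constructor
  · intro h
    refine ((ha'.inv fun q hq => h0 _ hq.1).mul h).congr fun q hq => ?_
    have := h0 _ hq.1
    simp only [Pi.inv_apply]
    field_simp
  · exact fun h => ha'.mul h

theorem contDiffOn_sqrt_sin :
    ContDiffOn ℝ ∞ (fun t => Real.sqrt (Real.sin t)) (Set.Ioo 0 Real.pi) :=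
  Real.contDiff_sin.contDiffOn.sqrt fun _ ht => (Real.sin_pos_of_mem_Ioo ht).ne'

theorem sphereLaplacian_const_mul (c : ℝ) (f : ℝ → ℝ) (θ : ℝ) :
    sphereLaplacian (fun θ => c * f θ) θ = c * sphereLaplacian f θ := by
  simp only [sphereLaplacian, deriv_const_mul_field']
  rw [show (fun η => Real.sin η * (c * deriv f η)) = fun η => c * (Real.sin η * deriv f η) by
    funext η; ring, deriv_const_mul_field]
  ring

/-- With a = √(sin t) one has 2a'/a = cot t, which accounts for the first-order term, and a''/a =
-(1 + csc² t)/4. Smoothness passes both ways because a is smooth and nonvanishing on (0, π). -/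
theorem isMasslessSolution_iff (φ : ℝ → ℝ → ℝ) :
    IsMasslessSolution φ ↔ IsStaticSolution fun t θ => Real.sqrt (Real.sin t) * φ t θ := by
  have hsm : IsSmoothField (fun t θ => Real.sqrt (Real.sin t) * φ t θ) ↔ IsSmoothField φ :=
    isSmoothField_mul_iff contDiffOn_sqrt_sin fun t ht =>
      (Real.sqrt_pos.mpr (Real.sin_pos_of_mem_Ioo ht)).ne'
  have key : IsSmoothField φ → ∀ t ∈ Set.Ioo 0 Real.pi, ∀ θ ∈ Set.Ioo 0 Real.pi,
      -deriv (deriv fun τ => Real.sqrt (Real.sin τ) * φ τ θ) t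
        + sphereLaplacian (fun θ => Real.sqrt (Real.sin t) * φ t θ) θ
        - (1 / 4) * (1 + 1 / Real.sin t ^ 2) * (Real.sqrt (Real.sin t) * φ t θ)
      = -(Real.sqrt (Real.sin t) * (deriv (deriv fun τ => φ τ θ) t
        + Real.cot t * deriv (fun τ => φ τ θ) t - sphereLaplacian (φ t) θ)) := by
    intro h t ht θ hθ
    have hθ' := Set.Ioo_subset_Icc_self hθ
    have hs := (Real.sin_pos_of_mem_Ioo ht).ne'
    have d1 : ∀ τ ∈ Set.Ioo 0 Real.pi, HasDerivAt (fun τ => Real.sqrt (Real.sin τ) * φ τ θ)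
        (1 / 2 * Real.cot τ * Real.sqrt (Real.sin τ) * φ τ θ
          + Real.sqrt (Real.sin τ) * deriv (fun τ => φ τ θ) τ) τ := fun τ hτ =>
      (hasDerivAt_sqrt_sin hτ).mul (deriv_time_eq h hτ hθ').differentiableAt.hasDerivAt
    have d2 := ((((hasDerivAt_cot ht).const_mul (1 / 2)).mul (hasDerivAt_sqrt_sin ht)).mul
      (deriv_time_eq h ht hθ').differentiableAt.hasDerivAt).add
      ((hasDerivAt_sqrt_sin ht).mul (deriv_deriv_time_eq h ht hθ').differentiableAt.hasDerivAt)
    have d3 := d2.congr_of_eventuallyEq (Filter.eventually_of_mem (isOpen_Ioo.mem_nhds ht)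
      fun τ hτ => (d1 τ hτ).deriv)
    rw [d3.deriv, sphereLaplacian_const_mul, Real.cot_eq_cos_div_sin]
    have hc : Real.cos t ^ 2 = 1 - Real.sin t ^ 2 := by rw [Real.sin_sq]; ring
    simp only [Pi.mul_apply]
    rw [Real.cot_eq_cos_div_sin]
    field_simp
    rw [hc]
    ring
  constructor
  · intro h
    refine ⟨hsm.mpr h.smooth, fun t ht θ hθ => ?_⟩
    have := key h.smooth t ht θ hθ
    rw [h.eqn t ht θ hθ, mul_zero, neg_zero] at this
    exact sub_eq_zero.mp this
  · intro h
    have hφ := hsm.mp h.smooth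
    refine ⟨hφ, fun t ht θ hθ => ?_⟩
    have := key hφ t ht θ hθ
    rw [sub_eq_zero.mpr (h.eqn t ht θ hθ), eq_comm, neg_eq_zero] at this
    exact (mul_eq_zero.mp this).resolve_left
      (Real.sqrt_pos.mpr (Real.sin_pos_of_mem_Ioo ht)).ne'

/-! ### Positive-frequency parts -/

theorem IsModeSolution.momentum_unique {l : ℕ} {f p g q : ℝ → ℂ} (hf : IsModeSolution l f p)
    (hg : IsModeSolution l g q) (h : ∀ t ∈ Set.Ioo 0 Real.pi, f t = g t) {t : ℝ}
    (ht : t ∈ Set.Ioo 0 Real.pi) : p t = q t := by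
  rw [← hf.momentum_eq ht, ← (hg.congr h fun _ _ => rfl).momentum_eq ht]

theorem IsPositiveFrequencyPart.coeff {ρ ν : ℕ → ℝ} {ξ : ℝ → ℝ → ℝ} {b : OneParticle}
    (hb : IsPositiveFrequencyPart ρ ν ξ b) (h : IsStaticSolution ξ) (l : ℕ) {t : ℝ}
    (ht : t ∈ Set.Ioo 0 Real.pi) :
    (coeffQ l ξ t : ℂ) = b l * mode ρ ν l t + conj (b l * mode ρ ν l t) ∧
    (coeffP l ξ t : ℂ) = b l * modeMomentum ρ ν l t + conj (b l * modeMomentum ρ ν l t) := by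
  refine ⟨hb t ht l, ?_⟩
  have h1 := (mode_system ρ ν l).const_mul (b l)
  exact (h.modeSystem l).momentum_unique (h1.add h1.conj) (fun s hs => hb s hs l) ht

/-- The positive-frequency coefficient of a pair of Cauchy data. -/
def frequencyCoeff (ρ ν : ℕ → ℝ) (l : ℕ) (t : ℝ) (f p : ℂ) : ℂ :=
  -Complex.I * (f * conj (modeMomentum ρ ν l t) - p * conj (mode ρ ν l t))

/-- The symplectic product with the conjugate mode annihilates the negative-frequency part and gives
i times the coefficient of the mode. -/
theorem frequencyCoeff_eq {ρ ν : ℕ → ℝ} (hρ : ∀ l, 0 < ρ l) (l : ℕ) {t : ℝ}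
    (ht : t ∈ Set.Ioo 0 Real.pi) (b : ℂ) :
    frequencyCoeff ρ ν l t (b * mode ρ ν l t + conj (b * mode ρ ν l t))
      (b * modeMomentum ρ ν l t + conj (b * modeMomentum ρ ν l t)) = b := by
  have hW := mode_wronskian ρ ν l (hρ l) ht
  simp only [frequencyCoeff, map_mul]
  linear_combination (-Complex.I * b) * hW - b * Complex.I_sq

theorem eq_of_frequencyCoeff {ρ ν : ℕ → ℝ} (hρ : ∀ l, 0 < ρ l) (l : ℕ) {t : ℝ}
    (ht : t ∈ Set.Ioo 0 Real.pi) (f p : ℝ) :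
    (f : ℂ) = frequencyCoeff ρ ν l t f p * mode ρ ν l t
      + conj (frequencyCoeff ρ ν l t f p * mode ρ ν l t) := by
  have hW := mode_wronskian ρ ν l (hρ l) ht
  simp only [frequencyCoeff, map_mul, map_sub, map_neg, Complex.conj_I, Complex.conj_conj,
    Complex.conj_ofReal]
  linear_combination (Complex.I * f) * hW + f * Complex.I_sq

/-- The Bogoliubov coefficient `α_l(t₁, t₀)`. -/
def bogoliubovAlpha (ρ ν : ℕ → ℝ) (l : ℕ) (t₁ t₀ : ℝ) : ℂ :=
  -Complex.I * (mode ρ ν l t₁ * conj (modeMomentum ρ ν l t₀)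
    - modeMomentum ρ ν l t₁ * conj (mode ρ ν l t₀))

/-- The evolution is symplectic; in one mode this is the product of the normalizations at the two
times. -/
theorem normSq_bogoliubovAlpha {ρ ν : ℕ → ℝ} (hρ : ∀ l, 0 < ρ l) (l : ℕ) {t₁ t₀ : ℝ}
    (h1 : t₁ ∈ Set.Ioo 0 Real.pi) (h0 : t₀ ∈ Set.Ioo 0 Real.pi) :
    ‖bogoliubovAlpha ρ ν l t₁ t₀‖ ^ 2 = 1 + ‖bogoliubovBeta ρ ν l t₁ t₀‖ ^ 2 := by
  have W1 := mode_wronskian ρ ν l (hρ l) h1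
  have W0 := mode_wronskian ρ ν l (hρ l) h0
  have : bogoliubovAlpha ρ ν l t₁ t₀ * conj (bogoliubovAlpha ρ ν l t₁ t₀)
      = 1 + bogoliubovBeta ρ ν l t₁ t₀ * conj (bogoliubovBeta ρ ν l t₁ t₀) := by
    simp only [bogoliubovAlpha, bogoliubovBeta, map_mul, map_sub, map_neg, Complex.conj_I,
      Complex.conj_conj]
    generalize mode ρ ν l t₁ = z1 at *
    generalize mode ρ ν l t₀ = z0 at *
    generalize modeMomentum ρ ν l t₁ = p1 at *
    generalize modeMomentum ρ ν l t₀ = p0 at *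
    linear_combination (-(z0 * conj p0 - conj z0 * p0)) * W1 - Complex.I * W0
      + (-(z1 * conj p0 - p1 * conj z0) * (conj z1 * p0 - conj p1 * z0)
        + (conj z0 * conj p1 - conj z1 * conj p0) * (z0 * p1 - z1 * p0) - 1) * Complex.I_sq
  rw [Complex.mul_conj, Complex.mul_conj, Complex.normSq_eq_norm_sq,
    Complex.normSq_eq_norm_sq] at this
  exact_mod_cast this

/-- The evolution acts on positive-frequency parts as a diagonal Bogoliubov transformation. -/
theorem IsEvolved.frequency_eq {ρ ν : ℕ → ℝ} (hρ : ∀ l, 0 < ρ l) {t₁ t₀ : ℝ} {ξ ξ' : ℝ → ℝ → ℝ}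
    (h : IsEvolved t₁ t₀ ξ ξ') (h1 : t₁ ∈ Set.Ioo 0 Real.pi) (h0 : t₀ ∈ Set.Ioo 0 Real.pi)
    {b b' : OneParticle} (hb : IsPositiveFrequencyPart ρ ν ξ b)
    (hb' : IsPositiveFrequencyPart ρ ν ξ' b') (l : ℕ) :
    b' l = bogoliubovAlpha ρ ν l t₁ t₀ * b l + bogoliubovBeta ρ ν l t₁ t₀ * conj (b l) := by
  obtain ⟨q1, p1⟩ := hb.coeff h.left l h1
  obtain ⟨q0, p0⟩ := hb'.coeff h.right l h0
  have hq : coeffQ l ξ' t₀ = coeffQ l ξ t₁ :=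
    sphereIntegral_congr fun θ hθ => by rw [h.position_eq θ hθ]
  have hp : coeffP l ξ' t₀ = coeffP l ξ t₁ :=
    sphereIntegral_congr fun θ hθ => by rw [h.momentum_eq θ hθ]
  have hc := frequencyCoeff_eq hρ l (ν := ν) h0 (b' l)
  rw [← q0, ← p0, hq, hp, q1, p1] at hc
  rw [← hc]
  simp only [frequencyCoeff, bogoliubovAlpha, bogoliubovBeta, map_mul]
  ring

/-! ### Square summability of the frequency coefficients of a solution -/

/-- These bounds are weaker than the true orders ω^(-1/2) and ω^(1/2), but the decay of the
coefficients of a smooth field makes up for the loss. -/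
theorem mode_bounds_half_pi {ρ ν : ℕ → ℝ} (hρ : ∀ l, 0 < ρ l)
    (hB : Summable fun l => ‖refB ρ ν l‖ ^ 2) : ∃ C : ℝ, 0 ≤ C ∧ ∀ l,
      ‖mode ρ ν l (Real.pi / 2)‖ ≤ C ∧
      ‖modeMomentum ρ ν l (Real.pi / 2)‖ ≤ C * freq l := by
  obtain ⟨M, hM⟩ : ∃ M, ∀ l, ‖refA ρ ν l‖ ^ 2 ≤ M := ⟨1 + ∑' l, ‖refB ρ ν l‖ ^ 2, fun l => by
    rw [normSq_refA ρ ν l (hρ l)]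
    gcongr
    exact hB.le_tsum l fun _ _ => by positivity⟩
  have hM0 : 0 ≤ M := (sq_nonneg _).trans (hM 0)
  refine ⟨8 * M, by positivity, fun l => ?_⟩
  have hA1 := one_le_norm_refA (ν := ν) hρ l
  have hA : ‖refA ρ ν l‖ ≤ M := by nlinarith [hM l]
  have hB : ‖refB ρ ν l‖ ≤ M := by
    have := normSq_refA ρ ν l (hρ l)
    nlinarith [hM l, norm_nonneg (refB ρ ν l)]
  obtain ⟨σ, r, hσ, hr, hr2, hr1, hm, hp⟩ := refMode_data l
  have hω := freq_pos l
  have hω2 := half_le_freq l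
  have hsω : 0 < Real.sqrt (freq l) := Real.sqrt_pos.mpr hω
  have hsω2 := Real.mul_self_sqrt hω.le
  have h20 : 1 ≤ Real.sqrt 2 := Real.one_le_sqrt.mpr one_le_two
  have hsω3 : 1 ≤ Real.sqrt (freq l) * Real.sqrt 2 := by
    rw [← Real.sqrt_mul hω.le]; exact Real.one_le_sqrt.mpr (by linarith)
  have hr3 : r ≤ 2 := by
    have h5 : 1 / freq l ≤ 2 := by rw [div_le_iff₀ hω]; linarith
    nlinarith [(abs_le.mp (hr1.trans h5)).2]
  have hr4 : 1 / 2 ≤ r := by nlinarith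
  have hmn : ‖mode refRho 0 l (Real.pi / 2)‖ ≤ 2 := by
    rw [hm, norm_mul, hσ, one_mul, Complex.norm_real, Real.norm_of_nonneg (by positivity),
      div_le_iff₀ (by positivity)]
    linarith
  have hpn : ‖modeMomentum refRho 0 l (Real.pi / 2)‖ ≤ 4 * freq l := by
    rw [hp, norm_mul, norm_mul, norm_neg, Complex.norm_I, hσ, one_mul, one_mul, Complex.norm_real,
      Real.norm_of_nonneg (by positivity), div_le_iff₀ (by positivity)]
    have h6 : 1 / 2 ≤ r * Real.sqrt 2 := by nlinarith
    have h7 : Real.sqrt (freq l) ≤ 2 * freq l := by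
      have : 1 / 2 ≤ Real.sqrt (freq l) := by
        rw [show (1 / 2 : ℝ) = Real.sqrt (1 / 4) by
          rw [show (1 / 4 : ℝ) = (1 / 2) ^ 2 by norm_num, Real.sqrt_sq (by norm_num)]]
        exact Real.sqrt_le_sqrt (by linarith)
      nlinarith
    nlinarith
  constructor
  · rw [mode_eq_ref ρ ν l (hρ l)]
    refine (norm_add_le _ _).trans ?_
    rw [norm_mul, norm_mul, RCLike.norm_conj]
    have e1 : ‖refA ρ ν l‖ * ‖mode refRho 0 l (Real.pi / 2)‖ ≤ M * 2 := by gcongr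
    have e2 : ‖refB ρ ν l‖ * ‖mode refRho 0 l (Real.pi / 2)‖ ≤ M * 2 := by gcongr
    linarith
  · rw [modeMomentum_eq_ref ρ ν l (hρ l) half_pi_mem]
    refine (norm_add_le _ _).trans ?_
    rw [norm_mul, norm_mul, RCLike.norm_conj]
    have e1 : ‖refA ρ ν l‖ * ‖modeMomentum refRho 0 l (Real.pi / 2)‖ ≤ M * (4 * freq l) := by gcongr
    have e2 : ‖refB ρ ν l‖ * ‖modeMomentum refRho 0 l (Real.pi / 2)‖ ≤ M * (4 * freq l) := by gcongr
    linarith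

/-- The coefficient is a conserved symplectic product, so it may be estimated at t = π/2, where the
momentum is the time derivative. The growth of the mode momentum is absorbed by the factor l (l + 1)
gained from Bessel's inequality for the Laplacian. -/
theorem IsStaticSolution.exists_positiveFrequencyPart {ρ ν : ℕ → ℝ} (hρ : ∀ l, 0 < ρ l)
    (hB : Summable fun l => ‖refB ρ ν l‖ ^ 2) {ξ : ℝ → ℝ → ℝ} (h : IsStaticSolution ξ) :
    ∃ b : OneParticle, IsPositiveFrequencyPart ρ ν ξ b := by
  obtain ⟨C, hC, hbd⟩ := mode_bounds_half_pi hρ hB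
  set b : ℕ → ℂ := fun l => frequencyCoeff ρ ν l (Real.pi / 2) (coeffQ l ξ (Real.pi / 2))
    (coeffP l ξ (Real.pi / 2)) with hb
  -- the coefficient does not depend on time
  have hconst : ∀ l, ∀ t ∈ Set.Ioo 0 Real.pi,
      frequencyCoeff ρ ν l t (coeffQ l ξ t) (coeffP l ξ t) = b l := fun l t ht => by
    have := (h.modeSystem l).wronskian (mode_system ρ ν l).conj ht half_pi_mem
    rw [hb]
    simp only [frequencyCoeff]
    linear_combination (-Complex.I) * this
  have hcQ : Summable fun l => coeffQ l ξ (Real.pi / 2) ^ 2 := by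
    simp only [coeffQ_eq_strip]
    exact summable_sphereIntegral_sq (h.smooth.strip.continuous_slice half_pi_mem)
  have hcP : Summable fun l => coeffP l ξ (Real.pi / 2) ^ 2 := by
    have : ∀ l, coeffP l ξ (Real.pi / 2)
        = sphereIntegral fun θ => sphericalY l θ * dTime (strip ξ) (Real.pi / 2, θ) := fun l => by
      rw [coeffP_eq_strip l h.smooth half_pi_mem, cot_half_pi]; ring
    simp only [this]
    exact summable_sphereIntegral_sq (h.smooth.strip.dTime.continuous_slice half_pi_mem)
  have hcL : Summable fun l : ℕ => (l * (l + 1) * coeffQ l ξ (Real.pi / 2)) ^ 2 := by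
    have := summable_sphereIntegral_sq (continuous_solutionLaplacian h.smooth half_pi_mem)
    simp only [h.coeff_laplacian _ half_pi_mem] at this
    refine this.congr fun l => by ring
  have hmem : Memℓp b 2 := by
    rw [memlp_two_iff]
    have s1 : Summable fun l : ℕ => (C * (|l * (l + 1) * coeffQ l ξ (Real.pi / 2)|
        + |coeffQ l ξ (Real.pi / 2)|)) ^ 2 := by
      simp only [mul_pow C]
      refine (summable_sq_of_le (a := fun l : ℕ => |l * (l + 1) * coeffQ l ξ (Real.pi / 2)|)
        (b := fun l => |coeffQ l ξ (Real.pi / 2)|) ?_ ?_ (fun l => by positivity)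
        fun l => le_rfl).mul_left _
      · simpa only [sq_abs] using hcL
      · simpa only [sq_abs] using hcQ
    have s2 : Summable fun l => (C * |coeffP l ξ (Real.pi / 2)|) ^ 2 := by
      simp only [mul_pow C, sq_abs]
      exact hcP.mul_left _
    refine summable_sq_of_le s1 s2 (fun l => norm_nonneg _) fun l => ?_
    obtain ⟨hz, hp⟩ := hbd l
    rw [hb]
    simp only [frequencyCoeff]
    rw [norm_mul, norm_neg, Complex.norm_I, one_mul]
    refine (norm_sub_le _ _).trans ?_
    rw [norm_mul, norm_mul, RCLike.norm_conj, RCLike.norm_conj, Complex.norm_real,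
      Complex.norm_real, Real.norm_eq_abs, Real.norm_eq_abs]
    refine add_le_add ?_ ?_
    · have hl : (0 : ℝ) ≤ l * (l + 1) := by positivity
      have hfr : freq l ≤ l * (l + 1) + 1 := by
        rw [freq]
        have : (0 : ℝ) ≤ l := Nat.cast_nonneg l
        nlinarith
      rw [abs_mul, abs_of_nonneg hl]
      calc |coeffQ l ξ (Real.pi / 2)| * ‖modeMomentum ρ ν l (Real.pi / 2)‖
          ≤ |coeffQ l ξ (Real.pi / 2)| * (C * (l * (l + 1) + 1)) := by
            gcongr
            exact hp.trans (by gcongr)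
        _ = _ := by ring
    · rw [mul_comm]
      gcongr
  refine ⟨⟨b, hmem⟩, fun t ht l => ?_⟩
  change (coeffQ l ξ t : ℂ) = b l * mode ρ ν l t + conj (b l * mode ρ ν l t)
  rw [← hconst l t ht]
  exact eq_of_frequencyCoeff hρ l ht _ _

/-! ### Diagonal Bogoliubov transformations of the one-particle space -/

theorem memlp_bogoliubov {α β : ℕ → ℂ} {M : ℝ} (hα : ∀ l, ‖α l‖ ≤ M) (hβ : ∀ l, ‖β l‖ ≤ M)
    (b : OneParticle) : Memℓp (fun l => α l * b l + β l * conj (b l)) 2 ∧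
      ∀ b' : OneParticle, (∀ l, b' l = α l * b l + β l * conj (b l)) → ‖b'‖ ≤ 2 * M * ‖b‖ := by
  have hM : 0 ≤ M := (norm_nonneg _).trans (hα 0)
  have hb := memlp_two_iff.mp (lp.memℓp b)
  have hle : ∀ l, ‖α l * b l + β l * conj (b l)‖ ≤ 2 * M * ‖b l‖ := fun l => by
    refine (norm_add_le _ _).trans ?_
    rw [norm_mul, norm_mul, RCLike.norm_conj]
    have e1 : ‖α l‖ * ‖b l‖ ≤ M * ‖b l‖ := by gcongr; exact hα l
    have e2 : ‖β l‖ * ‖b l‖ ≤ M * ‖b l‖ := by gcongr; exact hβ l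
    linarith
  have hle2 : ∀ l, ‖α l * b l + β l * conj (b l)‖ ^ 2 ≤ (2 * M) ^ 2 * ‖b l‖ ^ 2 := fun l => by
    rw [← mul_pow]
    exact pow_le_pow_left₀ (norm_nonneg _) (hle l) 2
  have hs : Summable fun l => ‖α l * b l + β l * conj (b l)‖ ^ 2 :=
    (hb.mul_left ((2 * M) ^ 2)).of_nonneg_of_le (fun l => by positivity) hle2
  refine ⟨memlp_two_iff.mpr hs, fun b' hb' => ?_⟩
  have hnorm : ∀ f : OneParticle, ‖f‖ ^ 2 = ∑' l, ‖f l‖ ^ 2 := fun f => by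
    have := lp.norm_rpow_eq_tsum (p := 2) (by norm_num) f
    simpa using this
  refine (sq_le_sq₀ (norm_nonneg _) (by positivity)).mp ?_
  rw [mul_pow, hnorm, hnorm, ← tsum_mul_left]
  simp only [hb']
  exact hs.tsum_le_tsum hle2 (hb.mul_left _)

theorem bogoliubov_bounded {ρ ν : ℕ → ℝ} (hρ : ∀ l, 0 < ρ l) {t₁ t₀ : ℝ}
    (h1 : t₁ ∈ Set.Ioo 0 Real.pi) (h0 : t₀ ∈ Set.Ioo 0 Real.pi)
    (hβ : Summable fun l => ‖bogoliubovBeta ρ ν l t₁ t₀‖ ^ 2) :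
    ∃ M, 0 < M ∧ (∀ l, ‖bogoliubovAlpha ρ ν l t₁ t₀‖ ≤ M) ∧
      ∀ l, ‖bogoliubovBeta ρ ν l t₁ t₀‖ ≤ M := by
  have hle : ∀ l, ‖bogoliubovAlpha ρ ν l t₁ t₀‖ ^ 2
      ≤ 1 + ∑' l, ‖bogoliubovBeta ρ ν l t₁ t₀‖ ^ 2 := fun l => by
    rw [normSq_bogoliubovAlpha hρ l h1 h0]
    gcongr
    exact hβ.le_tsum l fun _ _ => by positivity
  have hα : ∀ l, ‖bogoliubovAlpha ρ ν l t₁ t₀‖ ≤ Real.sqrt (1 + ∑' l, ‖bogoliubovBeta ρ ν l t₁ t₀‖ ^ 2) :=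
    fun l => Real.le_sqrt_of_sq_le (hle l)
  have hT : 0 ≤ ∑' l, ‖bogoliubovBeta ρ ν l t₁ t₀‖ ^ 2 := tsum_nonneg fun _ => by positivity
  refine ⟨_, Real.sqrt_pos.mpr (by positivity), hα, fun l => le_trans ?_ (hα l)⟩
  refine (sq_le_sq₀ (norm_nonneg _) (norm_nonneg _)).mp ?_
  rw [normSq_bogoliubovAlpha hρ l h1 h0]
  linarith

theorem evolutionContinuous {ρ ν : ℕ → ℝ} (hρ : ∀ l, 0 < ρ l) {t₁ t₀ : ℝ}
    (h1 : t₁ ∈ Set.Ioo 0 Real.pi) (h0 : t₀ ∈ Set.Ioo 0 Real.pi)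
    (hβ : Summable fun l => ‖bogoliubovBeta ρ ν l t₁ t₀‖ ^ 2) : EvolutionContinuous ρ ν t₁ t₀ := by
  obtain ⟨M, hM, hα, hβ'⟩ := bogoliubov_bounded hρ h1 h0 hβ
  exact ⟨2 * M, by positivity, fun ξ ξ' h b b' hb hb' =>
    (memlp_bogoliubov hα hβ' b).2 b' (h.frequency_eq hρ h1 h0 hb hb')⟩

/-! ### Solutions with a single mode -/

/-- The solution with positive-frequency part `c z_k Y_k`. -/
def modeField (ρ ν : ℕ → ℝ) (k : ℕ) (c : ℂ) (t θ : ℝ) : ℝ :=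
  2 * (c * mode ρ ν k t).re * sphericalY k θ

theorem contDiffOn_legendreQ (n : ℕ) : ContDiffOn ℝ ∞ (legendreQ n) (Set.Ioo (-1) 1) := by
  have hlog : ContDiffOn ℝ ∞ (fun x : ℝ => (1 / 2) * Real.log ((1 + x) / (1 - x)))
      (Set.Ioo (-1) 1) := by
    refine contDiffOn_const.mul (ContDiffOn.log (ContDiffOn.div (by fun_prop) (by fun_prop)
      fun x hx => ?_) fun x hx => ?_)
    · linarith [hx.2]
    · have := hx.1
      have := hx.2
      exact (div_pos (by linarith) (by linarith)).ne'
  induction n using Nat.twoStepInduction with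
  | zero => exact hlog
  | one => exact (contDiffOn_id.mul hlog).sub contDiffOn_const
  | more n h0 h1 =>
    have : legendreQ (n + 2) = fun x =>
        ((2 * n + 3) * x * legendreQ (n + 1) x - (n + 1) * legendreQ n x) / (n + 2) :=
      funext fun x => bonnet_legendreQ n x
    rw [this]
    exact (((contDiffOn_const.mul contDiffOn_id).mul h1).sub (contDiffOn_const.mul h0)).div_const _

theorem contDiffOn_mode (ρ ν : ℕ → ℝ) (k : ℕ) :
    ContDiffOn ℝ ∞ (mode ρ ν k) (Set.Ioo 0 Real.pi) := by
  have hs : ContDiffOn ℝ ∞ (fun t => ((Real.sqrt (Real.sin t) : ℝ) : ℂ)) (Set.Ioo 0 Real.pi) :=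
    Complex.ofRealCLM.contDiff.comp_contDiffOn contDiffOn_sqrt_sin
  have hP : ContDiffOn ℝ ∞ (fun t => ((legendreP k (Real.cos t) / Real.sqrt 2 : ℝ) : ℂ))
      (Set.Ioo 0 Real.pi) :=
    Complex.ofRealCLM.contDiff.comp_contDiffOn
      (((contDiff_legendreP k).comp Real.contDiff_cos).contDiffOn.div_const _)
  have hQ : ContDiffOn ℝ ∞ (fun t => ((legendreQ k (Real.cos t) / Real.sqrt 2 : ℝ) : ℂ))
      (Set.Ioo 0 Real.pi) :=
    Complex.ofRealCLM.contDiff.comp_contDiffOn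
      (((contDiffOn_legendreQ k).comp Real.contDiff_cos.contDiffOn
        fun _ ht => cos_mem_Ioo ht).div_const _)
  exact hs.mul ((contDiffOn_const.mul hP).add (contDiffOn_const.mul hQ))

theorem abs_coord_div_norm_le (x : EuclideanSpace ℝ (Fin 3)) (i : Fin 3) : |x i / ‖x‖| ≤ 1 := by
  rw [abs_div, abs_norm]
  exact div_le_one_of_le₀ (EuclideanSpace.norm_eq x ▸ by
    rw [← Real.sqrt_sq_eq_abs]
    exact Real.sqrt_le_sqrt (by
      simpa using Finset.single_le_sum (f := fun i => x i ^ 2) (fun _ _ => by positivity)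
        (Finset.mem_univ i))) (norm_nonneg _)

theorem isSmoothField_modeField (ρ ν : ℕ → ℝ) (k : ℕ) (c : ℂ) :
    IsSmoothField (modeField ρ ν k c) := by
  have h1 : ContDiffOn ℝ ∞ (fun t => 2 * (c * mode ρ ν k t).re) (Set.Ioo 0 Real.pi) :=
    contDiffOn_const.mul (Complex.reCLM.contDiff.comp_contDiffOn
      (contDiffOn_const.mul (contDiffOn_mode ρ ν k)))
  have h2 : ContDiffOn ℝ ∞ (fun q : ℝ × EuclideanSpace ℝ (Fin 3) => q.2 2 / ‖q.2‖)
      (Set.Ioo 0 Real.pi ×ˢ {x | x ≠ 0}) := by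
    refine ContDiffOn.div ?_ (contDiffOn_snd.norm ℝ fun q hq => hq.2)
      fun q hq => norm_ne_zero_iff.mpr hq.2
    exact ((EuclideanSpace.proj (𝕜 := ℝ) (2 : Fin 3)).contDiff.comp contDiff_snd).contDiffOn
  refine ((h1.comp contDiffOn_fst fun q hq => hq.1).mul ((contDiffOn_const (c :=
    Real.sqrt ((2 * k + 1) / (4 * Real.pi)))).mul
    ((contDiff_legendreP k).comp_contDiffOn h2))).congr fun q hq => ?_
  have := abs_le.mp (abs_coord_div_norm_le q.2 2)
  simp only [modeField, sphericalY, Function.comp]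
  rw [Real.cos_arccos this.1 this.2]

theorem sphereLaplacian_sphericalY (k : ℕ) {θ : ℝ} (hθ : θ ∈ Set.Ioo 0 Real.pi) :
    sphereLaplacian (sphericalY k) θ = -(k * (k + 1)) * sphericalY k θ := by
  have hs := (Real.sin_pos_of_mem_Ioo hθ).ne'
  have hev : (fun η => Real.sin η * deriv (sphericalY k) η) =ᶠ[nhds θ] sphericalFlux k := by
    filter_upwards [isOpen_Ioo.mem_nhds hθ] with η hη
    rw [(hasDerivAt_sphericalY k hη).deriv]
    have := (Real.sin_pos_of_mem_Ioo hη).ne'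
    field_simp
  rw [sphereLaplacian, hev.deriv_eq, (hasDerivAt_sphericalFlux k hθ).deriv]
  field_simp

theorem hasDerivAt_re_mode {f : ℝ → ℂ} {f' : ℂ} {t : ℝ} (hf : HasDerivAt f f' t) (c : ℂ) :
    HasDerivAt (fun t => 2 * (c * f t).re) (2 * (c * f').re) t :=
  ((Complex.reCLM.hasFDerivAt.comp_hasDerivAt t (hf.const_mul c))).const_mul 2

theorem hasDerivAt_modeField (ρ ν : ℕ → ℝ) (k : ℕ) (c : ℂ) (θ : ℝ) {t : ℝ}
    (ht : t ∈ Set.Ioo 0 Real.pi) : HasDerivAt (fun τ => modeField ρ ν k c τ θ)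
      (2 * (c * velocity (mode ρ ν k) (modeMomentum ρ ν k) t).re * sphericalY k θ) t :=
  (hasDerivAt_re_mode (mode_system ρ ν k t ht).1 c).mul_const _

theorem momentum_modeField (ρ ν : ℕ → ℝ) (k : ℕ) (c : ℂ) (θ : ℝ) {t : ℝ}
    (ht : t ∈ Set.Ioo 0 Real.pi) : momentum (modeField ρ ν k c) t θ
      = 2 * (c * modeMomentum ρ ν k t).re * sphericalY k θ := by
  rw [momentum, (hasDerivAt_modeField ρ ν k c θ ht).deriv, modeField, velocity]
  have : c * (modeMomentum ρ ν k t + 1 / 2 * (Real.cot t : ℂ) * mode ρ ν k t)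
      = c * modeMomentum ρ ν k t + ((1 / 2 * Real.cot t : ℝ) : ℂ) * (c * mode ρ ν k t) := by
    push_cast; ring
  rw [this, Complex.add_re, Complex.re_ofReal_mul]
  ring

theorem isStaticSolution_modeField (ρ ν : ℕ → ℝ) (k : ℕ) (c : ℂ) :
    IsStaticSolution (modeField ρ ν k c) := by
  refine ⟨isSmoothField_modeField ρ ν k c, fun t ht θ hθ => ?_⟩
  have hev : (deriv fun τ => modeField ρ ν k c τ θ) =ᶠ[nhds t] fun τ =>
      2 * (c * velocity (mode ρ ν k) (modeMomentum ρ ν k) τ).re * sphericalY k θ := by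
    filter_upwards [isOpen_Ioo.mem_nhds ht] with τ hτ
    exact (hasDerivAt_modeField ρ ν k c θ hτ).deriv
  have hd := (hasDerivAt_re_mode ((mode_system ρ ν k).hasDerivAt_velocity ht) c).mul_const
    (sphericalY k θ)
  rw [hev.deriv_eq, hd.deriv]
  have hL : sphereLaplacian (modeField ρ ν k c t) θ
      = 2 * (c * mode ρ ν k t).re * (-(k * (k + 1)) * sphericalY k θ) := by
    rw [← sphereLaplacian_sphericalY k hθ, ← sphereLaplacian_const_mul]
    rfl
  rw [hL, modeField, mul_left_comm c, ← Complex.ofReal_neg, Complex.re_ofReal_mul, freq]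
  ring

theorem coeffQ_modeField (ρ ν : ℕ → ℝ) (k : ℕ) (c : ℂ) (l : ℕ) (t : ℝ) :
    coeffQ l (modeField ρ ν k c) t = if l = k then 2 * (c * mode ρ ν k t).re else 0 := by
  have : coeffQ l (modeField ρ ν k c) t
      = sphereIntegral fun θ => 2 * (c * mode ρ ν k t).re * (sphericalY l θ * sphericalY k θ) := by
    refine sphereIntegral_congr fun θ _ => ?_
    rw [modeField]; ring
  rw [this, sphereIntegral_const_mul, sphereIntegral_sphericalY]
  split_ifs <;> ring

theorem isPositiveFrequencyPart_modeField (ρ ν : ℕ → ℝ) (k : ℕ) (c : ℂ) :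
    IsPositiveFrequencyPart ρ ν (modeField ρ ν k c) (lp.single 2 k c) := by
  intro t _ l
  change (coeffQ l (modeField ρ ν k c) t : ℂ) = _
  rw [coeffQ_modeField, lp.single_apply]
  split_ifs with h
  · subst h
    rw [Pi.single_eq_same, Complex.add_conj]
  · rw [Pi.single_eq_of_ne h]; simp

/-- Single-mode solutions realize every multiple of a basis vector of the one-particle space, so a
condition on fields becomes one on Weyl operators. -/
theorem isEvolved_modeField {ρ ν : ℕ → ℝ} (hρ : ∀ l, 0 < ρ l) (k : ℕ) (c : ℂ) {t₁ t₀ : ℝ}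
    (h1 : t₁ ∈ Set.Ioo 0 Real.pi) (h0 : t₀ ∈ Set.Ioo 0 Real.pi) :
    IsEvolved t₁ t₀ (modeField ρ ν k c) (modeField ρ ν k
      (bogoliubovAlpha ρ ν k t₁ t₀ * c + bogoliubovBeta ρ ν k t₁ t₀ * conj c)) := by
  have hW := mode_wronskian ρ ν k (hρ k) h0
  have re_eq : ∀ u v : ℂ, u + conj u = v + conj v → u.re = v.re := fun u v h => by
    rw [Complex.add_conj, Complex.add_conj] at h
    have := Complex.ofReal_inj.mp h
    linarith
  refine ⟨isStaticSolution_modeField _ _ _ _, isStaticSolution_modeField _ _ _ _,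
    fun θ _ => ?_, fun θ _ => ?_⟩
  · rw [modeField, modeField]
    congr 2
    refine re_eq _ _ ?_
    simp only [bogoliubovAlpha, bogoliubovBeta, map_add, map_mul, map_sub, map_neg, Complex.conj_I,
      Complex.conj_conj]
    linear_combination (-Complex.I * (c * mode ρ ν k t₁ + conj c * conj (mode ρ ν k t₁))) * hW
      - (c * mode ρ ν k t₁ + conj c * conj (mode ρ ν k t₁)) * Complex.I_sq
  · rw [momentum_modeField _ _ _ _ _ h0, momentum_modeField _ _ _ _ _ h1]
    congr 2
    refine re_eq _ _ ?_
    simp only [bogoliubovAlpha, bogoliubovBeta, map_add, map_mul, map_sub, map_neg, Complex.conj_I,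
      Complex.conj_conj]
    linear_combination (-Complex.I * (c * modeMomentum ρ ν k t₁
        + conj c * conj (modeMomentum ρ ν k t₁))) * hW
      - (c * modeMomentum ρ ν k t₁ + conj c * conj (modeMomentum ρ ν k t₁)) * Complex.I_sq

/-! ### The Weyl relations -/

theorem norm_expVec_sq (g : OneParticle) : ‖expVec g‖ ^ 2 = Real.exp (‖g‖ ^ 2) := by
  have h := inner_expVec g g
  rw [inner_self_eq_norm_sq_to_K, inner_self_eq_norm_sq_to_K] at h
  have h' : ((‖expVec g‖ ^ 2 : ℝ) : ℂ) = ((Real.exp (‖g‖ ^ 2) : ℝ) : ℂ) := by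
    push_cast
    exact h
  exact_mod_cast h'

theorem expVec_ext {A B : FockSpace →L[ℂ] FockSpace} (h : ∀ g, A (expVec g) = B (expVec g)) :
    A = B := by
  refine DFunLike.coe_injective (denseRange_expSpan.equalizer A.continuous B.continuous ?_)
  funext x
  simp only [Function.comp, expSpan, Finsupp.linearCombination_apply, Finsupp.sum, map_sum,
    map_smul, h]

theorem weyl_expSpan (f : OneParticle) (x : OneParticle →₀ ℂ) :
    weyl f (expSpan x) = weylOnExp f x :=
  LinearMap.extendOfNorm_eq denseRange_expSpan ⟨1, fun x => by rw [one_mul, norm_weylOnExp]⟩ x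

theorem norm_weyl (f : OneParticle) (ψ : FockSpace) : ‖weyl f ψ‖ = ‖ψ‖ := by
  refine denseRange_expSpan.induction_on ψ
    (isClosed_eq (weyl f).continuous.norm continuous_norm) fun x => ?_
  rw [weyl_expSpan, norm_weylOnExp]

theorem inner_weyl_weyl (f : OneParticle) (ψ φ : FockSpace) :
    inner ℂ (weyl f ψ) (weyl f φ) = inner ℂ ψ φ :=
  LinearIsometry.inner_map_map ⟨(weyl f).toLinearMap, norm_weyl f⟩ ψ φ

theorem weyl_weyl (f g : OneParticle) (ψ : FockSpace) : weyl f (weyl g ψ)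
    = Complex.exp ((inner ℂ g f - inner ℂ f g) / 2) • weyl (f + g) ψ := by
  have : (weyl f).comp (weyl g)
      = Complex.exp ((inner ℂ g f - inner ℂ f g) / 2) • weyl (f + g) := by
    refine expVec_ext fun h => ?_
    simp only [ContinuousLinearMap.comp_apply, _root_.smul_apply, weyl_expVec,
      map_smul, smul_smul, ← Complex.exp_add, add_assoc]
    congr 2
    have hn : ((‖f + g‖ ^ 2 : ℝ) : ℂ)
        = ((‖f‖ ^ 2 : ℝ) : ℂ) + ((‖g‖ ^ 2 : ℝ) : ℂ) + inner ℂ f g + inner ℂ g f := by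
      have e : ∀ u : OneParticle, ((‖u‖ ^ 2 : ℝ) : ℂ) = inner ℂ u u := fun u => by
        rw [inner_self_eq_norm_sq_to_K]; push_cast; rfl
      simp only [e, inner_add_left, inner_add_right]
      ring
    simp only [Complex.ofReal_div, hn, inner_add_left, inner_add_right]
    push_cast
    ring
  exact congrArg (fun A : FockSpace →L[ℂ] FockSpace => A ψ) this

theorem weyl_zero (ψ : FockSpace) : weyl 0 ψ = ψ := by
  have : weyl 0 = ContinuousLinearMap.id ℂ FockSpace := by
    refine expVec_ext fun h => ?_
    rw [weyl_expVec]; simp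
  rw [this]; rfl

theorem weyl_neg_weyl (f : OneParticle) (ψ : FockSpace) : weyl (-f) (weyl f ψ) = ψ := by
  rw [weyl_weyl]; simp [weyl_zero]

theorem inner_weyl_left (f : OneParticle) (ψ φ : FockSpace) :
    inner ℂ (weyl f ψ) φ = inner ℂ ψ (weyl (-f) φ) := by
  rw [← inner_weyl_weyl (-f), weyl_neg_weyl]

/-- The vacuum. -/
def vacuum : FockSpace := expVec 0

theorem norm_vacuum : ‖vacuum‖ = 1 := by
  have := norm_expVec_sq 0
  rw [norm_zero, zero_pow two_ne_zero, Real.exp_zero] at this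
  exact (pow_eq_one_iff_of_nonneg (norm_nonneg _) two_ne_zero).mp this

theorem weyl_vacuum (f : OneParticle) :
    weyl f vacuum = Complex.exp (-((‖f‖ ^ 2 / 2 : ℝ) : ℂ)) • expVec f := by
  rw [vacuum, weyl_expVec]; simp

theorem expVec_eq_weyl (f : OneParticle) :
    expVec f = Complex.exp ((‖f‖ ^ 2 / 2 : ℝ) : ℂ) • weyl f vacuum := by
  rw [weyl_vacuum, smul_smul, ← Complex.exp_add]; simp

/-! ### Holomorphic families of vectors -/

/-- A locally bounded family that is holomorphic against exponential vectors is holomorphic against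
every vector. -/
theorem differentiable_inner_of_expVec {v : ℂ → FockSpace} {M : ℂ → ℝ} (hM : Continuous M)
    (hv : ∀ z, ‖v z‖ ≤ M z) (h : ∀ g, Differentiable ℂ fun z => inner ℂ (expVec g) (v z))
    (χ : FockSpace) : Differentiable ℂ fun z => inner ℂ χ (v z) := by
  have hspan : ∀ x, Differentiable ℂ fun z => inner ℂ (expSpan x) (v z) := fun x => by
    simp only [expSpan, Finsupp.linearCombination_apply, Finsupp.sum, sum_inner, inner_smul_left]
    exact Differentiable.fun_sum fun g _ => (h g).const_mul _
  obtain ⟨u, hu, hlim⟩ := mem_closure_iff_seq_limit.mp (denseRange_expSpan χ)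
  choose x hx using hu
  rw [← differentiableOn_univ]
  -- Approximating χ by combinations of exponential vectors, Cauchy–Schwarz and the bound M give
  -- uniform convergence on compact sets, which preserves holomorphy.
  refine TendstoLocallyUniformlyOn.differentiableOn (φ := Filter.atTop)
    (F := fun n z => inner ℂ (u n) (v z)) ?_ (Filter.Eventually.of_forall fun n => by
      rw [← hx n]; exact (hspan (x n)).differentiableOn) isOpen_univ
  rw [tendstoLocallyUniformlyOn_iff_forall_isCompact isOpen_univ]
  intro K _ hK
  obtain ⟨B, hB⟩ := hK.exists_bound_of_continuousOn hM.continuousOn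
  rw [Metric.tendstoUniformlyOn_iff]
  intro ε hε
  have h1 : Filter.Tendsto (fun n => ‖u n - χ‖ * (|B| + 1)) Filter.atTop (nhds 0) := by
    have := (tendsto_iff_norm_sub_tendsto_zero.mp hlim).mul_const (|B| + 1)
    simpa using this
  filter_upwards [h1.eventually_lt_const hε] with n hn z hz
  rw [dist_comm, dist_eq_norm, ← inner_sub_left]
  refine (norm_inner_le_norm _ _).trans_lt (lt_of_le_of_lt ?_ hn)
  gcongr
  have h2 := hB z hz
  rw [Real.norm_eq_abs] at h2
  linarith [hv z, le_abs_self (M z), le_abs_self B]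

/-- A holomorphic function whose conjugate is holomorphic in a Bogoliubov transformed variable is
constant. -/
theorem eq_of_differentiable_bogoliubov {F G : ℂ → ℂ} (hF : Differentiable ℂ F)
    (hG : Differentiable ℂ G) {a b : ℂ} (ha : a ≠ 0) (h : ∀ z, F (a * z + b * conj z) = conj (G z))
    (z : ℂ) : G z = G 0 := by
  refine is_const_of_deriv_eq_zero hG (fun w => ?_) z 0
  have line : ∀ v : ℂ, HasDerivAt (fun t : ℝ => w + t * v) v 0 := fun v => by
    have := ((hasDerivAt_id (0 : ℝ)).ofReal_comp.mul_const v).const_add w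
    simpa using this
  have e : ∀ v : ℂ, w + ((0 : ℝ) : ℂ) * v = w := fun v => by simp
  -- The hypothesis is differentiated along the real line through w in direction v. The directions 1
  -- and i combine to 2 i a F' = 0, and a ≠ 0 then gives F' = 0 and G' = 0.
  have key : ∀ v : ℂ, (a * v + b * conj v) * deriv F (a * w + b * conj w) = conj (v * deriv G w) :=
    fun v => by
    have line' : HasDerivAt (fun t : ℝ => a * (w + t * v) + b * conj (w + t * v))
        (a * v + b * conj v) 0 :=
      ((line v).const_mul a).add ((line v).star.const_mul b)
    have h1 : HasDerivAt (fun t : ℝ => F (a * (w + t * v) + b * conj (w + t * v)))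
        (deriv F (a * w + b * conj w) * (a * v + b * conj v)) 0 :=
      HasDerivAt.comp (h₂ := F) (0 : ℝ) (by rw [e]; exact (hF _).hasDerivAt) line'
    have h2 : HasDerivAt (fun t : ℝ => G (w + t * v)) (deriv G w * v) 0 :=
      HasDerivAt.comp (h₂ := G) (0 : ℝ) (by rw [e]; exact (hG w).hasDerivAt) (line v)
    have h3 : HasDerivAt (fun t : ℝ => F (a * (w + t * v) + b * conj (w + t * v)))
        (conj (deriv G w * v)) 0 := by
      have h4 := h2.star
      simp only [h]
      exact h4
    rw [mul_comm, h1.unique h3, mul_comm]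
  have h1 := key 1
  have hI := key Complex.I
  rw [map_one, one_mul] at h1
  rw [map_mul, Complex.conj_I, ← h1] at hI
  have h2 : (2 * Complex.I * a) * deriv F (a * w + b * conj w) = 0 := by linear_combination hI
  rw [mul_eq_zero, or_iff_right (by simpa using ha)] at h2
  rw [h2, mul_zero] at h1
  simpa using h1.symm

/-- A holomorphic function whose conjugate is holomorphic is constant. -/
theorem eq_of_differentiable_conj {F G : ℂ → ℂ} (hF : Differentiable ℂ F)
    (hG : Differentiable ℂ G) (h : ∀ z, F z = conj (G z)) (z : ℂ) : F z = F 0 := by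
  have := eq_of_differentiable_bogoliubov hF hG (b := 0) one_ne_zero (fun z => by simpa using h z) z
  rw [h, h, this]

theorem differentiable_inner_expVec (g f : OneParticle) (χ : FockSpace) :
    Differentiable ℂ fun z : ℂ => inner ℂ χ (expVec (g + z • f)) := by
  refine differentiable_inner_of_expVec (M := fun z => Real.sqrt (Real.exp (‖g + z • f‖ ^ 2)))
    (by fun_prop) (fun z => ?_) (fun k => ?_) χ
  · rw [← norm_expVec_sq, Real.sqrt_sq (norm_nonneg _)]
  · simp only [inner_expVec, inner_add_right, inner_smul_right]
    fun_prop

/-! ### Irreducibility of the Weyl operators -/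

/-- Moving a Weyl operator through X shows that ⟨XΩ, exp(C(zf))Ω⟩ is both holomorphic and
antiholomorphic in z, hence constant. So XΩ is a multiple of the vacuum Ω, and X is a multiple of
the identity since Weyl operators applied to Ω span a dense subspace. -/
theorem eq_smul_of_commute_weyl {X : FockSpace →L[ℂ] FockSpace}
    (hX : ∀ f ψ, X (weyl f ψ) = weyl f (X ψ)) : ∃ κ : ℂ, ∀ ψ, X ψ = κ • ψ := by
  have hvac : ∀ f, inner ℂ (X vacuum) (expVec f) = inner ℂ (X vacuum) vacuum := by
    intro f
    have hG := differentiable_inner_expVec 0 f (X vacuum)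
    have hF : Differentiable ℂ fun z : ℂ =>
        inner ℂ (X.adjoint vacuum) (expVec (0 + z • (-f))) :=
      differentiable_inner_expVec 0 (-f) _
    have h := eq_of_differentiable_conj hG hF (fun z => ?_) 1
    · simpa [vacuum] using h
    · have e1 : inner ℂ (X.adjoint vacuum) (expVec (0 + z • (-f)))
          = inner ℂ vacuum (X (expVec (-(z • f)))) := by
        rw [ContinuousLinearMap.adjoint_inner_left]; simp
      have e2 : inner ℂ (expVec (z • f)) (X vacuum) = inner ℂ vacuum (X (expVec (-(z • f)))) := by
        rw [expVec_eq_weyl (z • f), expVec_eq_weyl (-(z • f)), map_smul, inner_smul_left,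
          inner_smul_right, inner_weyl_left, ← hX, norm_neg, ← Complex.exp_conj,
          Complex.conj_ofReal]
      rw [e1, ← e2, zero_add, inner_conj_symm]
  refine ⟨inner ℂ vacuum (X vacuum), fun ψ => ?_⟩
  have hΩ : X vacuum = (inner ℂ vacuum (X vacuum) : ℂ) • vacuum := by
    rw [← sub_eq_zero]
    refine eq_zero_of_inner_expVec fun f => ?_
    rw [inner_sub_left, hvac, inner_smul_left, inner_conj_symm, vacuum, inner_expVec]
    simp
  have : X = (inner ℂ vacuum (X vacuum) : ℂ) • ContinuousLinearMap.id ℂ FockSpace := by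
    refine expVec_ext fun f => ?_
    rw [expVec_eq_weyl, map_smul, hX]
    nth_rewrite 1 [hΩ]
    rw [map_smul]
    simp only [_root_.smul_apply, ContinuousLinearMap.id_apply]
    rw [smul_comm]
  exact congrArg (fun A : FockSpace →L[ℂ] FockSpace => A ψ) this

/-! ### Intertwiners from a vacuum functional -/

/-- A vector with the characteristic function of a transformed vacuum generates an intertwiner. -/
theorem exists_isometry_of_characteristic {T S : OneParticle → OneParticle} {ψ₀ : FockSpace}
    (hTS : ∀ b, T (S b) = b) (hST : ∀ b, S (T b) = b)
    (hadd : ∀ b c, T (b + c) = T b + T c)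
    (hsymp : ∀ b c, inner ℂ (T b) (T c) - inner ℂ (T c) (T b) = inner ℂ b c - inner ℂ c b)
    (hψ : ∀ b, inner ℂ ψ₀ (weyl b ψ₀) = Complex.exp (-((‖T b‖ ^ 2 / 2 : ℝ) : ℂ))) :
    ∃ U : FockSpace →L[ℂ] FockSpace, (∀ ψ, ‖U ψ‖ = ‖ψ‖) ∧
      ∀ b ψ, U (weyl (T b) ψ) = weyl b (U ψ) := by
  -- The map sends W(g)Ω to W(S g)ψ₀; the exponential factor converts W(g)Ω into an exponential
  -- vector.
  let L : (OneParticle →₀ ℂ) →ₗ[ℂ] FockSpace := Finsupp.linearCombination ℂ fun g =>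
    Complex.exp ((‖g‖ ^ 2 / 2 : ℝ) : ℂ) • weyl (S g) ψ₀
  have hsq : ∀ u : OneParticle, ((‖u‖ ^ 2 : ℝ) : ℂ) = inner ℂ u u := fun u => by
    rw [inner_self_eq_norm_sq_to_K]; push_cast; rfl
  have hSsub : ∀ g g', T (-S g + S g') = -g + g' := fun g g' => by
    have h0 : T 0 = 0 := by have := hadd 0 0; simpa using this
    have hneg : T (-S g) = -g := by
      have := hadd (S g) (-S g)
      rw [add_neg_cancel, h0, hTS] at this
      exact (neg_eq_of_add_eq_zero_right this.symm).symm
    rw [hadd, hneg, hTS]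
  -- The Weyl relations reduce the Gram matrix of the images to the characteristic function of ψ₀.
  -- It coincides with the Gram matrix of the vectors W(g)Ω, so the map is isometric.
  have hcorr : ∀ g g', inner ℂ (weyl (S g) ψ₀) (weyl (S g') ψ₀)
      = Complex.exp (inner ℂ g g' - ((‖g‖ ^ 2 / 2 : ℝ) : ℂ) - ((‖g'‖ ^ 2 / 2 : ℝ) : ℂ)) := by
    intro g g'
    rw [inner_weyl_left, weyl_weyl, inner_smul_right, hψ, hSsub, ← Complex.exp_add]
    congr 1
    have h1 := hsymp (S g) (S g')
    rw [hTS, hTS] at h1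
    simp only [Complex.ofReal_div, hsq, inner_add_left, inner_add_right, inner_neg_left,
      inner_neg_right]
    push_cast
    linear_combination (-1 / 2 : ℂ) * h1
  have hnorm : ∀ x, ‖L x‖ = ‖expSpan x‖ := fun x => by
    have h : inner ℂ (L x) (L x) = inner ℂ (expSpan x) (expSpan x) := by
      simp only [L, expSpan, Finsupp.linearCombination_apply, Finsupp.sum_inner,
        Finsupp.inner_sum]
      simp only [Finsupp.sum]
      refine Finset.sum_congr rfl fun g _ => Finset.sum_congr rfl fun g' _ => ?_
      simp only [inner_smul_left, inner_smul_right, inner_expVec, hcorr, ← Complex.exp_conj,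
        Complex.conj_ofReal]
      have key : Complex.exp ((‖g'‖ ^ 2 / 2 : ℝ) : ℂ) * (Complex.exp ((‖g‖ ^ 2 / 2 : ℝ) : ℂ)
          * Complex.exp (inner ℂ g' g - ((‖g'‖ ^ 2 / 2 : ℝ) : ℂ) - ((‖g‖ ^ 2 / 2 : ℝ) : ℂ)))
          = Complex.exp (inner ℂ g' g) := by
        rw [← Complex.exp_add, ← Complex.exp_add]; congr 1; ring
      linear_combination conj (x g') * x g * key
    rw [inner_self_eq_norm_sq_to_K, inner_self_eq_norm_sq_to_K] at h
    exact (sq_eq_sq₀ (norm_nonneg _) (norm_nonneg _)).mp (by exact_mod_cast h)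
  have hU : ∀ x, L.extendOfNorm expSpan (expSpan x) = L x := fun x =>
    LinearMap.extendOfNorm_eq denseRange_expSpan ⟨1, fun x => by rw [one_mul, hnorm]⟩ x
  have hUe : ∀ g, L.extendOfNorm expSpan (expVec g)
      = Complex.exp ((‖g‖ ^ 2 / 2 : ℝ) : ℂ) • weyl (S g) ψ₀ := fun g => by
    simpa [L, expSpan] using hU (Finsupp.single g 1)
  refine ⟨L.extendOfNorm expSpan, fun ψ => ?_, fun b ψ => ?_⟩
  · refine denseRange_expSpan.induction_on ψ
      (isClosed_eq (ContinuousLinearMap.continuous _).norm continuous_norm) fun x => ?_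
    rw [hU, hnorm]
  · have : (L.extendOfNorm expSpan).comp (weyl (T b))
        = (weyl b).comp (L.extendOfNorm expSpan) := by
      refine expVec_ext fun g => ?_
      have hS : S (T b + g) = b + S g := by
        rw [← hST (b + S g), hadd, hTS]
      simp only [ContinuousLinearMap.comp_apply, weyl_expVec, map_smul, hUe, hS, weyl_weyl,
        smul_smul, ← Complex.exp_add]
      congr 2
      have h1 := hsymp (S g) b
      rw [hTS] at h1
      simp only [Complex.ofReal_div, hsq, inner_add_left, inner_add_right]
      push_cast
      linear_combination (1 / 2 : ℂ) * h1
    exact congrArg (fun A : FockSpace →L[ℂ] FockSpace => A ψ) this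

/-! ### Infinite products over occupation numbers -/

theorem finsupp_prod_box {R : Type*} [CommSemiring R] {c : ℕ → ℕ → R} (h0 : ∀ l, c l 0 = 1)
    (s : Finset ℕ) (N : ℕ) :
    ∑ n ∈ s.finsupp (fun _ => Finset.range N), n.prod c
      = ∏ l ∈ s, ∑ k ∈ Finset.range N, c l k := by
  rw [Finset.prod_sum, Finset.finsupp, Finset.sum_map]
  refine Finset.sum_congr (by congr!) fun p _ => ?_
  change (Finsupp.indicator s p).prod _ = _
  rw [Finsupp.prod_of_support_subset (s := s) _ (Finsupp.support_indicator_subset _ _) _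
    (by simp [h0]), ← Finset.prod_attach]
  refine Finset.prod_congr rfl fun x _ => ?_
  simp

theorem summable_norm_finsupp_prod {c : ℕ → ℕ → ℂ} (h0 : ∀ l, c l 0 = 1) {C : ℝ}
    (hC : ∀ (s : Finset ℕ) (N : ℕ), ∏ l ∈ s, ∑ k ∈ Finset.range N, ‖c l k‖ ≤ C) :
    Summable fun n : ℕ →₀ ℕ => ‖n.prod c‖ := by
  have key : ∀ n : ℕ →₀ ℕ, ‖n.prod c‖ = n.prod fun l k => ‖c l k‖ := fun n => by
    simp [Finsupp.prod, norm_prod]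
  simp only [key]
  have hpos : ∀ n : ℕ →₀ ℕ, 0 ≤ n.prod fun l k => ‖c l k‖ := fun n =>
    Finset.prod_nonneg fun _ _ => norm_nonneg _
  refine summable_of_sum_le (c := C) hpos fun u => ?_
  let s := u.biUnion Finsupp.support
  let N := (u.sup fun n => n.support.sup n) + 1
  have hsub : u ⊆ s.finsupp (fun _ => Finset.range N) := fun n hn => by
    rw [Finset.mem_finsupp_iff]
    refine ⟨Finset.subset_biUnion_of_mem Finsupp.support hn, fun i _ => ?_⟩
    rw [Finset.mem_range, Nat.lt_succ_iff]
    by_cases hi : i ∈ n.support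
    · exact (Finset.le_sup (f := n) hi).trans
        (Finset.le_sup (f := fun n : ℕ →₀ ℕ => n.support.sup n) hn)
    · simp [Finsupp.notMem_support_iff.mp hi]
  refine (Finset.sum_le_sum_of_subset_of_nonneg hsub fun n _ _ => hpos n).trans ?_
  rw [finsupp_prod_box fun l => by rw [h0, norm_one]]
  exact hC s N

/-- On a box of finitely many modes and bounded occupation numbers the sum factorizes. The bound on
the occupation numbers and the set of modes are then removed by dominated convergence. The condition
c l 0 = 1 lets unoccupied modes contribute nothing. -/
theorem tsum_finsupp_prod {c : ℕ → ℕ → ℂ} (h0 : ∀ l, c l 0 = 1)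
    (hs : Summable fun n : ℕ →₀ ℕ => ‖n.prod c‖) {S : ℕ → ℂ} (hS : ∀ l, HasSum (c l) (S l))
    {P : ℂ} (hP : Filter.Tendsto (fun s : Finset ℕ => ∏ l ∈ s, S l) Filter.atTop (nhds P)) :
    ∑' n : ℕ →₀ ℕ, n.prod c = P := by
  classical
  have hfin : ∀ s : Finset ℕ,
      ∑' n : ℕ →₀ ℕ, (if n.support ⊆ s then n.prod c else 0) = ∏ l ∈ s, S l := fun s => by
    have h1 : Filter.Tendsto (fun N : ℕ => ∑' n : ℕ →₀ ℕ,
        (if n ∈ s.finsupp (fun _ => Finset.range N) then n.prod c else 0)) Filter.atTop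
        (nhds (∑' n : ℕ →₀ ℕ, (if n.support ⊆ s then n.prod c else 0))) := by
      refine tendsto_tsum_of_dominated_convergence hs (fun n => ?_)
        (Filter.Eventually.of_forall fun N n => ?_)
      · refine tendsto_const_nhds.congr' ?_
        filter_upwards [Filter.eventually_gt_atTop (s.sup n)] with N hN
        have : n ∈ s.finsupp (fun _ => Finset.range N) ↔ n.support ⊆ s := by
          rw [Finset.mem_finsupp_iff]
          exact ⟨fun h => h.1, fun h => ⟨h, fun i hi =>
            Finset.mem_range.mpr ((Finset.le_sup (f := n) hi).trans_lt hN)⟩⟩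
        simp only [this]
      · split_ifs
        · exact le_rfl
        · simp only [norm_zero]; exact norm_nonneg _
    have h2 : Filter.Tendsto (fun N : ℕ => ∏ l ∈ s, ∑ k ∈ Finset.range N, c l k)
        Filter.atTop (nhds (∏ l ∈ s, S l)) :=
      tendsto_finsetProd _ fun l _ => (hS l).tendsto_sum_nat
    refine tendsto_nhds_unique h1 (h2.congr fun N => ?_)
    rw [← finsupp_prod_box h0, tsum_eq_sum (s := s.finsupp (fun _ => Finset.range N))
      (fun n hn => if_neg hn)]
    exact Finset.sum_congr rfl fun n hn => (if_pos hn).symm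
  have h3 : Filter.Tendsto (fun s : Finset ℕ => ∑' n : ℕ →₀ ℕ,
      (if n.support ⊆ s then n.prod c else 0)) Filter.atTop
      (nhds (∑' n : ℕ →₀ ℕ, n.prod c)) := by
    refine tendsto_tsum_of_dominated_convergence hs (fun n => ?_)
      (Filter.Eventually.of_forall fun N n => ?_)
    · refine tendsto_const_nhds.congr' ?_
      filter_upwards [Filter.eventually_ge_atTop n.support] with s hs
      rw [if_pos hs]
    · split_ifs
      · exact le_rfl
      · simp only [norm_zero]; exact norm_nonneg _
  simp only [hfin] at h3
  exact tendsto_nhds_unique h3 hP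

/-! ### Squeezed vacua -/

/-- The occupation number amplitudes of `exp(s a†² / 2) |0⟩`. -/
def squeezeCoeff (s : ℂ) (k : ℕ) : ℂ :=
  if Even k then s ^ (k / 2) * (Real.sqrt (k.factorial : ℝ) : ℂ) / (2 ^ (k / 2) * (k / 2).factorial)
  else 0

theorem squeezeCoeff_zero (s : ℂ) : squeezeCoeff s 0 = 1 := by simp [squeezeCoeff]

theorem squeezeCoeff_even (s : ℂ) (j : ℕ) : squeezeCoeff s (2 * j)
    = s ^ j * (Real.sqrt ((2 * j).factorial : ℝ) : ℂ) / (2 ^ j * j.factorial) := by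
  simp [squeezeCoeff]

theorem squeezeCoeff_odd (s : ℂ) (j : ℕ) : squeezeCoeff s (2 * j + 1) = 0 :=
  if_neg (by simp)

/-- The central binomial coefficient is at most 4^j. The geometric majorant exceeds the exact norm
(1 - ‖s‖²)^(-1/2), but products of (1 - ‖s‖²)⁻¹ converge under the same condition. -/
theorem normSq_squeezeCoeff_le (s : ℂ) (j : ℕ) :
    ‖squeezeCoeff s (2 * j)‖ ^ 2 ≤ (‖s‖ ^ 2) ^ j := by
  have h1 : ((2 * j).factorial : ℝ) ≤ (2 ^ j * j.factorial) ^ 2 := by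
    have h2 : (2 * j).choose j ≤ 2 ^ (2 * j) := Nat.choose_le_two_pow _ _
    have h3 : (2 * j).choose j * j.factorial * j.factorial = (2 * j).factorial := by
      have := Nat.choose_mul_factorial_mul_factorial (show j ≤ 2 * j by omega)
      rwa [show 2 * j - j = j by omega] at this
    have h4 : (2 * j).factorial ≤ (2 ^ j * j.factorial) ^ 2 := by
      rw [← h3]
      calc _ ≤ 2 ^ (2 * j) * j.factorial * j.factorial := by gcongr
        _ = _ := by ring
    exact_mod_cast h4
  rw [squeezeCoeff_even, norm_div, norm_mul, norm_pow, norm_mul, norm_pow, Complex.norm_real,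
    Complex.norm_natCast, Complex.norm_ofNat, Real.norm_of_nonneg (Real.sqrt_nonneg _), div_pow,
    mul_pow, Real.sq_sqrt (by positivity), div_le_iff₀ (by positivity), ← pow_mul, ← pow_mul,
    mul_comm j 2]
  gcongr

theorem sum_normSq_squeezeCoeff_le {s : ℂ} (hs : ‖s‖ < 1) (N : ℕ) :
    ∑ k ∈ Finset.range N, ‖squeezeCoeff s k‖ ^ 2 ≤ (1 - ‖s‖ ^ 2)⁻¹ := by
  have hg := hasSum_geometric_of_lt_one (sq_nonneg ‖s‖) (by nlinarith [norm_nonneg s])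
  have he : Summable fun j => ‖squeezeCoeff s (2 * j)‖ ^ 2 :=
    hg.summable.of_nonneg_of_le (fun _ => by positivity) (normSq_squeezeCoeff_le s)
  have ho : HasSum (fun j => ‖squeezeCoeff s (2 * j + 1)‖ ^ 2) 0 := by
    simp only [squeezeCoeff_odd, norm_zero, ne_eq, OfNat.ofNat_ne_zero, not_false_eq_true,
      zero_pow]
    exact hasSum_zero
  have h := HasSum.even_add_odd (f := fun k => ‖squeezeCoeff s k‖ ^ 2) he.hasSum ho
  refine (sum_le_hasSum _ (fun _ _ => by positivity) h).trans ?_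
  rw [add_zero]
  exact hasSum_le (normSq_squeezeCoeff_le s) he.hasSum hg

theorem hasSum_squeezeCoeff (s w : ℂ) :
    HasSum (fun k => w ^ k / (Real.sqrt (k.factorial : ℝ) : ℂ) * squeezeCoeff s k)
      (Complex.exp (s * w ^ 2 / 2)) := by
  have he : HasSum (fun j => w ^ (2 * j) / (Real.sqrt ((2 * j).factorial : ℝ) : ℂ)
      * squeezeCoeff s (2 * j)) (Complex.exp (s * w ^ 2 / 2)) := by
    have := NormedSpace.expSeries_div_hasSum_exp (s * w ^ 2 / 2)
    rw [← Complex.exp_eq_exp_ℂ] at this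
    refine this.congr_fun fun j => ?_
    have h1 : (Real.sqrt ((2 * j).factorial : ℝ) : ℂ) ≠ 0 := by
      simpa using Nat.factorial_ne_zero _
    rw [squeezeCoeff_even, div_pow, mul_pow, ← pow_mul]
    field_simp
  have ho : HasSum (fun j => w ^ (2 * j + 1) / (Real.sqrt ((2 * j + 1).factorial : ℝ) : ℂ)
      * squeezeCoeff s (2 * j + 1)) 0 := by
    simp only [squeezeCoeff_odd, mul_zero]
    exact hasSum_zero
  have h := HasSum.even_add_odd
    (f := fun k => w ^ k / (Real.sqrt (k.factorial : ℝ) : ℂ) * squeezeCoeff s k) he ho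
  rwa [add_zero] at h

theorem summable_mul_conj_sq {s : ℕ → ℂ} (hs : ∀ l, ‖s l‖ ≤ 1) (g : OneParticle) :
    Summable fun l => s l * conj (g l) ^ 2 := by
  refine Summable.of_norm_bounded (summable_conj_mul g g) fun l => ?_
  rw [norm_mul, norm_pow, norm_mul, RCLike.norm_conj, sq]
  exact mul_le_of_le_one_left (by positivity) (hs l)

/-- The vector `exp(½ ∑ s_l a_l†²) |0⟩`. -/
theorem exists_squeezedVacuum {s : ℕ → ℂ} (hs : ∀ l, ‖s l‖ < 1) {C : ℝ}
    (hC : ∀ t : Finset ℕ, ∏ l ∈ t, (1 - ‖s l‖ ^ 2)⁻¹ ≤ C) :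
    ∃ ψ : FockSpace, ∀ g, inner ℂ (expVec g) ψ
      = Complex.exp ((∑' l, s l * conj (g l) ^ 2) / 2) := by
  have hmem : Memℓp (fun n : ℕ →₀ ℕ => n.prod fun l k => squeezeCoeff (s l) k) 2 := by
    rw [memℓp_gen_iff (by norm_num)]
    refine (summable_norm_finsupp_prod (c := fun l k => squeezeCoeff (s l) k ^ 2)
      (fun l => by simp [squeezeCoeff_zero]) (C := C) fun t N => ?_).congr fun n => ?_
    · refine (Finset.prod_le_prod (fun _ _ => Finset.sum_nonneg fun _ _ => norm_nonneg _)
        fun l _ => ?_).trans (hC t)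
      simp only [norm_pow]
      exact sum_normSq_squeezeCoeff_le (hs l) N
    · simp [Finsupp.prod, Finset.prod_pow]
  let ψ : FockSpace := ⟨_, hmem⟩
  refine ⟨ψ, fun g => ?_⟩
  have h1 : ∀ n : ℕ →₀ ℕ, inner ℂ (expVec g n) (ψ n)
      = n.prod fun l k => conj (g l) ^ k / (Real.sqrt (k.factorial : ℝ) : ℂ)
          * squeezeCoeff (s l) k := fun n => by
    change inner ℂ (expVec g n) (n.prod fun l k => squeezeCoeff (s l) k) = _
    rw [expVec_apply, RCLike.inner_apply, mul_comm]
    simp only [Finsupp.prod, map_prod, ← Finset.prod_mul_distrib, map_div₀, map_pow,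
      Complex.conj_ofReal]
  have hsum := lp.summable_inner (𝕜 := ℂ) (expVec g) ψ
  rw [lp.inner_eq_tsum]
  simp only [h1] at hsum ⊢
  refine tsum_finsupp_prod (fun l => by simp [squeezeCoeff_zero]) hsum.norm
    (fun l => hasSum_squeezeCoeff (s l) (conj (g l))) ?_
  simp only [← Complex.exp_sum]
  refine (Complex.continuous_exp.tendsto _).comp ?_
  have := (summable_mul_conj_sq (fun l => (hs l).le) g).hasSum.div_const 2
  exact this

/-! ### Implementability of diagonal Bogoliubov transformations -/

theorem exists_bogoliubovMap {α β : ℕ → ℂ} {M : ℝ} (hα : ∀ l, ‖α l‖ ≤ M) (hβ : ∀ l, ‖β l‖ ≤ M) :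
    ∃ T : OneParticle → OneParticle, ∀ b l, T b l = α l * b l + β l * conj (b l) :=
  ⟨fun b => ⟨_, (memlp_bogoliubov hα hβ b).1⟩, fun _ _ => rfl⟩

theorem inner_expVec_weyl (g b : OneParticle) (ψ : FockSpace) :
    inner ℂ (expVec g) (weyl b ψ)
      = Complex.exp (-((‖b‖ ^ 2 / 2 : ℝ) : ℂ) + inner ℂ g b) * inner ℂ (expVec (g - b)) ψ := by
  rw [← inner_conj_symm, inner_weyl_left, weyl_expVec, inner_smul_right, map_mul, inner_conj_symm,
    ← Complex.exp_conj, norm_neg, neg_add_eq_sub]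
  simp [map_ofNat]

theorem ofReal_normSq {E : Type*} [NormedAddCommGroup E] [InnerProductSpace ℂ E] (u : E) :
    ((‖u‖ ^ 2 : ℝ) : ℂ) = inner ℂ u u := by
  rw [inner_self_eq_norm_sq_to_K]; push_cast; rfl

theorem hasSum_conj_mul (f g : OneParticle) :
    HasSum (fun l => conj (f l) * g l) (inner ℂ f g) := by
  refine (lp.hasSum_inner (𝕜 := ℂ) f g).congr_fun fun l => ?_
  rw [RCLike.inner_apply, mul_comm]

section Bogoliubov

variable {α β : ℕ → ℂ} (hαβ : ∀ l, ‖α l‖ ^ 2 = 1 + ‖β l‖ ^ 2)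
include hαβ

theorem bogoliubov_relation (l : ℕ) : α l * conj (α l) = 1 + β l * conj (β l) := by
  rw [Complex.mul_conj, Complex.mul_conj, Complex.normSq_eq_norm_sq, Complex.normSq_eq_norm_sq,
    hαβ]
  push_cast
  ring

theorem bogoliubov_alpha_ne_zero (l : ℕ) : α l ≠ 0 := fun h => by
  have := hαβ l
  rw [h, norm_zero] at this
  nlinarith [sq_nonneg ‖β l‖]

theorem normSq_bogoliubov_ratio (l : ℕ) : 1 - ‖-β l / α l‖ ^ 2 = (1 + ‖β l‖ ^ 2)⁻¹ := by
  rw [norm_div, norm_neg, div_pow, hαβ]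
  have : 1 + ‖β l‖ ^ 2 ≠ 0 := by positivity
  field_simp
  ring

theorem norm_bogoliubov_ratio_lt (l : ℕ) : ‖-β l / α l‖ < 1 := by
  have h := normSq_bogoliubov_ratio hαβ l
  have : 0 < (1 + ‖β l‖ ^ 2)⁻¹ := by positivity
  nlinarith [norm_nonneg (-β l / α l)]

theorem one_le_norm_bogoliubov_alpha (l : ℕ) : 1 ≤ ‖α l‖ := by
  nlinarith [hαβ l, sq_nonneg ‖β l‖, norm_nonneg (α l)]

variable {T S : OneParticle → OneParticle} (hT : ∀ b l, T b l = α l * b l + β l * conj (b l))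
  (hS : ∀ b l, S b l = conj (α l) * b l - β l * conj (b l))

include hT hS in
theorem bogoliubov_right_inv (b : OneParticle) : T (S b) = b := by
  ext l
  rw [hT, hS]
  simp only [map_sub, map_mul, Complex.conj_conj]
  linear_combination b l * bogoliubov_relation hαβ l

include hT hS in
theorem bogoliubov_left_inv (b : OneParticle) : S (T b) = b := by
  ext l
  rw [hS, hT]
  simp only [map_add, map_mul, Complex.conj_conj]
  linear_combination b l * bogoliubov_relation hαβ l

include hT in
theorem bogoliubov_symplectic (b c : OneParticle) :
    inner ℂ (T b) (T c) - inner ℂ (T c) (T b) = (inner ℂ b c - inner ℂ c b : ℂ) := by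
  refine ((hasSum_conj_mul (T b) (T c)).sub (hasSum_conj_mul (T c) (T b))).unique
    (((hasSum_conj_mul b c).sub (hasSum_conj_mul c b)).congr_fun fun l => ?_)
  simp only [hT, map_add, map_mul, Complex.conj_conj]
  linear_combination (conj (b l) * c l - conj (c l) * b l) * bogoliubov_relation hαβ l

include hS in
/-- A displaced squeezed vacuum against an exponential vector. -/
theorem inner_expVec_weyl_squeezed {ψ : FockSpace}
    (hψ : ∀ g, inner ℂ (expVec g) ψ = Complex.exp ((∑' l, -β l / α l * conj (g l) ^ 2) / 2))
    (g f : OneParticle) :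
    Complex.exp ((‖f‖ ^ 2 / 2 : ℝ) : ℂ) * inner ℂ (expVec g) (weyl (S f) ψ)
      = Complex.exp ((∑' l, conj (β l) / α l * f l ^ 2) / 2 + ∑' l, conj (g l) * f l / α l
          + (∑' l, -β l / α l * conj (g l) ^ 2) / 2) := by
  have hr : ∀ l, ‖-β l / α l‖ ≤ 1 := fun l => (norm_bogoliubov_ratio_lt hαβ l).le
  have s1 := summable_mul_conj_sq hr (g - S f)
  have s2 := summable_mul_conj_sq hr g
  have s3 : Summable fun l => conj (β l) / α l * f l ^ 2 := by
    refine Summable.of_norm_bounded (summable_conj_mul f f) fun l => ?_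
    have := hr l
    rw [norm_div, norm_neg] at this
    rw [norm_mul, norm_div, norm_pow, norm_mul, RCLike.norm_conj, RCLike.norm_conj, sq]
    exact mul_le_of_le_one_left (by positivity) this
  have s4 : Summable fun l => conj (g l) * f l / α l := by
    refine Summable.of_norm_bounded (summable_conj_mul g f) fun l => ?_
    rw [norm_div]
    exact div_le_self (norm_nonneg _) (one_le_norm_bogoliubov_alpha hαβ l)
  rw [inner_expVec_weyl, hψ, ← Complex.exp_add, ← Complex.exp_add]
  congr 1
  -- The exponents are compared mode by mode. With the ratio -β/α all terms containing conj f cancel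
  -- by |α|² = 1 + |β|², so the result is holomorphic in f.
  have e1 := ((((hasSum_conj_mul f f).div_const 2).sub
    ((hasSum_conj_mul (S f) (S f)).div_const 2)).add (hasSum_conj_mul g (S f))).add
      (s1.hasSum.div_const 2)
  have e2 := ((s3.hasSum.div_const 2).add s4.hasSum).add (s2.hasSum.div_const 2)
  have := e1.unique (e2.congr_fun fun l => ?_)
  · rw [Complex.ofReal_div, Complex.ofReal_div, ofReal_normSq, ofReal_normSq]
    push_cast
    linear_combination this
  · have h0 := bogoliubov_alpha_ne_zero hαβ l
    have hl : (g - S f : OneParticle) l = g l - S f l := rfl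
    simp only [hl, hS, map_sub, map_mul, Complex.conj_conj]
    have h1 := bogoliubov_relation hαβ l
    field_simp
    linear_combination (conj (g l) * f l * 2 - f l * (α l * conj (f l) - conj (β l) * f l)) * h1

include hT hS in
theorem exists_bogoliubov_isometry (hβ : Summable fun l => ‖β l‖ ^ 2) :
    ∃ U : FockSpace →L[ℂ] FockSpace, (∀ ψ, ‖U ψ‖ = ‖ψ‖) ∧
      ∀ b ψ, U (weyl (T b) ψ) = weyl b (U ψ) := by
  obtain ⟨ψ, hψ⟩ := exists_squeezedVacuum (norm_bogoliubov_ratio_lt hαβ)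
    (C := Real.exp (∑' l, ‖β l‖ ^ 2)) fun t => by
      simp only [normSq_bogoliubov_ratio hαβ, inv_inv]
      calc ∏ l ∈ t, (1 + ‖β l‖ ^ 2) ≤ ∏ l ∈ t, Real.exp (‖β l‖ ^ 2) :=
            Finset.prod_le_prod (fun _ _ => by positivity) fun l _ => by
              rw [add_comm]; exact Real.add_one_le_exp _
        _ = Real.exp (∑ l ∈ t, ‖β l‖ ^ 2) := (Real.exp_sum _ _).symm
        _ ≤ _ := Real.exp_le_exp.mpr (hβ.sum_le_tsum _ fun _ _ => by positivity)
  have hψ0 : ψ ≠ 0 := fun h => by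
    have := hψ 0
    rw [h, inner_zero_right] at this
    exact Complex.exp_ne_zero _ this.symm
  have hSneg : ∀ f, S (-f) = -S f := fun f => by
    ext l
    have h1 : (-S f : OneParticle) l = -(S f l) := rfl
    have h2 : (-f : OneParticle) l = -(f l) := rfl
    rw [h1, hS, hS, h2, map_neg]
    ring
  have hS0 : S 0 = 0 := by
    ext l
    rw [hS]; simp
  -- Along z • f this is entire in z, and since the adjoint of W(b) is W(-b), replacing z by -z
  -- conjugates it. It is therefore constant and equal to its value at 0; for f = T b this is the
  -- characteristic function of the transformed vacuum up to ‖ψ‖².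
  have hconst : ∀ f, Complex.exp ((‖f‖ ^ 2 / 2 : ℝ) : ℂ) * inner ℂ ψ (weyl (S f) ψ)
      = inner ℂ ψ ψ := fun f => by
    have hF : Differentiable ℂ fun z : ℂ =>
        inner ℂ ψ (Complex.exp ((‖z • f‖ ^ 2 / 2 : ℝ) : ℂ) • weyl (S (z • f)) ψ) := by
      refine differentiable_inner_of_expVec
        (M := fun z => Real.exp (‖z • f‖ ^ 2 / 2) * ‖ψ‖) (by fun_prop) (fun z => ?_) (fun g => ?_) ψ
      · rw [norm_smul, norm_weyl, Complex.norm_exp, Complex.ofReal_re]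
      · simp only [inner_smul_right, inner_expVec_weyl_squeezed hαβ hS hψ]
        have hc : ∀ (z : ℂ) l, (z • f : OneParticle) l = z * f l := fun _ _ => rfl
        have h1 : ∀ z : ℂ, ∑' l, conj (β l) / α l * (z • f : OneParticle) l ^ 2
            = z ^ 2 * ∑' l, conj (β l) / α l * f l ^ 2 := fun z => by
          rw [← tsum_mul_left]
          exact tsum_congr fun l => by rw [hc]; ring
        have h2 : ∀ z : ℂ, ∑' l, conj (g l) * (z • f : OneParticle) l / α l
            = z * ∑' l, conj (g l) * f l / α l := fun z => by
          rw [← tsum_mul_left]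
          exact tsum_congr fun l => by rw [hc]; ring
        simp only [h1, h2]
        fun_prop
    have h := eq_of_differentiable_conj hF (hF.comp (differentiable_id.neg)) (fun z => ?_) 1
    · simpa [hS0, weyl_zero] using h
    · simp only [Function.comp, id, Pi.neg_apply, neg_smul, norm_neg, hSneg, inner_smul_right,
        map_mul, ← Complex.exp_conj, Complex.conj_ofReal]
      rw [inner_conj_symm, inner_weyl_left, neg_neg]
  refine exists_isometry_of_characteristic (S := S) (ψ₀ := ((‖ψ‖⁻¹ : ℝ) : ℂ) • ψ)
    (bogoliubov_right_inv hαβ hT hS)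
    (bogoliubov_left_inv hαβ hT hS) (fun b c => ?_) (bogoliubov_symplectic hαβ hT) fun b => ?_
  · ext l
    have h1 : (T b + T c : OneParticle) l = T b l + T c l := rfl
    have h2 : (b + c : OneParticle) l = b l + c l := rfl
    rw [h1, hT, hT, hT, h2, map_add]
    ring
  · have h := hconst (T b)
    rw [bogoliubov_left_inv hαβ hT hS, ← ofReal_normSq ψ] at h
    rw [map_smul, inner_smul_left, inner_smul_right, Complex.conj_ofReal, Complex.exp_neg]
    have hn : ((‖ψ‖ : ℝ) : ℂ) ≠ 0 := by simpa using hψ0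
    have he := Complex.exp_ne_zero ((‖T b‖ ^ 2 / 2 : ℝ) : ℂ)
    push_cast at h he ⊢
    field_simp
    linear_combination h

include hT in
-- Surjectivity comes from the inverse transformation, with coefficients conj α and -β. Its isometry
-- V makes U V commute with every Weyl operator, so U V is a nonzero scalar.
theorem exists_bogoliubov_unitary (hβ : Summable fun l => ‖β l‖ ^ 2) {M : ℝ}
    (hαM : ∀ l, ‖α l‖ ≤ M) (hβM : ∀ l, ‖β l‖ ≤ M) :
    ∃ U : FockSpace ≃ₗᵢ[ℂ] FockSpace, ∀ b ψ, U.symm (weyl b (U ψ)) = weyl (T b) ψ := by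
  obtain ⟨S, hS⟩ := exists_bogoliubovMap (α := fun l => conj (α l)) (β := fun l => -β l) (M := M)
    (fun l => by rw [RCLike.norm_conj]; exact hαM l) (fun l => by rw [norm_neg]; exact hβM l)
  have hS' : ∀ b l, S b l = conj (α l) * b l - β l * conj (b l) := fun b l => by
    rw [hS]; ring
  obtain ⟨U, hU, hUW⟩ := exists_bogoliubov_isometry hαβ hT hS' hβ
  obtain ⟨V, hV, hVW⟩ := exists_bogoliubov_isometry (α := fun l => conj (α l))
    (β := fun l => -β l) (T := S) (S := T)
    (fun l => by simpa using hαβ l) hS (fun b l => by rw [hT, Complex.conj_conj]; ring)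
    (by simpa using hβ)
  obtain ⟨κ, hκ⟩ := eq_smul_of_commute_weyl (X := U.comp V) fun f ψ => by
    rw [ContinuousLinearMap.comp_apply, ← bogoliubov_left_inv hαβ hT hS' f, hVW, hUW,
      bogoliubov_left_inv hαβ hT hS' f]
    rfl
  have hκ0 : κ ≠ 0 := fun h => by
    have h1 := congrArg norm (hκ vacuum)
    rw [ContinuousLinearMap.comp_apply, hU, hV, norm_vacuum, h, zero_smul, norm_zero] at h1
    exact one_ne_zero h1
  let U' : FockSpace →ₗᵢ[ℂ] FockSpace := ⟨U.toLinearMap, hU⟩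
  have hsurj : Function.Surjective U' := fun y =>
    ⟨V (κ⁻¹ • y), by
      have := hκ (κ⁻¹ • y)
      rwa [smul_smul, mul_inv_cancel₀ hκ0, one_smul] at this⟩
  refine ⟨LinearIsometryEquiv.ofSurjective U' hsurj, fun b ψ => ?_⟩
  rw [LinearIsometryEquiv.symm_apply_eq]
  exact (hUW b ψ).symm

end Bogoliubov

theorem evolutionImplementable_of_summable {ρ ν : ℕ → ℝ} (hρ : ∀ l, 0 < ρ l) {t₁ t₀ : ℝ}
    (h1 : t₁ ∈ Set.Ioo 0 Real.pi) (h0 : t₀ ∈ Set.Ioo 0 Real.pi)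
    (hβ : Summable fun l => ‖bogoliubovBeta ρ ν l t₁ t₀‖ ^ 2) :
    EvolutionImplementable ρ ν t₁ t₀ := by
  obtain ⟨M, -, hαM, hβM⟩ := bogoliubov_bounded hρ h1 h0 hβ
  obtain ⟨T, hT⟩ := exists_bogoliubovMap hαM hβM
  obtain ⟨U, hU⟩ := exists_bogoliubov_unitary
    (fun l => normSq_bogoliubovAlpha hρ l h1 h0) hT hβ hαM hβM
  refine ⟨U, fun ξ ξ' h b b' hb hb' ψ => ?_⟩
  have : b' = T b := by
    ext l
    rw [h.frequency_eq hρ h1 h0 hb hb', hT]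
  rw [hU, this]

/-! ### Implementability forces square summability -/

theorem continuous_expVec : Continuous expVec := by
  refine continuous_iff_continuousAt.mpr fun g => ?_
  rw [ContinuousAt, tendsto_iff_norm_sub_tendsto_zero]
  have h : ∀ f, ‖expVec f - expVec g‖ = Real.sqrt (Real.exp (‖f‖ ^ 2)
      - 2 * (Complex.exp (inner ℂ f g)).re + Real.exp (‖g‖ ^ 2)) := fun f => by
    rw [← norm_expVec_sq, ← norm_expVec_sq, ← inner_expVec, ← RCLike.re_eq_complex_re,
      ← norm_sub_sq, Real.sqrt_sq (norm_nonneg _)]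
  have hc : Continuous fun f : OneParticle => Real.sqrt (Real.exp (‖f‖ ^ 2)
      - 2 * (Complex.exp (inner ℂ f g)).re + Real.exp (‖g‖ ^ 2)) := by fun_prop
  have := hc.tendsto g
  simp only [← h, sub_self, norm_zero] at this
  exact this

theorem coeff_eq_of_hasSum {c d : ℕ → ℂ} {f : ℂ → ℂ}
    (hc : ∀ z, HasSum (fun k => z ^ k * c k) (f z)) (hd : ∀ z, HasSum (fun k => z ^ k * d k) (f z))
    (k : ℕ) : c k = d k := by
  have hp : HasFPowerSeriesAt (0 : ℂ → ℂ)
      (FormalMultilinearSeries.ofScalars ℂ fun k => c k - d k) 0 := by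
    rw [hasFPowerSeriesAt_iff]
    refine Filter.Eventually.of_forall fun z => ?_
    simp only [FormalMultilinearSeries.coeff_ofScalars]
    have := (hc z).sub (hd z)
    rw [sub_self] at this
    refine this.congr_fun fun k => ?_
    rw [smul_eq_mul, mul_sub]
  have := congrArg (fun p => p.coeff k) hp.eq_zero
  simp only [FormalMultilinearSeries.coeff_ofScalars] at this
  exact sub_eq_zero.mp this

theorem hasSum_inner_expVec_single (l : ℕ) (x : ℂ) (ψ : FockSpace) :
    HasSum (fun k : ℕ => conj x ^ k * (ψ (Finsupp.single l k) / (Real.sqrt (k.factorial : ℝ) : ℂ)))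
      (inner ℂ (expVec (lp.single 2 l x)) ψ) := by
  classical
  have h := lp.hasSum_inner (𝕜 := ℂ) (expVec (lp.single 2 l x)) ψ
  rw [← (Finsupp.single_injective l).hasSum_iff] at h
  · refine h.congr_fun fun k => ?_
    have : expVec (lp.single 2 l x) (Finsupp.single l k)
        = x ^ k / (Real.sqrt (k.factorial : ℝ) : ℂ) := by
      rw [expVec_apply, Finsupp.prod_single_index (by simp), lp.single_apply_self]
    rw [Function.comp, this, RCLike.inner_apply, map_div₀, map_pow, Complex.conj_ofReal]
    ring
  · intro n hn
    have : expVec (lp.single 2 l x) n = 0 := by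
      have hsup : ∃ i ∈ n.support, i ≠ l := by
        by_contra! hc
        refine hn ⟨n l, ?_⟩
        ext i
        by_cases hi : i = l
        · rw [hi, Finsupp.single_eq_same]
        · rw [Finsupp.single_eq_of_ne hi]
          by_contra h0
          exact hi (hc i (Finsupp.mem_support_iff.mpr fun h => h0 h.symm))
      obtain ⟨i, hi, hil⟩ := hsup
      rw [expVec_apply, Finsupp.prod]
      refine Finset.prod_eq_zero hi ?_
      rw [lp.single_apply_ne _ _ _ hil, zero_pow (Finsupp.mem_support_iff.mp hi), zero_div]
    rw [this, inner_zero_left]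

/-- The transformed vacuum is a squeezed state in every intertwined mode. -/
theorem inner_expVec_sub_of_intertwine {a b : ℂ} (hab : a * conj a = 1 + b * conj b) (ha : a ≠ 0)
    {l : ℕ} {U : FockSpace ≃ₗᵢ[ℂ] FockSpace}
    (hU : ∀ c φ, weyl (lp.single 2 l c) (U φ) = U (weyl (lp.single 2 l (a * c + b * conj c)) φ))
    (g : OneParticle) (c : ℂ) :
    inner ℂ (expVec (g - lp.single 2 l c)) (U vacuum)
      = inner ℂ (expVec g) (U vacuum)
        * Complex.exp (-b / a / 2 * (conj (g l - c) ^ 2 - conj (g l) ^ 2)) := by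
  have hsingle : ∀ z : ℂ, (lp.single 2 l z : OneParticle) = z • lp.single 2 l (1 : ℂ) := fun z => by
    rw [← lp.single_smul, smul_eq_mul, mul_one]
  have hnorm : ∀ z : ℂ, ((‖(lp.single 2 l z : OneParticle)‖ ^ 2 / 2 : ℝ) : ℂ) = z * conj z / 2 :=
    fun z => by
    rw [lp.norm_single (by norm_num), Complex.mul_conj, Complex.normSq_eq_norm_sq]
    push_cast
    ring
  -- The Gaussian factors are chosen so that the intertwining relation reads F(a c + b conj c) =
  -- conj (G c) with F and G entire. G is then constant, which makes the overlap explicit in c.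
  have hF : Differentiable ℂ fun w : ℂ => inner ℂ (U.symm (expVec g)) (expVec (lp.single 2 l w))
      * Complex.exp (-(conj b / a / 2 * w ^ 2 + conj (g l) * w / a - b / a / 2 * conj (g l) ^ 2)) := by
    have h1 := differentiable_inner_expVec 0 (lp.single 2 l (1 : ℂ)) (U.symm (expVec g))
    simp only [zero_add, ← hsingle] at h1
    exact h1.mul (by fun_prop)
  have hG : Differentiable ℂ fun c : ℂ => inner ℂ (U vacuum) (expVec (g - lp.single 2 l c))
      * Complex.exp (conj (b / a) / 2 * (g l - c) ^ 2) := by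
    have h1 := differentiable_inner_expVec g (-lp.single 2 l (1 : ℂ)) (U vacuum)
    simp only [smul_neg, ← hsingle, ← sub_eq_add_neg] at h1
    exact h1.mul (by fun_prop)
  have h := congrArg conj (eq_of_differentiable_bogoliubov hF hG ha (b := b) (fun z => ?_) c)
  · simp only [map_mul, inner_conj_symm, ← Complex.exp_conj, map_div₀, map_pow, Complex.conj_conj,
      map_ofNat, lp.single_zero, sub_zero] at h
    have e1 := Complex.exp_ne_zero (b / a / 2 * conj (g l - c) ^ 2)
    rw [← mul_left_inj' e1, h, mul_assoc, ← Complex.exp_add]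
    congr 2
    ring
  · have h1 := inner_expVec_weyl g (lp.single 2 l z) (U vacuum)
    rw [hU, weyl_vacuum, map_smul, inner_smul_right, ← U.symm.inner_map_map,
      U.symm_apply_apply, hnorm, hnorm, lp.inner_single_right, RCLike.inner_apply] at h1
    simp only [map_mul, inner_conj_symm, ← Complex.exp_conj, map_div₀, map_pow, Complex.conj_conj,
      map_ofNat]
    have h2 := congrArg (fun x => Complex.exp ((a * z + b * conj z) * conj (a * z + b * conj z) / 2)
      * x * Complex.exp (-(conj b / a / 2 * (a * z + b * conj z) ^ 2
        + conj (g l) * (a * z + b * conj z) / a - b / a / 2 * conj (g l) ^ 2))) h1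
    simp only [← mul_assoc, ← Complex.exp_add] at h2
    rw [add_neg_cancel, Complex.exp_zero, one_mul] at h2
    rw [h2, mul_right_comm, ← Complex.exp_add, mul_comm]
    congr 2
    simp only [map_add, map_sub, map_mul, Complex.conj_conj]
    field_simp
    linear_combination (conj z * (a * z + b * conj z)) * hab

/-- The states with two particles in mode l are distinct basis vectors, and the components of U Ω
along them are ⟨Ω, U Ω⟩ times -β/α times 1/√2. Their squares are summable, so β/α tends to 0 and
‖β‖² ≤ 2 ‖β/α‖² eventually. -/
theorem summable_of_intertwine {α β : ℕ → ℂ} (hαβ : ∀ l, ‖α l‖ ^ 2 = 1 + ‖β l‖ ^ 2)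
    {U : FockSpace ≃ₗᵢ[ℂ] FockSpace}
    (hU : ∀ l c φ, weyl (lp.single 2 l c) (U φ)
      = U (weyl (lp.single 2 l (α l * c + β l * conj c)) φ)) :
    Summable fun l => ‖β l‖ ^ 2 := by
  have key := fun l => inner_expVec_sub_of_intertwine (bogoliubov_relation hαβ l)
    (bogoliubov_alpha_ne_zero hαβ l) (hU l)
  set ψ := U vacuum with hψ
  have hψ0 : ψ ≠ 0 := fun h => by
    have := U.norm_map vacuum
    rw [← hψ, h, norm_zero, norm_vacuum] at this
    exact zero_ne_one this
  -- If the vacuum component vanished, adding modes one at a time would make the overlap with every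
  -- finitely supported exponential vector vanish. By continuity all overlaps would vanish, and so
  -- would ψ.
  have hΨ : inner ℂ (expVec 0) ψ ≠ 0 := fun h0 => hψ0 <| by
    refine eq_zero_of_inner_expVec fun g => ?_
    rw [← inner_conj_symm, map_eq_zero]
    have hfin : ∀ t : Finset ℕ, inner ℂ (expVec (∑ l ∈ t, lp.single 2 l (g l))) ψ = 0 := fun t => by
      classical
      induction t using Finset.induction_on with
      | empty => simpa using h0
      | insert l t hl ih =>
        have := key l (∑ i ∈ insert l t, lp.single 2 i (g i)) (g l)
        rw [Finset.sum_insert hl, add_sub_cancel_left, ih, eq_comm, mul_eq_zero] at this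
        rw [Finset.sum_insert hl]
        exact this.resolve_right (Complex.exp_ne_zero _)
    have hlim : Filter.Tendsto (fun t : Finset ℕ =>
        inner ℂ (expVec (∑ l ∈ t, lp.single 2 l (g l))) ψ) Filter.atTop
        (nhds (inner ℂ (expVec g) ψ)) := by
      have hc : Continuous fun f => inner ℂ (expVec f) ψ :=
        continuous_expVec.inner continuous_const
      exact (hc.tendsto g).comp (lp.hasSum_single (by norm_num) g)
    simp only [hfin] at hlim
    exact tendsto_nhds_unique hlim tendsto_const_nhds
  have hcoeff : ∀ l, ψ (Finsupp.single l 2) / (Real.sqrt (Nat.factorial 2 : ℝ) : ℂ)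
      = inner ℂ (expVec 0) ψ * (squeezeCoeff (-β l / α l) 2
        / (Real.sqrt (Nat.factorial 2 : ℝ) : ℂ)) := fun l => by
    refine coeff_eq_of_hasSum (f := fun z => inner ℂ (expVec 0) ψ
      * Complex.exp (-β l / α l * z ^ 2 / 2))
      (c := fun k => ψ (Finsupp.single l k) / (Real.sqrt (Nat.factorial k : ℝ) : ℂ))
      (d := fun k => inner ℂ (expVec 0) ψ * (squeezeCoeff (-β l / α l) k
        / (Real.sqrt (Nat.factorial k : ℝ) : ℂ)))
      (fun z => ?_) (fun z => ?_) 2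
    · have h1 := hasSum_inner_expVec_single l (conj z) ψ
      have h2 := key l 0 (-conj z)
      rw [zero_sub, lp.single_neg, neg_neg] at h2
      rw [h2, Complex.conj_conj] at h1
      convert h1 using 3
      simp
      ring
    · refine ((hasSum_squeezeCoeff (-β l / α l) z).mul_left _).congr_fun fun k => ?_
      ring
  have hsum : Summable fun l => ‖-β l / α l‖ ^ 2 := by
    have h1 : Summable fun n => ‖ψ n‖ ^ 2 := by
      have := (memℓp_gen_iff (p := 2) (by norm_num)).mp (lp.memℓp ψ)
      simpa using this
    have h2 := h1.comp_injective (i := fun l : ℕ => Finsupp.single l 2)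
      (Finsupp.single_left_injective two_ne_zero)
    refine (h2.mul_left (2 / ‖inner ℂ (expVec 0) ψ‖ ^ 2)).congr fun l => ?_
    have h3 : ψ (Finsupp.single l 2)
        = inner ℂ (expVec 0) ψ * (-β l / α l * (Real.sqrt 2 : ℂ) / 2) := by
      have h4 := hcoeff l
      have h5 := squeezeCoeff_even (-β l / α l) 1
      have h6 : (Real.sqrt (Nat.factorial 2 : ℝ) : ℂ) ≠ 0 := by
        simp
      rw [mul_one, pow_one, pow_one, Nat.factorial_one, Nat.cast_one, mul_one] at h5
      rw [← mul_div_assoc, div_left_inj' h6, h5] at h4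
      rw [h4, Nat.factorial_two, Nat.cast_ofNat]
    have hn : ‖inner ℂ (expVec 0) ψ‖ ≠ 0 := by simpa using hΨ
    rw [Function.comp, h3]
    simp only [norm_mul, norm_div, norm_neg, Complex.norm_real, Complex.norm_ofNat, mul_pow,
      div_pow, Real.norm_of_nonneg (Real.sqrt_nonneg _), Real.sq_sqrt zero_le_two]
    field_simp
  refine Summable.of_norm_bounded_eventually_nat (hsum.mul_left 2) ?_
  filter_upwards [hsum.tendsto_atTop_zero.eventually_le_const (show (0 : ℝ) < 1 / 2 by norm_num)]
    with l hl
  have h1 := normSq_bogoliubov_ratio hαβ l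
  have h2 : (1 + ‖β l‖ ^ 2)⁻¹ * (1 + ‖β l‖ ^ 2) = 1 := inv_mul_cancel₀ (by positivity)
  rw [← h1] at h2
  rw [Real.norm_of_nonneg (by positivity)]
  nlinarith [sq_nonneg ‖β l‖]

theorem summable_of_evolutionImplementable {ρ ν : ℕ → ℝ} (hρ : ∀ l, 0 < ρ l) {t₁ t₀ : ℝ}
    (h1 : t₁ ∈ Set.Ioo 0 Real.pi) (h0 : t₀ ∈ Set.Ioo 0 Real.pi)
    (h : EvolutionImplementable ρ ν t₁ t₀) :
    Summable fun l => ‖bogoliubovBeta ρ ν l t₁ t₀‖ ^ 2 := by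
  obtain ⟨U, hU⟩ := h
  refine summable_of_intertwine (U := U) (fun l => normSq_bogoliubovAlpha hρ l h1 h0)
    fun l c φ => ?_
  have := hU _ _ (isEvolved_modeField hρ l c h1 h0) _ _ (isPositiveFrequencyPart_modeField ρ ν l c)
    (isPositiveFrequencyPart_modeField ρ ν l _) φ
  rwa [LinearIsometryEquiv.symm_apply_eq] at this

end GowdyField

end

/-! ### Assembly of the four statements -/

theorem mainTheorem2 :
    (∀ φ : ℝ → ℝ → ℝ,
      IsMasslessSolution φ ↔ IsStaticSolution fun t θ => Real.sqrt (Real.sin t) * φ t θ) ∧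
    ∀ ρ ν : ℕ → ℝ, (∀ l, 0 < ρ l) →
      ((∀ t₁ ∈ Set.Ioo 0 Real.pi, ∀ t₀ ∈ Set.Ioo 0 Real.pi,
          Summable fun l => ‖bogoliubovBeta ρ ν l t₁ t₀‖ ^ 2) ↔
        Memℓp (fun l => ρ l - Real.sqrt (Real.pi / 2)) 2 ∧ Memℓp ν 2) ∧
      ((∀ t₁ ∈ Set.Ioo 0 Real.pi, ∀ t₀ ∈ Set.Ioo 0 Real.pi, EvolutionImplementable ρ ν t₁ t₀) ↔
        Memℓp (fun l => ρ l - Real.sqrt (Real.pi / 2)) 2 ∧ Memℓp ν 2) ∧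
      (Memℓp (fun l => ρ l - Real.sqrt (Real.pi / 2)) 2 ∧ Memℓp ν 2 →
        (∀ ξ : ℝ → ℝ → ℝ, IsStaticSolution ξ →
          ∃ b : OneParticle, IsPositiveFrequencyPart ρ ν ξ b) ∧
        ∀ t₁ ∈ Set.Ioo 0 Real.pi, ∀ t₀ ∈ Set.Ioo 0 Real.pi, EvolutionContinuous ρ ν t₁ t₀) := by
  refine ⟨isMasslessSolution_iff, fun ρ ν hρ => ⟨summable_beta_iff hρ, ⟨fun h => ?_, fun h => ?_⟩,
    fun h => ?_⟩⟩
  · exact (summable_beta_iff hρ).mp fun t₁ h1 t₀ h0 =>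
      summable_of_evolutionImplementable hρ h1 h0 (h t₁ h1 t₀ h0)
  · exact fun t₁ h1 t₀ h0 => evolutionImplementable_of_summable hρ h1 h0
      ((summable_beta_iff hρ).mpr h t₁ h1 t₀ h0)
  · exact ⟨fun ξ hξ => hξ.exists_positiveFrequencyPart hρ ((summable_refB_iff hρ).mpr h),
      fun t₁ h1 t₀ h0 => evolutionContinuous hρ h1 h0 ((summable_beta_iff hρ).mpr h t₁ h1 t₀ h0)⟩
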